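/- Let $n,\Delta\ge 1$ be integers. A set $S\subseteq\mathbb R^n$ is a $\Delta$-modular simplex if it is an $n$-dimensional simplex (the convex hull of $n+1$ affinely independent points) and $S=\{x\in\mathbb R^n : Ax\le b\}$ for some $A\in\mathbb Z^{(n+1)\times n}$ of rank $n$ and $b\in\mathbb Z^{n+1}$ such that all $n\times n$ sub-determinants of $A$ are at most $\Delta$ in absolute value (such a matrix $A$ is called $\Delta$-modular). A simplex $S$ is called empty if $S\cap\mathbb Z^n=\emptyset$; it is called an empty lattice-simplex if all its vertices are in $\mathbb Z^n$ and $S\cap\mathbb Z^n$ is exactly the set of its vertices. Simplices $S,T\subseteq\mathbb R^n$ are unimodular equivalent if $T=\{Ux+x_0 : x\in S\}$ for some $U\in\mathbb Z^{n\times n}$ with $\det U=\pm1$ and some $x_0\in\mathbb Z^n$. There is an algorithm that, given $n\ge1$ and $\Delta\ge1$, outputs two lists of systems $Ax\le b$ with $\Delta$-modular matrices $A$ of rank $n$. The first list consists of exactly one representative of every unimodular equivalence class of $\Delta$-modular empty simplices in $\mathbb R^n$, and the second one of exactly one representative of every unimodular equivalence class of $\Delta$-modular empty lattice-simplices in $\mathbb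 R^n$. For an absolute constant $C>0$, the number of steps of the algorithm is at most $$C\cdot\bigl(C\,(n+\Delta)\bigr)^{\Delta-1}\cdot n^{\log_2(\Delta)+C},$$ and hence, for every fixed $\Delta$, it is bounded by a polynomial in $n$. (Steps are counted in a model in which a pointer operation on integer-labelled trees costs one step, and arithmetic on integers costs its number of bit operations.) -/

import Mathlib

namespace DeltaSimplex

/-! ### The machine model -/

/-- Data of the machine: binary trees (LISP S-expressions) whose leaves are integers. -/
inductive Val where
  | int (z : ℤ) : Val
  | pair (a b : Val) : Val

namespace Val

/-- Tests succeed exactly on positive integers. -/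
def IsTrue : Val → Prop
  | int z => 0 < z
  | pair _ _ => False

/-- The usual list encoding: `0` for the empty list, pairs for `cons`. -/
def ofList : List Val → Val
  | [] => int 0
  | a :: l => pair a (ofList l)

end Val

/-- The bit length of an integer (of its absolute value). -/
def bits (z : ℤ) : ℕ := Nat.size z.natAbs

/-- The elementary instructions. The binary arithmetic instructions read a pair of integers;
`quo` is integer division rounding down for positive divisors (and `0` for divisor `0`). -/
inductive Instr where
  | id : Instr
  | const (z : ℤ) : Instr
  | fst : Instr
  | snd : Instr
  | isInt : Instr
  | add : Instr
  | sub : Instr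
  | mul : Instr
  | quo : Instr

/-- The result of an instruction; an instruction that does not apply to its argument gives `0`. -/
def Instr.apply : Instr → Val → Val
  | .id, x => x
  | .const z, _ => .int z
  | .fst, .pair a _ => a
  | .snd, .pair _ b => b
  | .isInt, .int _ => .int 1
  | .add, .pair (.int a) (.int b) => .int (a + b)
  | .sub, .pair (.int a) (.int b) => .int (a - b)
  | .mul, .pair (.int a) (.int b) => .int (a * b)
  | .quo, .pair (.int a) (.int b) => .int (a / b)
  | _, _ => .int 0

/-- The cost of an instruction: one step for every pointer operation, and the number of bit
operations of the school method for arithmetic. -/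
def Instr.cost : Instr → Val → ℕ
  | .add, .pair (.int a) (.int b) => 1 + bits a + bits b
  | .sub, .pair (.int a) (.int b) => 1 + bits a + bits b
  | .mul, .pair (.int a) (.int b) => (1 + bits a) * (1 + bits b)
  | .quo, .pair (.int a) (.int b) => (1 + bits a) * (1 + bits b)
  | _, _ => 1

/-- Programs: a finite text, built from instructions by pairing the results of two programs,
sequential composition, branching, and while-loops. -/
inductive Prog where
  | instr (o : Instr) : Prog
  | pair (p q : Prog) : Prog
  | seq (p q : Prog) : Prog
  | ite (c p q : Prog) : Prog
  | loop (c p : Prog) : Prog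

/-- `Run p x y t`: the program `p`, started on the input `x`, halts with the output `y`
after exactly `t` steps. -/
inductive Run : Prog → Val → Val → ℕ → Prop where
  | instr (o : Instr) (x : Val) : Run (.instr o) x (o.apply x) (o.cost x)
  | pair {p q : Prog} {x a b : Val} {s t : ℕ} :
      Run p x a s → Run q x b t → Run (.pair p q) x (.pair a b) (s + t + 1)
  | seq {p q : Prog} {x y z : Val} {s t : ℕ} :
      Run p x y s → Run q y z t → Run (.seq p q) x z (s + t + 1)
  | ite_true {c p q : Prog} {x d y : Val} {s t : ℕ} :
      Run c x d s → d.IsTrue → Run p x y t → Run (.ite c p q) x y (s + t + 1)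
  | ite_false {c p q : Prog} {x d y : Val} {s t : ℕ} :
      Run c x d s → ¬ d.IsTrue → Run q x y t → Run (.ite c p q) x y (s + t + 1)
  | loop_stop {c p : Prog} {x d : Val} {s : ℕ} :
      Run c x d s → ¬ d.IsTrue → Run (.loop c p) x x (s + 1)
  | loop_step {c p : Prog} {x d y z : Val} {s t u : ℕ} :
      Run c x d s → d.IsTrue → Run p x y t → Run (.loop c p) y z u →
        Run (.loop c p) x z (s + t + u + 1)

/-! ### Modular simplices -/

/-- An integer matrix is `Δ`-modular if all its sub-determinants of order `rank A` are at most
`Δ` in absolute value. Order embeddings choose the subsets of rows and columns. -/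
def IsModularMatrix {m n : ℕ} (Δ : ℕ) (A : Matrix (Fin m) (Fin n) ℤ) : Prop :=
  ∀ (I : Fin (A.map (Int.cast : ℤ → ℚ)).rank ↪o Fin m)
    (J : Fin (A.map (Int.cast : ℤ → ℚ)).rank ↪o Fin n), |(A.submatrix I J).det| ≤ (Δ : ℤ)

/-- A system `A x ≤ b` of `n + 1` integer linear inequalities in `n` variables. -/
structure System (n : ℕ) where
  A : Matrix (Fin (n + 1)) (Fin n) ℤ
  b : Fin (n + 1) → ℤ

namespace System

/-- The set of real solutions of the system. -/
def polyhedron {n : ℕ} (σ : System n) : Set (Fin n → ℝ) :=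
  {x | ∀ i, ∑ j, (σ.A i j : ℝ) * x j ≤ (σ.b i : ℝ)}

/-- The matrix of the system has rank `n` and is `Δ`-modular. -/
def IsModular {n : ℕ} (Δ : ℕ) (σ : System n) : Prop :=
  (σ.A.map (Int.cast : ℤ → ℚ)).rank = n ∧ IsModularMatrix Δ σ.A

/-- The list of the rows of the extended matrix `(A b)`. -/
def encode {n : ℕ} (σ : System n) : Val :=
  Val.ofList (List.ofFn fun i =>
    Val.ofList (List.ofFn (fun j => Val.int (σ.A i j)) ++ [Val.int (σ.b i)]))

end System

/-- A full-dimensional simplex: the convex hull of `n + 1` affinely independent points of `ℝⁿ`. -/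
def IsSimplex {n : ℕ} (S : Set (Fin n → ℝ)) : Prop :=
  ∃ v : Fin (n + 1) → (Fin n → ℝ), AffineIndependent ℝ v ∧ S = convexHull ℝ (Set.range v)

/-- A simplex that can be defined by a system `A x ≤ b` with a `Δ`-modular matrix `A`. -/
def IsModularSimplex {n : ℕ} (Δ : ℕ) (S : Set (Fin n → ℝ)) : Prop :=
  IsSimplex S ∧ ∃ σ : System n, σ.IsModular Δ ∧ S = σ.polyhedron

/-- The points of `ℝⁿ` with integer coordinates. -/
def integerPoints (n : ℕ) : Set (Fin n → ℝ) :=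
  {x | ∃ z : Fin n → ℤ, x = fun i => (z i : ℝ)}

/-- `Δ`-modular empty simplices: they contain no integer point. -/
def IsModularEmptySimplex {n : ℕ} (Δ : ℕ) (S : Set (Fin n → ℝ)) : Prop :=
  IsModularSimplex Δ S ∧ S ∩ integerPoints n = ∅

/-- `Δ`-modular empty lattice-simplices: the vertices are integer points, and there are no other
integer points in the simplex. -/
def IsModularEmptyLatticeSimplex {n : ℕ} (Δ : ℕ) (S : Set (Fin n → ℝ)) : Prop :=
  IsModularSimplex Δ S ∧ S.extremePoints ℝ ⊆ integerPoints n ∧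
    S ∩ integerPoints n = S.extremePoints ℝ

/-- Some unimodular affine map `x ↦ U x + x₀` maps `S` onto `T`. -/
def UnimodularEquiv {n : ℕ} (S T : Set (Fin n → ℝ)) : Prop :=
  ∃ (U : Matrix (Fin n) (Fin n) ℤ) (x₀ : Fin n → ℤ), IsUnit U.det ∧
    (fun (x : Fin n → ℝ) (i : Fin n) => (∑ j, (U i j : ℝ) * x j) + (x₀ i : ℝ)) '' S = T

/-- The list `L` of systems with `Δ`-modular matrices consists of exactly one representative of
every unimodular equivalence class of the simplices with the property `P`. -/
def ListsRepresentatives {n : ℕ} (Δ : ℕ) (P : Set (Fin n → ℝ) → Prop)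
    (L : List (System n)) : Prop :=
  (∀ σ ∈ L, σ.IsModular Δ ∧ P σ.polyhedron) ∧
  (∀ S : Set (Fin n → ℝ), P S → ∃ σ ∈ L, UnimodularEquiv S σ.polyhedron) ∧
  L.Pairwise fun σ τ => ¬ UnimodularEquiv σ.polyhedron τ.polyhedron

/-- The encoding of a list of systems. -/
def encodeList {n : ℕ} (L : List (System n)) : Val := Val.ofList (L.map System.encode)

/-- The program `p`, given `n` and `Δ` (in binary), halts after exactly `t` steps, and its output
is a pair of lists: one representative of every unimodular equivalence class of `Δ`-modular empty
simplices in `ℝⁿ`, and the same for `Δ`-modular empty lattice-simplices. -/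
def Enumerates (p : Prog) (n Δ t : ℕ) : Prop :=
  ∃ L M : List (System n),
    ListsRepresentatives Δ (IsModularEmptySimplex Δ) L ∧
    ListsRepresentatives Δ (IsModularEmptyLatticeSimplex Δ) M ∧
    Run p (.pair (.int n) (.int Δ)) (.pair (encodeList L) (encodeList M)) t

end DeltaSimplex

namespace DeltaSimplex

/-! ### Typed polynomial-time programs -/

/-- Types whose elements are represented as data of the machine. -/
class Enc (α : Type) where
  enc : α → Val

open Enc

instance : Enc ℤ := ⟨Val.int⟩
instance : Enc Bool := ⟨fun b => Val.int (cond b 1 0)⟩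
instance {α β : Type} [Enc α] [Enc β] : Enc (α × β) := ⟨fun p => Val.pair (enc p.1) (enc p.2)⟩
instance {α : Type} [Enc α] : Enc (List α) := ⟨fun l => Val.ofList (l.map enc)⟩

/-- The size of a tree, counting the bits of its leaves. -/
def Val.size : Val → ℕ
  | .int z => 1 + bits z
  | .pair a b => 1 + a.size + b.size

/-- The size of the representation. -/
def sz {α : Type} [Enc α] (a : α) : ℕ := (enc a).size

section sizes
variable {α β : Type} [Enc α] [Enc β]

theorem enc_nil : enc ([] : List α) = Val.int 0 := rfl
theorem enc_cons (a : α) (l : List α) : enc (a :: l) = Val.pair (enc a) (enc l) := rfl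

theorem sz_pair (a : α) (b : β) : sz (a, b) = 1 + sz a + sz b := rfl
theorem sz_int (z : ℤ) : sz z = 1 + bits z := rfl
theorem sz_nil : sz ([] : List α) = 1 := by simp [sz, enc_nil, Val.size, bits]
theorem sz_cons (a : α) (l : List α) : sz (a :: l) = 1 + sz a + sz l := rfl
theorem sz_bool (b : Bool) : sz b ≤ 2 := by cases b <;> simp [sz, enc, Val.size, bits]
theorem sz_pos (a : α) : 1 ≤ sz a := by
  unfold sz; cases enc a <;> (simp [Val.size]; try omega)

theorem sz_list (l : List α) : sz l = 1 + (l.map fun a => 1 + sz a).sum := by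
  induction l with
  | nil => simp [sz_nil]
  | cons a l ih => rw [sz_cons, ih]; simp; omega

theorem length_le_sz (l : List α) : l.length ≤ sz l := by
  induction l with
  | nil => simp
  | cons a l ih => rw [sz_cons]; simp; omega

theorem sz_mem_le {l : List α} {a : α} (h : a ∈ l) : sz a ≤ sz l := by
  induction l with
  | nil => simp at h
  | cons b l ih =>
    rw [sz_cons]
    rcases List.mem_cons.1 h with rfl | h
    · omega
    · have := ih h; omega

theorem sz_list_le (l : List α) (B : ℕ) (h : ∀ a ∈ l, sz a ≤ B) : sz l ≤ 1 + l.length * (1 + B) := by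
  induction l with
  | nil => simp [sz_nil]
  | cons b l ih =>
    rw [sz_cons]
    have h1 := h b (by simp)
    have h2 := ih fun a ha => h a (by simp [ha])
    simp only [List.length_cons]; nlinarith

theorem sz_append (l l' : List α) : sz (l ++ l') + 1 = sz l + sz l' := by
  induction l with
  | nil => simp [sz_nil]; omega
  | cons a l ih => simp only [List.cons_append, sz_cons]; omega

theorem sz_reverse (l : List α) : sz l.reverse = sz l := by
  rw [sz_list, sz_list, List.map_reverse, List.sum_reverse]

theorem sz_sublist {l l' : List α} (h : l.Sublist l') : sz l ≤ sz l' := by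
  induction h with
  | slnil => exact le_rfl
  | cons a _ ih => rw [sz_cons]; omega
  | cons_cons a _ ih => rw [sz_cons, sz_cons]; omega

end sizes

/-! ### Polynomial bounds -/

/-- `g` is bounded by a polynomial in `μ`. -/
def PB {α : Type} (μ g : α → ℕ) : Prop := ∃ c, ∀ a, g a ≤ (μ a + 2) ^ c

namespace PB
variable {α β : Type} {μ g h : α → ℕ}

theorem mono (hg : PB μ g) (hh : ∀ a, h a ≤ g a) : PB μ h :=
  hg.imp fun _ hc a => (hh a).trans (hc a)

theorem const (k : ℕ) : PB μ fun _ => k :=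
  ⟨k, fun a => (Nat.lt_two_pow_self (n := k)).le.trans (Nat.pow_le_pow_left (by omega) k)⟩

theorem self : PB μ μ := ⟨1, fun a => by simp⟩

theorem add (hg : PB μ g) (hh : PB μ h) : PB μ fun a => g a + h a := by
  obtain ⟨c, hc⟩ := hg
  obtain ⟨d, hd⟩ := hh
  refine ⟨c + d + 1, fun a => ?_⟩
  have h1 : (μ a + 2) ^ c ≤ (μ a + 2) ^ (c + d) := Nat.pow_le_pow_right (by omega) (by omega)
  have h2 : (μ a + 2) ^ d ≤ (μ a + 2) ^ (c + d) := Nat.pow_le_pow_right (by omega) (by omega)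
  have := hc a
  have := hd a
  calc g a + h a ≤ (μ a + 2) ^ (c + d) * 2 := by omega
    _ ≤ (μ a + 2) ^ (c + d) * (μ a + 2) := Nat.mul_le_mul_left _ (by omega)
    _ = _ := (pow_succ _ _).symm

theorem mul (hg : PB μ g) (hh : PB μ h) : PB μ fun a => g a * h a := by
  obtain ⟨c, hc⟩ := hg
  obtain ⟨d, hd⟩ := hh
  exact ⟨c + d, fun a => by rw [pow_add]; exact Nat.mul_le_mul (hc a) (hd a)⟩

theorem pow (hg : PB μ g) (k : ℕ) : PB μ fun a => g a ^ k := by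
  induction k with
  | zero => simpa using PB.const 1
  | succ k ih => simpa [pow_succ] using ih.mul hg

theorem trans (hg : PB g h) (hh : PB μ g) : PB μ h := by
  obtain ⟨c, hc⟩ := hg
  have h2 := (hh.add (PB.const 2)).pow c
  exact h2.mono hc

theorem comp (hg : PB μ g) (f : β → α) : PB (fun b => μ (f b)) fun b => g (f b) :=
  hg.imp fun _ hc b => hc (f b)

end PB

/-- `f` is computed by a program with running time and size of the output polynomial in `μ`. -/
def PolyOn {α β : Type} [Enc α] [Enc β] (μ : α → ℕ) (f : α → β) : Prop :=
  ∃ (p : Prog) (T : α → ℕ), PB μ T ∧ PB μ (fun a => sz (f a)) ∧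
    ∀ a, ∃ t ≤ T a, Run p (enc a) (enc (f a)) t

/-- `f` is computed in polynomial time. -/
@[fun_prop]
def PT {α β : Type} [Enc α] [Enc β] (f : α → β) : Prop := PolyOn (fun a => sz a) f

namespace PolyOn
variable {α β γ : Type} [Enc α] [Enc β] [Enc γ] {μ : α → ℕ}

theorem comp {g : β → γ} {f : α → β} (hg : PT g) (hf : PolyOn μ f) : PolyOn μ fun a => g (f a) := by
  obtain ⟨p, T, hT, hs, h⟩ := hg
  obtain ⟨q, U, hU, hs', h'⟩ := hf
  refine ⟨q.seq p, fun a => U a + T (f a) + 1, (hU.add ((hT.comp f).trans hs')).add (PB.const 1),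
    (hs.comp f).trans hs', fun a => ?_⟩
  obtain ⟨t, ht, hr⟩ := h' a
  obtain ⟨u, hu, hr'⟩ := h (f a)
  exact ⟨_, by dsimp only; omega, hr.seq hr'⟩

theorem prodMk {f : α → β} {g : α → γ} (hf : PolyOn μ f) (hg : PolyOn μ g) :
    PolyOn μ fun a => (f a, g a) := by
  obtain ⟨p, T, hT, hs, h⟩ := hf
  obtain ⟨q, U, hU, hs', h'⟩ := hg
  refine ⟨p.pair q, fun a => T a + U a + 1, (hT.add hU).add (PB.const 1),
    ((PB.const 1).add hs).add hs', fun a => ?_⟩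
  obtain ⟨t, ht, hr⟩ := h a
  obtain ⟨u, hu, hr'⟩ := h' a
  exact ⟨_, by dsimp only; omega, hr.pair hr'⟩

theorem of_id (h : PB μ fun a => sz a) : PolyOn μ fun a : α => a :=
  ⟨.instr .id, fun _ => 1, PB.const 1, h, fun a => ⟨1, le_rfl, Run.instr .id (enc a)⟩⟩

theorem of_pt {f : α → β} (hf : PT f) (h : PB μ fun a => sz a) : PolyOn μ f :=
  comp hf (of_id h)

theorem isTrue_enc (b : Bool) : (enc b).IsTrue ↔ b = true := by cases b <;> simp [enc, Val.IsTrue]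

theorem cond {c : α → Bool} {f g : α → β} (hc : PolyOn μ c) (hf : PolyOn μ f) (hg : PolyOn μ g) :
    PolyOn μ fun a => bif c a then f a else g a := by
  obtain ⟨r, V, hV, -, h''⟩ := hc
  obtain ⟨p, T, hT, hs, h⟩ := hf
  obtain ⟨q, U, hU, hs', h'⟩ := hg
  refine ⟨.ite r p q, fun a => V a + (T a + U a) + 1, (hV.add (hT.add hU)).add (PB.const 1),
    (hs.add hs').mono fun a => ?_, fun a => ?_⟩
  · dsimp only; cases c a <;> simp
  · obtain ⟨t, ht, hr⟩ := h a
    obtain ⟨u, hu, hr'⟩ := h' a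
    obtain ⟨v, hv, hr''⟩ := h'' a
    rcases hca : c a
    · exact ⟨v + u + 1, by dsimp only; omega, by
        simpa [hca] using Run.ite_false (p := p) hr'' (by rw [isTrue_enc, hca]; simp) hr'⟩
    · exact ⟨v + t + 1, by dsimp only; omega, by
        simpa [hca] using Run.ite_true (q := q) hr'' (by rw [isTrue_enc, hca]) hr⟩

end PolyOn

/-- A program that builds a given value. -/
def Val.build : Val → Prog
  | .int z => .instr (.const z)
  | .pair a b => .pair a.build b.build

theorem Val.run_build (v x : Val) : ∃ t ≤ 2 * v.size, Run v.build x v t := by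
  induction v with
  | int z => exact ⟨1, by simp [Val.size]; omega, Run.instr (.const z) x⟩
  | pair a b iha ihb =>
    obtain ⟨s, hs, h⟩ := iha
    obtain ⟨t, ht, h'⟩ := ihb
    exact ⟨_, by simp [Val.size]; omega, h.pair h'⟩

/-- Comparison of integers. -/
def ltb (a b : ℤ) : Bool := decide (a < b)
/-- Comparison of integers. -/
def leb (a b : ℤ) : Bool := decide (a ≤ b)
/-- Comparison of integers. -/
def eqb (a b : ℤ) : Bool := decide (a = b)

@[simp] theorem ltb_eq_true {a b : ℤ} : ltb a b = true ↔ a < b := by simp [ltb]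
@[simp] theorem leb_eq_true {a b : ℤ} : leb a b = true ↔ a ≤ b := by simp [leb]
@[simp] theorem eqb_eq_true {a b : ℤ} : eqb a b = true ↔ a = b := by simp [eqb]

namespace PT
variable {α β γ : Type} [Enc α] [Enc β] [Enc γ]

@[fun_prop] theorem id' : PT fun a : α => a := PolyOn.of_id PB.self

@[fun_prop] theorem const (b : β) : PT fun _ : α => b :=
  ⟨(enc b).build, fun _ => 2 * sz b, PB.const _, PB.const _, fun a => (enc b).run_build (enc a)⟩

@[fun_prop] theorem comp {g : β → γ} {f : α → β} (hg : PT g) (hf : PT f) : PT fun a => g (f a) :=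
  PolyOn.comp hg hf

@[fun_prop] theorem prodMk {f : α → β} {g : α → γ} (hf : PT f) (hg : PT g) :
    PT fun a => (f a, g a) := PolyOn.prodMk hf hg

theorem prim {f : α → β} (o : Instr) (T : α → ℕ) (hT : PB (fun a => sz a) T)
    (hs : PB (fun a => sz a) fun a => sz (f a)) (h : ∀ a, o.apply (enc a) = enc (f a))
    (hc : ∀ a, o.cost (enc a) ≤ T a) : PT f :=
  ⟨.instr o, T, hT, hs, fun a => ⟨_, hc a, h a ▸ Run.instr o (enc a)⟩⟩

theorem fst' : PT (Prod.fst : α × β → α) :=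
  prim .fst (fun _ => 1) (PB.const 1) (PB.self.mono fun a => by
    obtain ⟨a, b⟩ := a; simp only [sz_pair]; omega) (fun _ => rfl) fun _ => le_rfl

theorem snd' : PT (Prod.snd : α × β → β) :=
  prim .snd (fun _ => 1) (PB.const 1) (PB.self.mono fun a => by
    obtain ⟨a, b⟩ := a; simp only [sz_pair]; omega) (fun _ => rfl) fun _ => le_rfl

@[fun_prop] theorem fst {f : α → β × γ} (hf : PT f) : PT fun a => (f a).1 := fst'.comp hf
@[fun_prop] theorem snd {f : α → β × γ} (hf : PT f) : PT fun a => (f a).2 := snd'.comp hf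

@[fun_prop] theorem cond {c : α → Bool} {f g : α → β} (hc : PT c) (hf : PT f) (hg : PT g) :
    PT fun a => cond (c a) (f a) (g a) := PolyOn.cond hc hf hg

theorem bits_le_of_lt {a : ℤ} {k : ℕ} (h : a.natAbs < 2 ^ k) : bits a ≤ k := Nat.size_le.2 h

theorem lt_two_pow_bits (a : ℤ) : a.natAbs < 2 ^ bits a := Nat.lt_size_self _

theorem bits_add (a b : ℤ) : bits (a + b) ≤ bits a + bits b := by
  rcases eq_or_ne a 0 with rfl | ha
  · simp [bits]
  rcases eq_or_ne b 0 with rfl | hb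
  · simp
  apply bits_le_of_lt
  have h1 := lt_two_pow_bits a
  have h2 := lt_two_pow_bits b
  have h3 := Int.natAbs_add_le a b
  have h4 : 1 ≤ a.natAbs := Int.natAbs_pos.2 ha
  have h5 : 1 ≤ b.natAbs := Int.natAbs_pos.2 hb
  rw [pow_add]
  nlinarith

theorem bits_sub (a b : ℤ) : bits (a - b) ≤ bits a + bits b := by
  have := bits_add a (-b)
  rwa [← sub_eq_add_neg, show bits (-b) = bits b by simp [bits]] at this

theorem bits_mul (a b : ℤ) : bits (a * b) ≤ bits a + bits b := by
  apply bits_le_of_lt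
  rw [Int.natAbs_mul, pow_add]
  exact Nat.mul_lt_mul'' (lt_two_pow_bits a) (lt_two_pow_bits b)

theorem bits_div (a b : ℤ) : bits (a / b) ≤ bits a + 1 := by
  apply bits_le_of_lt
  have h1 := lt_two_pow_bits a
  have : (a / b).natAbs ≤ a.natAbs := Int.natAbs_ediv_le_natAbs a b
  rw [pow_succ]; omega

theorem arith (o : Instr) (f : ℤ → ℤ → ℤ) (h : ∀ a b, o.apply (.pair (.int a) (.int b)) = .int (f a b))
    (hc : ∀ a b, o.cost (.pair (.int a) (.int b)) ≤ (1 + bits a + bits b) ^ 2)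
    (hb : ∀ a b, bits (f a b) ≤ bits a + bits b + 1) : PT fun p : ℤ × ℤ => f p.1 p.2 := by
  refine prim o (fun a => sz a ^ 2) (PB.self.pow 2) (PB.self.mono ?_) ?_ ?_
  · rintro ⟨a, b⟩
    have := hb a b
    simp only [sz_pair, sz_int]; omega
  · rintro ⟨a, b⟩; exact h a b
  · rintro ⟨a, b⟩
    refine (hc a b).trans (Nat.pow_le_pow_left ?_ 2)
    simp only [sz_pair, sz_int]; omega

variable {f g : α → ℤ}

@[fun_prop] theorem add (hf : PT f) (hg : PT g) : PT fun a => f a + g a :=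
  (arith .add (· + ·) (fun _ _ => rfl) (fun a b => by simp only [Instr.cost]; nlinarith) fun a b =>
    (bits_add a b).trans (by omega)).comp (hf.prodMk hg)

@[fun_prop] theorem sub (hf : PT f) (hg : PT g) : PT fun a => f a - g a :=
  (arith .sub (· - ·) (fun _ _ => rfl) (fun a b => by simp only [Instr.cost]; nlinarith) fun a b =>
    (bits_sub a b).trans (by omega)).comp (hf.prodMk hg)

@[fun_prop] theorem mul (hf : PT f) (hg : PT g) : PT fun a => f a * g a :=
  (arith .mul (· * ·) (fun _ _ => rfl) (fun a b => by simp only [Instr.cost]; nlinarith) fun a b =>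
    (bits_mul a b).trans (by omega)).comp (hf.prodMk hg)

@[fun_prop] theorem div (hf : PT f) (hg : PT g) : PT fun a => f a / g a :=
  (arith .quo (· / ·) (fun _ _ => rfl) (fun a b => by simp only [Instr.cost]; nlinarith) fun a b =>
    (bits_div a b).trans (by omega)).comp (hf.prodMk hg)

@[fun_prop] theorem neg (hf : PT f) : PT fun a => - f a := by
  simpa using (const (0 : ℤ)).sub hf

theorem pos_decide (hf : PT f) : PT fun a => decide (0 < f a) := by
  have : PT fun z : ℤ => decide (0 < z) := by
    refine ⟨.ite (.instr .id) (.instr (.const 1)) (.instr (.const 0)), fun _ => 3, PB.const 3,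
      (PB.const 2).mono fun a => sz_bool _, fun z => ?_⟩
    by_cases h : 0 < z
    · exact ⟨3, le_rfl, by
        simpa [h, enc, Instr.cost, Instr.apply] using Run.ite_true (Run.instr .id (enc z)) (show (enc z).IsTrue from h)
          (Run.instr (.const 1) _)⟩
    · exact ⟨3, le_rfl, by
        simpa [h, enc, Instr.cost, Instr.apply] using Run.ite_false (Run.instr .id (enc z)) (show ¬ (enc z).IsTrue from h)
          (Run.instr (.const 0) _)⟩
  exact this.comp hf

theorem lt_decide (hf : PT f) (hg : PT g) : PT fun a => decide (f a < g a) := by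
  have := (hg.sub hf).pos_decide
  simpa using this

@[fun_prop] theorem not {c : α → Bool} (hc : PT c) : PT fun a => !(c a) := by
  have := hc.cond (const false) (const true)
  convert this using 2 with a
  cases c a <;> rfl

@[fun_prop] theorem and {c d : α → Bool} (hc : PT c) (hd : PT d) : PT fun a => c a && d a := by
  have := hc.cond hd (const false)
  convert this using 2 with a
  cases c a <;> rfl

@[fun_prop] theorem or {c d : α → Bool} (hc : PT c) (hd : PT d) : PT fun a => c a || d a := by
  have := hc.cond (const true) hd
  convert this using 2 with a
  cases c a <;> rfl

theorem le_decide (hf : PT f) (hg : PT g) : PT fun a => decide (f a ≤ g a) := by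
  have := (hg.lt_decide hf).not
  convert this using 2 with a
  grind

theorem eq_decide (hf : PT f) (hg : PT g) : PT fun a => decide (f a = g a) := by
  have := (hf.le_decide hg).and (hg.le_decide hf)
  convert this using 2 with a
  rw [Bool.eq_iff_iff]; simp [le_antisymm_iff]

@[fun_prop] theorem ltb (hf : PT f) (hg : PT g) : PT fun a => ltb (f a) (g a) := lt_decide hf hg

@[fun_prop] theorem leb (hf : PT f) (hg : PT g) : PT fun a => leb (f a) (g a) := le_decide hf hg

@[fun_prop] theorem eqb (hf : PT f) (hg : PT g) : PT fun a => eqb (f a) (g a) := eq_decide hf hg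

@[fun_prop] theorem cons {f : α → β} {l : α → List β} (hf : PT f) (hl : PT l) :
    PT fun a => f a :: l a := by
  obtain ⟨p, T, hT, hs, h⟩ := hf.prodMk hl
  exact ⟨p, T, hT, hs.mono fun a => le_rfl, h⟩

end PT
end DeltaSimplex

namespace DeltaSimplex
open Enc

/-! ### Loops over lists -/

namespace Prog

abbrev pfst : Prog := .instr .fst
abbrev psnd : Prog := .instr .snd

/-- On `(a, (l, s))`, is the list `l` nonempty? -/
def nonempty : Prog := .seq (.pair (.instr (.const 1)) (.seq (.seq psnd pfst) (.instr .isInt))) (.instr .sub)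

/-- `(a, (b :: l, s)) ↦ (a, (l, p (a, (s, b))))`. -/
def foldBody (p : Prog) : Prog :=
  .pair pfst (.pair (.seq (.seq psnd pfst) psnd)
    (.seq (.pair pfst (.pair (.seq psnd psnd) (.seq (.seq psnd pfst) pfst))) p))

/-- `(a, (l, s)) ↦ l.foldl (fun s b => p (a, (s, b))) s`. -/
def fold (p : Prog) : Prog := .seq (.loop nonempty (foldBody p)) (.seq psnd psnd)

end Prog

section
variable {α β γ σ : Type} [Enc α] [Enc β] [Enc γ] [Enc σ]

theorem run_nonempty (ea sv : Val) (l : List β) :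
    ∃ t ≤ 11, Run Prog.nonempty (.pair ea (.pair (enc l) sv)) (enc (!l.isEmpty)) t := by
  have h1 : Run (.seq Prog.psnd Prog.pfst) (.pair ea (.pair (enc l) sv)) (enc l) 3 :=
    (Run.instr .snd _).seq (Run.instr .fst _)
  cases l with
  | nil => exact ⟨_, by simp [Instr.cost, Instr.apply, enc_nil, bits], ((Run.instr (.const 1) _).pair
      (h1.seq (Run.instr .isInt _))).seq (Run.instr .sub _)⟩
  | cons b l => exact ⟨_, by simp [Instr.cost, Instr.apply, enc_cons, bits], ((Run.instr (.const 1) _).pair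
      (h1.seq (Run.instr .isInt _))).seq (Run.instr .sub _)⟩

theorem run_foldBody {p : Prog} {ea bv lv sv sv' : Val} {t : ℕ} (h : Run p (.pair ea (.pair sv bv)) sv' t) :
    Run (Prog.foldBody p) (.pair ea (.pair (.pair bv lv) sv)) (.pair ea (.pair lv sv')) (t + 20) := by
  have := (Run.instr .fst (.pair ea (.pair (.pair bv lv) sv))).pair
    ((((Run.instr .snd (.pair ea (.pair (.pair bv lv) sv))).seq (Run.instr .fst _)).seq
      (Run.instr .snd _)).pair
      (((Run.instr .fst (.pair ea (.pair (.pair bv lv) sv))).pair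
        (((Run.instr .snd (.pair ea (.pair (.pair bv lv) sv))).seq (Run.instr .snd _)).pair
        (((Run.instr .snd (.pair ea (.pair (.pair bv lv) sv))).seq (Run.instr .fst _)).seq
      (Run.instr .fst _)))).seq h))
  convert this using 1
  · rfl
  · rfl
  · simp [Instr.cost]; omega

theorem run_fold {p : Prog} (f : σ → β → σ) (ea : Val) (Inv : List β → σ → Prop) (B : ℕ)
    (h : ∀ s b l, Inv (b :: l) s → Inv l (f s b) ∧
      ∃ t ≤ B, Run p (.pair ea (.pair (enc s) (enc b))) (enc (f s b)) t) (l : List β) (s : σ) (hs : Inv l s) :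
    ∃ t ≤ l.length * (B + 35) + 20,
      Run (Prog.fold p) (.pair ea (.pair (enc l) (enc s))) (enc (l.foldl f s)) t := by
  have key : ∀ (l : List β) (s : σ), Inv l s → ∃ t ≤ l.length * (B + 35) + 12,
      Run (.loop Prog.nonempty (Prog.foldBody p)) (.pair ea (.pair (enc l) (enc s)))
        (.pair ea (.pair (.int 0) (enc (l.foldl f s)))) t := by
    intro l
    induction l with
    | nil =>
      intro s _
      obtain ⟨t, ht, hr⟩ := run_nonempty ea (enc s) ([] : List β)
      exact ⟨t + 1, by simp; omega, Run.loop_stop hr (by simp [enc, Val.IsTrue])⟩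
    | cons b l ih =>
      intro s hs
      obtain ⟨hi, u, hu, hb⟩ := h s b l hs
      obtain ⟨v, hv, hv'⟩ := ih _ hi
      obtain ⟨t, ht, hr⟩ := run_nonempty ea (enc s) (b :: l)
      refine ⟨_, ?_, Run.loop_step hr (by simp [enc, Val.IsTrue]) (run_foldBody hb) hv'⟩
      simp only [List.length_cons, add_mul]; omega
  obtain ⟨t, ht, hr⟩ := key l s hs
  exact ⟨t + 3 + 1, by omega, hr.seq ((Run.instr .snd _).seq (Run.instr .snd _))⟩

end

namespace Prog

/-- `(a, (s, b)) ↦ b :: s`. -/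
def push : Prog := .pair (.seq psnd psnd) (.seq psnd pfst)

/-- `(a, (s, b)) ↦ (p (a, b)).reverse ++ s`. -/
def flatMapStep (p : Prog) : Prog :=
  .seq (.pair pfst (.pair (.seq (.pair pfst (.seq psnd psnd)) p) (.seq psnd pfst))) (fold push)

/-- `(a, l) ↦ l.flatMap fun b => p (a, b)`. -/
def flatMap (p : Prog) : Prog :=
  .seq (.pair pfst (.pair (.seq (.pair pfst (.pair psnd (.instr (.const 0)))) (fold (flatMapStep p)))
    (.instr (.const 0)))) (fold push)

end Prog

section
variable {α β γ σ : Type} [Enc α] [Enc β] [Enc γ] [Enc σ]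

theorem run_push (ea : Val) (l s : List β) :
    ∃ t ≤ l.length * 42 + 20, Run (Prog.fold Prog.push) (.pair ea (.pair (enc l) (enc s)))
      (enc (l.reverse ++ s)) t := by
  have := run_fold (p := Prog.push) (fun (s : List β) b => b :: s) ea (fun _ _ => True) 7
    (fun s b l _ => ⟨trivial, 7, le_rfl,
      ((Run.instr .snd _).seq (Run.instr .snd _)).pair ((Run.instr .snd _).seq (Run.instr .fst _))⟩) l s trivial
  have e : l.foldl (fun (s : List β) b => b :: s) s = l.reverse ++ s := by
    induction l generalizing s with
    | nil => rfl
    | cons b l ih => simp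
  rwa [e] at this

theorem run_flatMap {p : Prog} (g : β → List γ) (ea : Val) (B M : ℕ) (l : List β)
    (h : ∀ b ∈ l, (g b).length ≤ M ∧ ∃ t ≤ B, Run p (.pair ea (enc b)) (enc (g b)) t) :
    ∃ t ≤ 200 * ((l.length + 1) * (B + M + 1)),
      Run (Prog.flatMap p) (.pair ea (enc l)) (enc (l.flatMap g)) t := by
  have h1 := run_fold (p := Prog.flatMapStep p) (fun (s : List γ) b => (g b).reverse ++ s) ea
    (fun l' _ => ∀ b ∈ l', b ∈ l) (B + M * 42 + 36) (fun s b l' hl => by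
      refine ⟨fun b hb => hl b (by simp [hb]), ?_⟩
      obtain ⟨hM, t, ht, hr⟩ := h b (hl b (by simp))
      obtain ⟨u, hu, hr'⟩ := run_push ea (g b) s
      have h1 : Run (.pair Prog.pfst (.seq Prog.psnd Prog.psnd)) (.pair ea (.pair (enc s) (enc b)))
        (.pair ea (enc b)) 5 := (Run.instr .fst _).pair ((Run.instr .snd _).seq (Run.instr .snd _))
      have h2 : Run (.seq Prog.psnd Prog.pfst) (.pair ea (.pair (enc s) (enc b)))
        (enc s) 3 := (Run.instr .snd _).seq (Run.instr .fst _)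
      refine ⟨_, ?_, ((Run.instr .fst _).pair ((h1.seq hr).pair h2)).seq hr'⟩
      simp only [Instr.cost]; omega) l [] fun b hb => hb
  have e : ∀ s : List γ, l.foldl (fun (s : List γ) b => (g b).reverse ++ s) s = (l.flatMap g).reverse ++ s := by
    clear h h1
    induction l with
    | nil => intro s; rfl
    | cons b l ih => intro s; simp [ih]
  rw [e, List.append_nil] at h1
  obtain ⟨t, ht, hr⟩ := h1
  obtain ⟨u, hu, hr'⟩ := run_push ea (l.flatMap g).reverse []
  rw [List.reverse_reverse, List.append_nil] at hr'
  have hlen : (l.flatMap g).length ≤ l.length * M := by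
    rw [List.length_flatMap]
    refine (List.sum_le_card_nsmul _ M ?_).trans (by simp)
    simp only [List.mem_map]
    rintro _ ⟨b, hb, rfl⟩
    exact (h b hb).1
  refine ⟨_, ?_, ((Run.instr .fst _).pair (Run.pair (((Run.instr .fst _).pair ((Run.instr .snd _).pair
    (Run.instr (.const 0) _))).seq hr) (Run.instr (.const 0) _))).seq hr'⟩
  simp only [Instr.cost, List.length_reverse] at hu ⊢
  nlinarith [Nat.zero_le (l.length * B), Nat.zero_le (l.length * M)]

end

namespace PolyOn
variable {α β γ σ : Type} [Enc α] [Enc β] [Enc γ] [Enc σ] {μ : α → ℕ}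

theorem congr {f g : α → β} (hf : PolyOn μ f) (h : ∀ a, f a = g a) : PolyOn μ g := by
  rwa [show g = f from funext fun a => (h a).symm]

theorem foldl_env {ε : Type} [Enc ε] {e : α → ε} {f : ε → σ → β → σ} {l : α → List β} {s : α → σ} (he : PolyOn μ e)
    (hf : PT fun q : ε × (σ × β) => f q.1 q.2.1 q.2.2) (hl : PolyOn μ l) (hs : PolyOn μ s)
    (N : α → ℕ) (hN : PB μ N)
    (hb : ∀ a l₁ l₂, l a = l₁ ++ l₂ → sz (l₁.foldl (f (e a)) (s a)) ≤ N a) :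
    PolyOn μ fun a => (l a).foldl (f (e a)) (s a) := by
  obtain ⟨p, T, hT, hsz, h⟩ := he.prodMk (hl.prodMk hs)
  obtain ⟨q, U, ⟨c, hc⟩, -, hU⟩ := hf
  have hl' : PB μ fun a => sz (l a) := hsz.mono fun a => by simp only [sz_pair]; omega
  have ha : PB μ fun a => sz (e a) := hsz.mono fun a => by simp only [sz_pair]; omega
  have hB : PB μ fun a => (sz (e a) + N a + sz (l a) + 4) ^ c :=
    (((ha.add hN).add hl').add (PB.const 4)).pow c
  refine ⟨p.seq (.fold q), fun a => T a + (sz (l a) * ((sz (e a) + N a + sz (l a) + 4) ^ c + 35) + 20) + 1,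
    (hT.add ((hl'.mul (hB.add (PB.const 35))).add (PB.const 20))).add (PB.const 1),
    hN.mono fun a => hb a (l a) [] (by simp), fun a => ?_⟩
  obtain ⟨t, ht, hr⟩ := h a
  obtain ⟨u, hu, hr'⟩ := run_fold (p := q) (f (e a)) (enc (e a))
    (fun l' s' => ∃ l₁, l a = l₁ ++ l' ∧ s' = l₁.foldl (f (e a)) (s a)) ((sz (e a) + N a + sz (l a) + 4) ^ c) (by
      rintro s' b l' ⟨l₁, h1, rfl⟩
      refine ⟨⟨l₁ ++ [b], by simp [h1], by simp⟩, ?_⟩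
      obtain ⟨v, hv, hr⟩ := hU (e a, l₁.foldl (f (e a)) (s a), b)
      refine ⟨v, hv.trans ((hc _).trans (Nat.pow_le_pow_left ?_ c)), hr⟩
      have h3 := hb a l₁ (b :: l') h1
      have h4 : sz b ≤ sz (l a) := sz_mem_le (by simp [h1])
      simp only [sz_pair]; omega) (l a) (s a) ⟨[], by simp, rfl⟩
  refine ⟨_, ?_, hr.seq hr'⟩
  have := Nat.mul_le_mul_right ((sz (e a) + N a + sz (l a) + 4) ^ c + 35) (length_le_sz (l a))
  dsimp only; omega

theorem foldl {f : α → σ → β → σ} {l : α → List β} {s : α → σ}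
    (hf : PT fun q : α × (σ × β) => f q.1 q.2.1 q.2.2) (hl : PolyOn μ l) (hs : PolyOn μ s)
    (ha : PB μ fun a => sz a) (N : α → ℕ) (hN : PB μ N)
    (hb : ∀ a l₁ l₂, l a = l₁ ++ l₂ → sz (l₁.foldl (f a) (s a)) ≤ N a) :
    PolyOn μ fun a => (l a).foldl (f a) (s a) :=
  foldl_env (of_id ha) hf hl hs N hN hb

theorem foldl_iterate {B S : Type} (l : List B) (g : S → S) (s : S) : l.foldl (fun s _ => g s) s = g^[l.length] s := by
  induction l generalizing s with
  | nil => rfl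
  | cons b l ih => simp [ih]

/-- The states of an iteration have to stay small. -/
theorem iterate {ε : Type} [Enc ε] {e : α → ε} {f : ε → σ → σ} {l : α → List β} {s : α → σ} (he : PolyOn μ e)
    (hf : PT fun q : ε × σ => f q.1 q.2) (hl : PolyOn μ l) (hs : PolyOn μ s) (N : α → ℕ) (hN : PB μ N)
    (hb : ∀ a, ∀ i ≤ (l a).length, sz ((f (e a))^[i] (s a)) ≤ N a) :
    PolyOn μ fun a => (f (e a))^[(l a).length] (s a) := by
  have := foldl_env (f := fun a s (_ : β) => f a s) (l := l) (s := s) he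
    (hf.comp (PT.fst'.prodMk (PT.snd'.fst))) hl hs N hN fun a l₁ l₂ h => by
      rw [foldl_iterate]; exact hb a _ (by simp [h])
  simpa only [foldl_iterate] using this

theorem flatMap {f : α → β → List γ} {l : α → List β}
    (hf : PT fun q : α × β => f q.1 q.2) (hl : PolyOn μ l) (ha : PB μ fun a => sz a) :
    PolyOn μ fun a => (l a).flatMap (f a) := by
  obtain ⟨p, T, hT, hsz, h⟩ := (of_id ha).prodMk hl
  obtain ⟨q, U, ⟨c, hc⟩, ⟨d, hd⟩, hU⟩ := hf
  have hl' : PB μ fun a => sz (l a) := hsz.mono fun a => by simp only [sz_pair]; omega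
  have hB := fun c => ((ha.add hl').add (PB.const 3)).pow c
  refine ⟨p.seq (.flatMap q), fun a => T a + 200 * ((sz (l a) + 1) * ((sz a + sz (l a) + 3) ^ c +
    (sz a + sz (l a) + 3) ^ d + 1)) + 1, (hT.add ((PB.const 200).mul ((hl'.add (PB.const 1)).mul
      (((hB c).add (hB d)).add (PB.const 1))))).add (PB.const 1),
      ((PB.const 1).add (hl'.mul (hB d))).mono fun a => ?_, fun a => ?_⟩
  · have h1 : ∀ b ∈ l a, sz (f a b) ≤ (sz a + sz (l a) + 3) ^ d := fun b hb =>
      (hd (a, b)).trans (Nat.pow_le_pow_left (by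
        have := sz_mem_le hb
        simp only [sz_pair]; omega) d)
    have h2 : ∀ l' : List β, (∀ b ∈ l', b ∈ l a) →
        sz (l'.flatMap (f a)) ≤ 1 + l'.length * ((sz a + sz (l a) + 3) ^ d) := by
      intro l'
      induction l' with
      | nil => intro _; simp [sz_nil]
      | cons b l' ih =>
        intro h
        have := sz_append (f a b) (l'.flatMap (f a))
        have h3 := ih fun b hb => h b (by simp [hb])
        have h4 := h1 b (h b (by simp))
        simp only [List.flatMap_cons, List.length_cons]
        nlinarith
    refine (h2 (l a) fun _ => id).trans ?_
    exact Nat.add_le_add_left (Nat.mul_le_mul_right _ (length_le_sz (l a))) 1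
  · obtain ⟨t, ht, hr⟩ := h a
    obtain ⟨u, hu, hr'⟩ := run_flatMap (p := q) (f a) (enc a) ((sz a + sz (l a) + 3) ^ c)
      ((sz a + sz (l a) + 3) ^ d) (l a) fun b hb => by
        have h3 : sz (a, b) + 2 ≤ sz a + sz (l a) + 3 := by
          have := sz_mem_le hb
          simp only [sz_pair]; omega
        obtain ⟨v, hv, hr⟩ := hU (a, b)
        exact ⟨(length_le_sz _).trans ((hd (a, b)).trans (Nat.pow_le_pow_left h3 d)),
          v, hv.trans ((hc _).trans (Nat.pow_le_pow_left h3 c)), hr⟩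
    refine ⟨_, ?_, hr.seq hr'⟩
    have := Nat.mul_le_mul_left 200 (Nat.mul_le_mul_right ((sz a + sz (l a) + 3) ^ c +
      (sz a + sz (l a) + 3) ^ d + 1) (Nat.add_le_add_right (length_le_sz (l a)) 1))
    dsimp only; omega

end PolyOn

namespace PT
variable {α β γ σ δ : Type} [Enc α] [Enc β] [Enc γ] [Enc σ] [Enc δ]

@[fun_prop] theorem flatMap {f : α → β → List γ} {l : α → List β}
    (hf : PT fun q : α × β => f q.1 q.2) (hl : PT l) : PT fun a => (l a).flatMap (f a) :=
  PolyOn.flatMap hf hl PB.self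

@[fun_prop] theorem map {f : α → β → γ} {l : α → List β}
    (hf : PT fun q : α × β => f q.1 q.2) (hl : PT l) : PT fun a => (l a).map (f a) := by
  have : PT fun a => (l a).flatMap fun b => [f a b] := flatMap (f := fun a b => [f a b])
    (hf.cons (const [])) hl
  simpa only [List.map_eq_flatMap] using this

end PT
end DeltaSimplex

namespace DeltaSimplex
open Enc

/-! ### Polynomial-time list processing -/

namespace PT
variable {α β γ σ δ : Type} [Enc α] [Enc β] [Enc γ] [Enc σ] [Enc δ]

theorem foldl {f : α → σ → β → σ} {l : α → List β} {s : α → σ}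
    (hf : PT fun q : α × (σ × β) => f q.1 q.2.1 q.2.2) (hl : PT l) (hs : PT s)
    (N : ℕ → ℕ) (hN : PB id N) (hmono : Monotone N)
    (h : ∀ a s b, sz (f a s b) ≤ sz s + N (sz a + sz b)) :
    PT fun a => (l a).foldl (f a) (s a) := by
  have hl' : PB (fun a : α => sz a) fun a => sz (l a) := hl.choose_spec.choose_spec.2.1
  have hs' : PB (fun a : α => sz a) fun a => sz (s a) := hs.choose_spec.choose_spec.2.1
  refine PolyOn.foldl hf hl hs PB.self (fun a => sz (s a) + sz (l a) * N (sz a + sz (l a)))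
    (hs'.add (hl'.mul ?_)) fun a l₁ l₂ e => ?_
  · exact PB.trans (g := fun a => sz a + sz (l a)) (hN.comp fun a => sz a + sz (l a)) (PB.self.add hl')
  · have key : ∀ (l' : List β) s', (∀ b ∈ l', b ∈ l a) →
        sz (l'.foldl (f a) s') ≤ sz s' + l'.length * N (sz a + sz (l a)) := by
      intro l'
      induction l' with
      | nil => intro s' _; simp
      | cons b l' ih =>
        intro s' hm
        have h1 := ih (f a s' b) fun c hc => hm c (by simp [hc])
        have h2 := h a s' b
        have h3 : N (sz a + sz b) ≤ N (sz a + sz (l a)) := hmono (by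
          have := sz_mem_le (hm b (by simp)); omega)
        simp only [List.foldl_cons, List.length_cons, add_mul]
        omega
    refine (key l₁ (s a) fun b hb => by simp [e, hb]).trans (Nat.add_le_add_left (Nat.mul_le_mul_right _ ?_) _)
    have := length_le_sz (l a)
    rw [e, List.length_append] at this
    rw [e]; omega

/-- The case of states that grow by a linear amount. -/
theorem foldl_linear {f : α → σ → β → σ} {l : α → List β} {s : α → σ} (k : ℕ)
    (hf : PT fun q : α × (σ × β) => f q.1 q.2.1 q.2.2) (hl : PT l) (hs : PT s)
    (h : ∀ a s b, sz (f a s b) ≤ sz s + k * (sz a + sz b)) :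
    PT fun a => (l a).foldl (f a) (s a) :=
  foldl hf hl hs (fun x => k * x) ((PB.const k).mul PB.self)
    (fun _ _ h => Nat.mul_le_mul_left k h) h

theorem reverse' : PT fun l : List β => l.reverse := by
  have := foldl_linear (α := List β) (f := fun (_ : List β) s b => b :: s) (l := fun l => l) (s := fun _ => []) 1
    (by fun_prop) (by fun_prop) (by fun_prop) (fun a s b => by
      have := sz_pos a
      rw [sz_cons]; omega)
  simpa using this

@[fun_prop] theorem reverse {l : α → List β} (hl : PT l) : PT fun a => (l a).reverse := reverse'.comp hl

theorem append' : PT fun p : List β × List β => p.1 ++ p.2 := by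
  have := foldl_linear (α := List β × List β) (f := fun _ s b => b :: s) (l := fun p => p.1.reverse) (s := fun p => p.2) 1
    (by fun_prop) (by fun_prop) (by fun_prop) (fun a s b => by
      have := sz_pos a
      rw [sz_cons]; omega)
  simpa using this

@[fun_prop] theorem append {l l' : α → List β} (hl : PT l) (hl' : PT l') : PT fun a => l a ++ l' a :=
  append'.comp (hl.prodMk hl')

theorem headD' : PT fun p : List β × β => p.1.headD p.2 := by
  have := foldl_linear (α := List β × β) (f := fun _ _ b => b) (l := fun p => p.1.reverse) (s := fun p => p.2) 1
    (by fun_prop) (by fun_prop) (by fun_prop) (fun a s b => by omega)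
  convert this using 2 with p
  obtain ⟨l, d⟩ := p
  cases l <;> simp

@[fun_prop] theorem headD {l : α → List β} {d : α → β} (hl : PT l) (hd : PT d) :
    PT fun a => (l a).headD (d a) := headD'.comp (hl.prodMk hd)

theorem tail' : PT fun l : List β => l.tail := by
  refine prim .snd (fun _ => 1) (PB.const 1) (PB.self.mono fun l => ?_) (fun l => ?_) fun l => ?_
  · cases l with
    | nil => exact le_rfl
    | cons b l => simp only [List.tail_cons, sz_cons]; omega
  · cases l <;> rfl
  · cases l <;> exact le_rfl

@[fun_prop] theorem tail {l : α → List β} (hl : PT l) : PT fun a => (l a).tail := tail'.comp hl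

theorem isEmpty' : PT fun l : List β => l.isEmpty := by
  refine prim .isInt (fun _ => 1) (PB.const 1) ((PB.const 2).mono fun l => sz_bool _) (fun l => ?_) fun l => ?_
  · cases l <;> rfl
  · cases l <;> exact le_rfl

@[fun_prop] theorem isEmpty {l : α → List β} (hl : PT l) : PT fun a => (l a).isEmpty := isEmpty'.comp hl

@[fun_prop] theorem filter {f : α → β → Bool} {l : α → List β}
    (hf : PT fun q : α × β => f q.1 q.2) (hl : PT l) : PT fun a => (l a).filter (f a) := by
  have : PT fun a => (l a).flatMap fun b => bif f a b then [b] else [] := by fun_prop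
  convert this using 2 with a
  generalize l a = l
  induction l with
  | nil => rfl
  | cons b l ih => cases h : f a b <;> simp [h, ih]

@[fun_prop] theorem any {f : α → β → Bool} {l : α → List β}
    (hf : PT fun q : α × β => f q.1 q.2) (hl : PT l) : PT fun a => (l a).any (f a) := by
  have : PT fun a => !((l a).filter (f a)).isEmpty := by fun_prop
  convert this using 2 with a
  rw [Bool.eq_iff_iff]
  simp

@[fun_prop] theorem all {f : α → β → Bool} {l : α → List β}
    (hf : PT fun q : α × β => f q.1 q.2) (hl : PT l) : PT fun a => (l a).all (f a) := by
  have : PT fun a => !(l a).any (fun b => !(f a b)) := by fun_prop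
  convert this using 2 with a
  rw [Bool.eq_iff_iff]
  simp

theorem sum' : PT fun l : List ℤ => l.sum := by
  have := foldl_linear (α := List ℤ) (f := fun _ s b => s + b) (l := fun l => l) (s := fun _ => 0) 1
    (by fun_prop) (by fun_prop) (by fun_prop) (fun a s b => by
      have := bits_add s b
      simp only [sz_int]; omega)
  simpa [List.sum_eq_foldl] using this

@[fun_prop] theorem sum {l : α → List ℤ} (hl : PT l) : PT fun a => (l a).sum := sum'.comp hl

@[fun_prop] theorem length {l : α → List β} (hl : PT l) : PT fun a => ((l a).length : ℤ) := by
  have : PT fun a => ((l a).map fun _ => (1 : ℤ)).sum := by fun_prop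
  simpa using this

@[fun_prop] theorem zip [Inhabited γ] {l : α → List β} {m : α → List γ} (hl : PT l) (hm : PT m) :
    PT fun a => (l a).zip (m a) := by
  have h : PT fun p : List β × List γ => p.1.zip p.2 := by
    let f : List γ × List (β × γ) → β → List γ × List (β × γ) := fun s b =>
      bif s.1.isEmpty then s else (s.1.tail, (b, s.1.headD default) :: s.2)
    have := foldl_linear (α := List β × List γ) (f := fun _ => f) (l := fun p => p.1) (s := fun p => (p.2, [])) 1
      (by unfold f; fun_prop) (by fun_prop) (by fun_prop) (fun a s b => by
        have := sz_pos a
        obtain ⟨_ | ⟨c, s⟩, t⟩ := s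
        · exact Nat.le_add_right _ _
        · simp only [f, List.isEmpty_cons, cond_false, sz_pair, sz_cons, List.tail_cons, List.headD_cons]; omega)
    have key : ∀ (l : List β) (m : List γ) (t : List (β × γ)), (l.foldl f (m, t)).2 = (l.zip m).reverse ++ t := by
      intro l
      induction l with
      | nil => intro m t; rfl
      | cons b l ih =>
        intro m t
        rcases m with _ | ⟨c, m⟩
        · rw [List.foldl_cons]; simp only [f, List.isEmpty_nil, cond_true]; rw [ih]; simp
        · rw [List.foldl_cons]; simp only [f, List.isEmpty_cons, cond_false, List.tail_cons, List.headD_cons]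
          rw [ih]; simp
    have h2 : PT fun p : List β × List γ => ((p.1.foldl f (p.2, [])).2).reverse := by fun_prop
    simpa [key] using h2
  exact h.comp (hl.prodMk hm)

theorem bits_natCast_le (k : ℕ) : bits (k : ℤ) ≤ k :=
  bits_le_of_lt (by simpa using Nat.lt_two_pow_self)

end PT

/-- The indices of the entries of a list. -/
def idx {β : Type} (l : List β) : List ℤ := (List.range l.length).map Nat.cast

/-- The entry of a list with a given index. -/
def nth {β : Type} (l : List β) (j : ℤ) (d : β) : β :=
  (l.foldl (fun (s : ℤ × β) b => (s.1 - 1, bif eqb s.1 0 then b else s.2)) (j, d)).2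

theorem nth_natCast {β : Type} (l : List β) (j : ℕ) (d : β) : nth l j d = l.getD j d := by
  have neg : ∀ (l : List β) (j : ℤ) (d : β), j < 0 → nth l j d = d := by
    intro l
    induction l with
    | nil => intro j d _; rfl
    | cons b l ih =>
      intro j d hj
      have : nth (b :: l) j d = nth l (j - 1) d := by
        simp [nth, eqb, show j ≠ 0 by omega]
      rw [this, ih _ _ (by omega)]
  induction l generalizing j with
  | nil => simp [nth, eqb]
  | cons b l ih =>
    rcases j with _ | j
    · have : nth (b :: l) ((0 : ℕ) : ℤ) d = nth l (-1) b := by simp [nth, eqb]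
      rw [this, neg _ _ _ (by omega)]; simp
    · have : nth (b :: l) ((j + 1 : ℕ) : ℤ) d = nth l j d := by
        have : ((j : ℤ) + 1) ≠ 0 := by omega
        simp [nth, eqb, this]
      rw [this, ih]; simp

/-- The list without its first `j` entries. -/
def dropZ {β : Type} (l : List β) (j : ℤ) : List β :=
  (((idx l).zip l).filter fun p => leb j p.1).map fun p => p.2

/-- The nonempty suffixes of a list. -/
def suffixes {β : Type} (l : List β) : List (List β) := (idx l).map fun j => dropZ l j

namespace PT
variable {α β γ σ δ : Type} [Enc α] [Enc β] [Enc γ] [Enc σ] [Enc δ]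

@[fun_prop] theorem idx {l : α → List β} (hl : PT l) : PT fun a => idx (l a) := by
  have h : PT fun l : List β => DeltaSimplex.idx l := by
    have e : ∀ l : List β, l.foldl (fun (s : List ℤ) _ => (s.length : ℤ) :: s) [] = (DeltaSimplex.idx l).reverse := by
      intro l
      induction l using List.reverseRecOn with
      | nil => rfl
      | append_singleton l b ih => rw [List.foldl_append, ih]; simp [DeltaSimplex.idx, List.range_succ]
    have : PT fun l : List β => l.foldl (fun (s : List ℤ) _ => (s.length : ℤ) :: s) [] := by
      refine PolyOn.foldl (by fun_prop) id' (const []) PB.self (fun l => 1 + sz l * (1 + (1 + sz l)))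
        ((PB.const 1).add (PB.self.mul ((PB.const 1).add ((PB.const 1).add PB.self)))) fun l l₁ l₂ h => ?_
      rw [e, sz_reverse]
      have h1 : l₁.length ≤ sz l := by
        have := length_le_sz l
        rw [h, List.length_append] at this
        rw [h]; omega
      refine (sz_list_le _ (1 + sz l) fun z hz => ?_).trans ?_
      · simp only [DeltaSimplex.idx, List.mem_map, List.mem_range] at hz
        obtain ⟨k, hk, rfl⟩ := hz
        have := bits_natCast_le k
        rw [sz_int]; omega
      · simp only [DeltaSimplex.idx, List.length_map, List.length_range]
        exact Nat.add_le_add_left (Nat.mul_le_mul_right _ h1) 1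
    simpa [e] using this.reverse
  exact h.comp hl

@[fun_prop] theorem nth {l : α → List β} {j : α → ℤ} {d : α → β} (hl : PT l) (hj : PT j) (hd : PT d) :
    PT fun a => nth (l a) (j a) (d a) := by
  have := foldl_linear (f := fun (_ : α) (s : ℤ × β) b => (s.1 - 1, bif DeltaSimplex.eqb s.1 0 then b else s.2))
    (l := l) (s := fun a => (j a, d a)) 2 (by fun_prop) hl (by fun_prop) (fun a s b => by
      have h1 := bits_sub s.1 1
      have h2 := sz_pos a
      have h3 : bits 1 = 1 := by decide
      obtain ⟨s, t⟩ := s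
      rcases DeltaSimplex.eqb s 0 <;> simp only [sz_pair, sz_int, cond_true, cond_false] at * <;> omega)
  exact this.snd

@[fun_prop] theorem dropZ [Inhabited β] {l : α → List β} {j : α → ℤ} (hl : PT l) (hj : PT j) :
    PT fun a => dropZ (l a) (j a) := by
  unfold DeltaSimplex.dropZ
  fun_prop

@[fun_prop] theorem suffixes [Inhabited β] {l : α → List β} (hl : PT l) : PT fun a => suffixes (l a) := by
  unfold DeltaSimplex.suffixes
  fun_prop

end PT
end DeltaSimplex

namespace DeltaSimplex
open Enc

/-! ### The algorithm -/

/-- Elements `(h, x)` of `ℤ × ∏ ℤ / dᵢ`. -/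
abbrev El := ℤ × List ℤ

namespace El

def sub (x y : El) : El := (x.1 - y.1, (x.2.zip y.2).map fun p => p.1 - p.2)

def smul (t : ℤ) (x : El) : El := (t * x.1, x.2.map fun z => t * z)

/-- Is `x` zero in `ℤ × ∏ ℤ / dᵢ`? -/
def isZ (ds : List ℤ) (x : El) : Bool :=
  eqb x.1 0 && (ds.zip x.2).all fun p => eqb (p.2 - p.1 * (p.2 / p.1)) 0

/-- The linear combination of the elements of `X` with the coefficients `y`. -/
def lin (ds y : List ℤ) (X : List El) : El :=
  (((y.zip X).map fun p => p.1 * p.2.1).sum,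
    (idx ds).map fun j => ((y.zip X).map fun p => p.1 * nth p.2.2 j 0).sum)

def eqG (ds : List ℤ) (x y : El) : Bool := isZ ds (sub x y)

def memG (ds : List ℤ) (l : List El) (x : El) : Bool := l.any fun y => eqG ds x y

def count (ds : List ℤ) (l : List El) (x : El) : ℤ := ((l.filter fun y => eqG ds x y).length : ℤ)

end El

def lexStep (s : ℤ) (p : ℤ × ℤ) : ℤ :=
  bif eqb s 0 then (bif ltb p.1 p.2 then -1 else (bif ltb p.2 p.1 then 1 else 0)) else s

/-- Lexicographic comparison of lists of the same length. -/
def lexLt (k l : List ℤ) : Bool := ltb ((k.zip l).foldl lexStep 0) 0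

/-- If `u` is a multiple of `g₀`, the coefficient, added to `y`. -/
def repOf (ds : List ℤ) (g₀ : El) (y : List ℤ) (u : El) : List (List ℤ) :=
  bif El.eqG ds u (El.smul (u.1 / g₀.1) g₀) then [(u.1 / g₀.1) :: y] else []

/-- All coefficient vectors `(t, y)` with `w = t g₀ + ∑ yⱼ gⱼ` and `y ∈ T`. -/
def findRep (ds : List ℤ) (g₀ : El) (gs : List El) (T : List (List ℤ)) (w : El) : List (List ℤ) :=
  T.flatMap fun y => repOf ds g₀ y (El.sub w (El.lin ds y gs))

/-- The least `r ≥ 1` such that `r g` is a combination of the previous elements, with coefficients. -/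
def findOrder (ds : List ℤ) (g₀ : El) (gs : List El) (r1 : List ℤ) (T : List (List ℤ)) (g : El) :
    ℤ × List ℤ :=
  (r1.flatMap fun r => (findRep ds g₀ gs T (El.smul r g)).map fun c => (r, c)).headD (1, [])

def extendT (r0 : List ℤ) (T : List (List ℤ)) (r : ℤ) : List (List ℤ) :=
  (r0.filter fun q => ltb q r).flatMap fun q => T.map fun y => y ++ [q]

def guardT (r0 : List ℤ) (T : List (List ℤ)) : List (List ℤ) :=
  bif leb T.length r0.length then T else []

def relColumn (p : ℤ × List ℤ) : List ℤ := (p.2.map fun z => -z) ++ [p.1]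

/-- One step of the computation of a triangular basis of the relations between `g₀, gs`. -/
def basisStep (ds : List ℤ) (g₀ : El) (gs : List El) (r0 r1 : List ℤ)
    (s : List (List ℤ) × List (List ℤ)) (g : El) : List (List ℤ) × List (List ℤ) :=
  (guardT r0 (extendT r0 s.1 (findOrder ds g₀ gs r1 s.1 g).1),
    s.2 ++ [relColumn (findOrder ds g₀ gs r1 s.1 g)])

/-- Coefficients of the elements of the quotient by `g₀`, and a basis of the relations. -/
def basis (ds : List ℤ) (g₀ : El) (gs : List El) (r0 r1 : List ℤ) : List (List ℤ) × List (List ℤ) :=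
  gs.foldl (basisStep ds g₀ gs r0 r1) ([[]], [])

def mkRow (cols : List (List ℤ)) (lift : List ℤ) (j : ℤ) : List ℤ :=
  (cols.map fun c => nth c j 0) ++ [nth lift j 0]

/-- The extended matrix. -/
def mkMatrix (rows : List El) (cols : List (List ℤ)) (lift : List ℤ) : List (List ℤ) :=
  (idx rows).map fun j => mkRow cols lift j

def divAll (row : List ℤ) (k : ℤ) : Bool := row.all fun z => eqb (z - k * (z / k)) 0

/-- No number of `r2` divides a whole row. -/
def reducedTest (r2 : List ℤ) (M : List (List ℤ)) : Bool :=
  M.all fun row => r2.all fun k => !(divAll row k)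

def reachStep (ds : List ℤ) (acells rows R : List El) : List El :=
  acells.filter fun c => El.isZ ds c || rows.any fun g => El.memG ds R (El.sub c g)

/-- The elements of the semigroup generated by `rows`, up to some height. -/
def reach (ds : List ℤ) (acells rows : List El) (rB : List ℤ) : List El :=
  rB.foldl (fun R _ => reachStep ds acells rows R) []

def emptyTest (ds : List ℤ) (R : List El) (b : El) : Bool :=
  !(El.memG ds R b)

def vertexTest (ds : List ℤ) (b g : El) : Bool := El.eqG ds b (El.smul (b.1 / g.1) g)

def pairTest (ds : List ℤ) (R : List El) (b : El) (p q : ℤ × El) : Bool :=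
  eqb p.1 q.1 || !(El.memG ds R (El.sub (El.sub b p.2) q.2))

def latticeTest (ds : List ℤ) (rows R : List El) (b : El) : Bool :=
  (rows.all fun g => vertexTest ds b g) &&
    ((idx rows).zip rows).all fun p => ((idx rows).zip rows).all fun q => pairTest ds R b p q

def indicator (ds : List ℤ) (b c : El) : ℤ := bif El.eqG ds b c then 1 else 0

/-- The numbers that describe `rows` and `b` in the coordinates given by the cells `cs`. -/
def key (ds : List ℤ) (rows : List El) (b : El) (iso : List ℤ × List El) : List ℤ :=
  iso.1 ++ ((iso.2.map fun c => El.count ds rows c) ++ iso.2.map fun c => indicator ds b c)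

def prefixOf (ds : List ℤ) : List ℤ := (ds.length : ℤ) :: ds

/-- No isomorphism gives a smaller description. -/
def canonTest (ds : List ℤ) (bcells rows : List El) (b : El) (isos : List (List ℤ × List El)) : Bool :=
  isos.all fun iso => !(lexLt (key ds rows b iso) (key ds rows b (prefixOf ds, bcells)))

/-- A group `ℤ × ∏ ℤ / dᵢ` with its elements of height `1, …, B`, of height `0, …, B`, and the isomorphisms. -/
abbrev Grp := List ℤ × (List El × (List El × List (List ℤ × List El)))

/-- The ranges `0, …, Δ - 1`; `1, …, Δ`; `2, …, Δ`; `0, …, B`. -/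
abbrev Rng := List ℤ × (List ℤ × (List ℤ × List ℤ))

def lift (ds : List ℤ) (rows : List El) (T : List (List ℤ)) (b : El) : List ℤ :=
  (findRep ds (rows.headD (0, [])) rows.tail T b).headD []

/-- The extended matrix of a candidate. -/
def candMatrix (ds : List ℤ) (rows : List El) (s : List (List ℤ) × List (List ℤ)) (b : El) : List (List ℤ) :=
  mkMatrix rows s.2 (lift ds rows s.1 b)

def generates (ds : List ℤ) (rows bcells : List El) (T : List (List ℤ)) : Bool :=
  bcells.all fun c => !(findRep ds (rows.headD (0, [])) rows.tail T c).isEmpty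

/-- The extended matrix, if the candidate passes the tests. -/
def accept (R : Rng) (G : Grp) (rows : List El) (s : List (List ℤ) × List (List ℤ)) (geom : Bool) (b : El) :
    List (List (List ℤ)) :=
  bif geom && (reducedTest R.2.2.1 (candMatrix G.1 rows s b) && canonTest G.1 G.2.1 rows b G.2.2.2) then
    [candMatrix G.1 rows s b] else []

def processEmpty (R : Rng) (G : Grp) (rows : List El) (s : List (List ℤ) × List (List ℤ)) (Q : List El) :
    List (List (List ℤ)) :=
  bif generates G.1 rows G.2.1 s.1 then
    G.2.1.flatMap fun b => accept R G rows s (emptyTest G.1 Q b) b else []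

def processLattice (R : Rng) (G : Grp) (rows : List El) (s : List (List ℤ) × List (List ℤ)) (Q : List El) :
    List (List (List ℤ)) :=
  bif generates G.1 rows G.2.1 s.1 then
    G.2.1.flatMap fun b => accept R G rows s (latticeTest G.1 rows Q b) b else []

abbrev Item := (Rng × Grp) × (List El × List El)

def itemBasis (R : Rng) (G : Grp) (rows : List El) : List (List ℤ) × List (List ℤ) :=
  basis G.1 (rows.headD (0, [])) rows.tail R.1 R.2.1

def itemReach (R : Rng) (G : Grp) (rows : List El) : List El :=
  reach G.1 G.2.2.1 rows R.2.2.2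

def emptyOf (i : Item) : List (List (List ℤ)) :=
  processEmpty i.1.1 i.1.2 i.2.2 (itemBasis i.1.1 i.1.2 i.2.2) (itemReach i.1.1 i.1.2 i.2.2)

def latticeOf (i : Item) : List (List (List ℤ)) :=
  processLattice i.1.1 i.1.2 i.2.2 (itemBasis i.1.1 i.1.2 i.2.2) (itemReach i.1.1 i.1.2 i.2.2)

/-- Add one more row, from the cells that are still allowed. -/
def itemStep (i : Item) : List Item :=
  (suffixes i.2.1).map fun t => (i.1, (t, t.headD (0, []) :: i.2.2))

/-! ### The groups and the isomorphisms between them -/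

abbrev Fin0 := List ℤ × List (List ℤ)

def extendElems (r0 : List ℤ) (F : List (List ℤ)) (q : ℤ) : List (List ℤ) :=
  (r0.filter fun r => ltb r q).flatMap fun r => F.map fun x => r :: x

def extendGroup (r0 : List ℤ) (g : Fin0) (q : ℤ) : List Fin0 :=
  bif leb (q * (g.2.length : ℤ)) r0.length then [(q :: g.1, extendElems r0 g.2 q)] else []

def groupsStep (r0 r2 : List ℤ) (L : List Fin0) : List Fin0 :=
  ([], [[]]) :: L.flatMap fun g => r2.flatMap fun q => extendGroup r0 g q

def cellsOf (hs : List ℤ) (F : List (List ℤ)) : List El := hs.flatMap fun h => F.map fun x => (h, x)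

def tuplesStep (c : List El) (L : List (List El)) : List (List El) :=
  [] :: c.flatMap fun x => L.map fun X => x :: X

def isHom (ds ds' : List ℤ) (X : List El) : Bool :=
  (ds'.zip X.tail).all fun p => El.isZ ds (El.smul p.1 p.2)

def isInj (ds ds' : List ℤ) (F' : List (List ℤ)) (X : List El) : Bool :=
  F'.all fun y => !(El.isZ ds (El.lin ds (0 :: y) X)) || El.isZ ds' (0, y)

def isIso (g g' : Fin0) (X : List El) : Bool :=
  (eqb X.length (g'.1.length + 1) && eqb (X.headD (0, [])).1 1) &&
    (eqb g.2.length g'.2.length && (isHom g.1 g'.1 X && isInj g.1 g'.1 g'.2 X))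

def isoImage (ds : List ℤ) (X cs : List El) : List El := cs.map fun c => El.lin ds (c.1 :: c.2) X

/-- The isomorphisms onto the group `g`, as images of cells. -/
def isosOf (rB1 : List ℤ) (L : List Fin0) (g : Fin0) (tuples : List (List El)) : List (List ℤ × List El) :=
  L.flatMap fun g' => (tuples.filter fun X => isIso g g' X).map fun X =>
    (prefixOf g'.1, isoImage g.1 X (cellsOf rB1 g'.2))

def mkGrp (rB rB1 : List ℤ) (L : List Fin0) (gt : Fin0 × List (List El)) : Grp :=
  (gt.1.1, (cellsOf rB1 gt.1.2, (cellsOf rB gt.1.2, isosOf rB1 L gt.1 gt.2)))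

def smallHeights (r1 : List ℤ) (F : List (List ℤ)) : List ℤ :=
  r1.filter fun h => leb (h * (F.length : ℤ)) r1.length

def mkItem (R : Rng) (rB1 : List ℤ) (L : List Fin0) (gt : Fin0 × List (List El)) : Item :=
  ((R, mkGrp R.2.2.2 rB1 L gt), (cellsOf (smallHeights R.2.1 gt.1.2) gt.1.2, []))

end DeltaSimplex

namespace DeltaSimplex
open Enc

variable {α β γ : Type} [Enc α] [Enc β] [Enc γ]

namespace El

@[fun_prop] theorem pt_sub {f g : α → El} (hf : PT f) (hg : PT g) : PT fun a => sub (f a) (g a) := by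
  unfold sub; fun_prop

@[fun_prop] theorem pt_smul {f : α → ℤ} {g : α → El} (hf : PT f) (hg : PT g) : PT fun a => smul (f a) (g a) := by
  unfold smul; fun_prop

@[fun_prop] theorem pt_isZ {ds : α → List ℤ} {g : α → El} (hf : PT ds) (hg : PT g) :
    PT fun a => isZ (ds a) (g a) := by
  unfold isZ; fun_prop

@[fun_prop] theorem pt_lin {ds y : α → List ℤ} {X : α → List El} (hf : PT ds) (hy : PT y) (hg : PT X) :
    PT fun a => lin (ds a) (y a) (X a) := by
  unfold lin; fun_prop

@[fun_prop] theorem pt_eqG {ds : α → List ℤ} {f g : α → El} (hd : PT ds) (hf : PT f) (hg : PT g) :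
    PT fun a => eqG (ds a) (f a) (g a) := by
  unfold eqG; fun_prop

@[fun_prop] theorem pt_memG {ds : α → List ℤ} {l : α → List El} {g : α → El} (hd : PT ds) (hl : PT l) (hg : PT g) :
    PT fun a => memG (ds a) (l a) (g a) := by
  unfold memG; fun_prop

@[fun_prop] theorem pt_count {ds : α → List ℤ} {l : α → List El} {g : α → El} (hd : PT ds) (hl : PT l) (hg : PT g) :
    PT fun a => count (ds a) (l a) (g a) := by
  unfold count; fun_prop

end El

@[fun_prop] theorem pt_lexStep {s : α → ℤ} {p : α → ℤ × ℤ} (hs : PT s) (hp : PT p) :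
    PT fun a => lexStep (s a) (p a) := by
  unfold lexStep; fun_prop

@[fun_prop] theorem pt_lexLt {k l : α → List ℤ} (hk : PT k) (hl : PT l) : PT fun a => lexLt (k a) (l a) := by
  unfold lexLt
  refine PT.ltb (PT.foldl_linear (f := fun _ => lexStep) 1 (by fun_prop) (by fun_prop) (by fun_prop)
    fun a s b => ?_) (by fun_prop)
  have h := sz_pos a
  have h' := sz_pos b
  have h1 : sz (1 : ℤ) = 2 := by decide
  have h2 : sz (-1 : ℤ) = 2 := by decide
  have h3 : sz (0 : ℤ) = 1 := by decide
  unfold lexStep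
  rcases eqb s 0 <;> rcases ltb b.1 b.2 <;> rcases ltb b.2 b.1 <;> simp only [cond_true, cond_false] <;> omega

@[fun_prop] theorem pt_repOf {ds y : α → List ℤ} {g u : α → El} (hd : PT ds) (hy : PT y) (hg : PT g) (hu : PT u) :
    PT fun a => repOf (ds a) (g a) (y a) (u a) := by
  unfold repOf; fun_prop

@[fun_prop] theorem pt_findRep {ds : α → List ℤ} {g : α → El} {gs : α → List El} {T : α → List (List ℤ)} {w : α → El}
    (hd : PT ds) (hg : PT g) (hgs : PT gs) (hT : PT T) (hw : PT w) :
    PT fun a => findRep (ds a) (g a) (gs a) (T a) (w a) := by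
  unfold findRep; fun_prop

@[fun_prop] theorem pt_findOrder {ds r1 : α → List ℤ} {g : α → El} {gs : α → List El} {T : α → List (List ℤ)} {w : α → El}
    (hd : PT ds) (hr : PT r1) (hg : PT g) (hgs : PT gs) (hT : PT T) (hw : PT w) :
    PT fun a => findOrder (ds a) (g a) (gs a) (r1 a) (T a) (w a) := by
  unfold findOrder; fun_prop

@[fun_prop] theorem pt_extendT {r0 : α → List ℤ} {T : α → List (List ℤ)} {r : α → ℤ} (h0 : PT r0) (hT : PT T) (hr : PT r) :
    PT fun a => extendT (r0 a) (T a) (r a) := by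
  unfold extendT; fun_prop

@[fun_prop] theorem pt_guardT {r0 : α → List ℤ} {T : α → List (List ℤ)} (h0 : PT r0) (hT : PT T) :
    PT fun a => guardT (r0 a) (T a) := by
  unfold guardT; fun_prop

@[fun_prop] theorem pt_relColumn {p : α → ℤ × List ℤ} (hp : PT p) : PT fun a => relColumn (p a) := by
  unfold relColumn; fun_prop

@[fun_prop] theorem pt_mkMatrix {rows : α → List El} {cols : α → List (List ℤ)} {lift : α → List ℤ} (hr : PT rows)
    (hc : PT cols) (hl : PT lift) : PT fun a => mkMatrix (rows a) (cols a) (lift a) := by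
  unfold mkMatrix mkRow; fun_prop

@[fun_prop] theorem pt_reducedTest {r2 : α → List ℤ} {M : α → List (List ℤ)} (hr : PT r2) (hM : PT M) :
    PT fun a => reducedTest (r2 a) (M a) := by
  unfold reducedTest divAll; fun_prop

@[fun_prop] theorem pt_reachStep {ds : α → List ℤ} {c r R : α → List El} (hd : PT ds) (hc : PT c) (hr : PT r) (hR : PT R) :
    PT fun a => reachStep (ds a) (c a) (r a) (R a) := by
  unfold reachStep; fun_prop

@[fun_prop] theorem pt_reach {ds rB : α → List ℤ} {c r : α → List El} (hd : PT ds) (hB : PT rB) (hc : PT c) (hr : PT r) :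
    PT fun a => reach (ds a) (c a) (r a) (rB a) := by
  have h : PT fun p : List ℤ × (List ℤ × (List El × List El)) => reach p.1 p.2.2.1 p.2.2.2 p.2.1 := by
    unfold reach
    refine PT.foldl_linear 1 (by fun_prop) (by fun_prop) (by fun_prop) fun a s b => ?_
    obtain ⟨d, B, c, r⟩ := a
    have : sz (reachStep d c r s) ≤ sz c := sz_sublist List.filter_sublist
    simp only [sz_pair]; omega
  exact h.comp (hd.prodMk (hB.prodMk (hc.prodMk hr)))

@[fun_prop] theorem pt_emptyTest {ds : α → List ℤ} {R : α → List El} {b : α → El} (hd : PT ds)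
    (hR : PT R) (hb : PT b) : PT fun a => emptyTest (ds a) (R a) (b a) := by
  unfold emptyTest; fun_prop

@[fun_prop] theorem pt_pairTest {ds : α → List ℤ} {R : α → List El} {b : α → El} {p q : α → ℤ × El} (hd : PT ds)
    (hR : PT R) (hb : PT b) (hp : PT p) (hq : PT q) : PT fun a => pairTest (ds a) (R a) (b a) (p a) (q a) := by
  unfold pairTest; fun_prop

@[fun_prop] theorem pt_latticeTest {ds : α → List ℤ} {r R : α → List El} {b : α → El} (hd : PT ds) (hr : PT r)
    (hR : PT R) (hb : PT b) : PT fun a => latticeTest (ds a) (r a) (R a) (b a) := by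
  unfold latticeTest vertexTest; fun_prop

@[fun_prop] theorem pt_key {ds : α → List ℤ} {r : α → List El} {b : α → El} {i : α → List ℤ × List El} (hd : PT ds)
    (hr : PT r) (hb : PT b) (hi : PT i) : PT fun a => key (ds a) (r a) (b a) (i a) := by
  unfold key indicator; fun_prop

@[fun_prop] theorem pt_prefixOf {ds : α → List ℤ} (hd : PT ds) : PT fun a => prefixOf (ds a) := by
  unfold prefixOf; fun_prop

@[fun_prop] theorem pt_canonTest {ds : α → List ℤ} {c r : α → List El} {b : α → El} {i : α → List (List ℤ × List El)}
    (hd : PT ds) (hc : PT c) (hr : PT r) (hb : PT b) (hi : PT i) :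
    PT fun a => canonTest (ds a) (c a) (r a) (b a) (i a) := by
  unfold canonTest; fun_prop

@[fun_prop] theorem pt_candMatrix {ds : α → List ℤ} {r : α → List El} {s : α → List (List ℤ) × List (List ℤ)} {b : α → El}
    (hd : PT ds) (hr : PT r) (hs : PT s) (hb : PT b) : PT fun a => candMatrix (ds a) (r a) (s a) (b a) := by
  unfold candMatrix lift; fun_prop

@[fun_prop] theorem pt_generates {ds : α → List ℤ} {r c : α → List El} {T : α → List (List ℤ)}
    (hd : PT ds) (hr : PT r) (hc : PT c) (hT : PT T) : PT fun a => generates (ds a) (r a) (c a) (T a) := by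
  unfold generates; fun_prop

@[fun_prop] theorem pt_accept {R : α → Rng} {G : α → Grp} {r : α → List El} {s : α → List (List ℤ) × List (List ℤ)}
    {g : α → Bool} {b : α → El} (hR : PT R) (hG : PT G) (hr : PT r) (hs : PT s) (hg : PT g) (hb : PT b) :
    PT fun a => accept (R a) (G a) (r a) (s a) (g a) (b a) := by
  unfold accept; fun_prop

@[fun_prop] theorem pt_processEmpty {R : α → Rng} {G : α → Grp} {r Q : α → List El}
    {s : α → List (List ℤ) × List (List ℤ)} (hR : PT R) (hG : PT G) (hr : PT r) (hs : PT s) (hQ : PT Q) :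
    PT fun a => processEmpty (R a) (G a) (r a) (s a) (Q a) := by
  unfold processEmpty; fun_prop

@[fun_prop] theorem pt_processLattice {R : α → Rng} {G : α → Grp} {r Q : α → List El}
    {s : α → List (List ℤ) × List (List ℤ)} (hR : PT R) (hG : PT G) (hr : PT r) (hs : PT s) (hQ : PT Q) :
    PT fun a => processLattice (R a) (G a) (r a) (s a) (Q a) := by
  unfold processLattice; fun_prop

theorem length_T_le {ds r0 r1 : List ℤ} {g₀ : El} {gs l : List El} :
    ∀ y ∈ (l.foldl (basisStep ds g₀ gs r0 r1) ([[]], [])).1, sz y ≤ 1 + l.length * (1 + sz r0) := by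
  induction l using List.reverseRecOn with
  | nil => simp [sz_nil]
  | append_singleton l g ih =>
    rw [List.foldl_append, List.foldl_cons, List.foldl_nil]
    intro y hy
    generalize l.foldl (basisStep ds g₀ gs r0 r1) ([[]], []) = s at *
    have : y ∈ extendT r0 s.1 (findOrder ds g₀ gs r1 s.1 g).1 := by
      unfold basisStep guardT at hy
      rcases h : leb (↑(extendT r0 s.1 (findOrder ds g₀ gs r1 s.1 g).1).length) ↑r0.length with _ | _ <;>
        simp [h] at hy
      exact hy
    simp only [extendT, List.mem_flatMap, List.mem_filter, List.mem_map] at this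
    obtain ⟨q, ⟨hq, -⟩, z, hz, rfl⟩ := this
    have h1 := ih z hz
    have h2 := sz_append z [q]
    have h3 := sz_mem_le hq
    rw [sz_cons, sz_nil] at h2
    simp only [List.length_append, List.length_singleton]
    linarith

theorem sz_T_le {ds r0 r1 : List ℤ} {g₀ : El} {gs l : List El} :
    sz (l.foldl (basisStep ds g₀ gs r0 r1) ([[]], [])).1 ≤
      1 + (r0.length + 1) * (1 + (1 + l.length * (1 + sz r0))) := by
  refine (sz_list_le _ _ length_T_le).trans (Nat.add_le_add_left (Nat.mul_le_mul_right _ ?_) 1)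
  rcases List.eq_nil_or_concat l with rfl | ⟨l, g, rfl⟩
  · simp
  · rw [List.concat_eq_append, List.foldl_append, List.foldl_cons, List.foldl_nil]
    generalize l.foldl (basisStep ds g₀ gs r0 r1) ([[]], []) = s at *
    unfold basisStep guardT
    rcases h : leb (↑(extendT r0 s.1 (findOrder ds g₀ gs r1 s.1 g).1).length) ↑r0.length with _ | _
    · simp
    · simp only [leb_eq_true, Nat.cast_le] at h
      simp only [cond_true]; omega

@[fun_prop] theorem pt_basisStep {ds r0 r1 : α → List ℤ} {g g' : α → El} {gs : α → List El}
    {s : α → List (List ℤ) × List (List ℤ)} (hd : PT ds) (h0 : PT r0) (h1 : PT r1) (hg : PT g) (hgs : PT gs)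
    (hs : PT s) (hg' : PT g') : PT fun a => basisStep (ds a) (g a) (gs a) (r0 a) (r1 a) (s a) (g' a) := by
  unfold basisStep; fun_prop

/-- The arguments of `basis`. -/
abbrev BasisArg := (List ℤ × (List ℤ × List ℤ)) × (El × List El)

/-- A bound for the size of the first component of the states of `basis`. -/
def sizeT (S : ℕ) : ℕ := 1 + (S + 1) * (1 + (1 + S * (1 + S)))

theorem pb_sizeT {A : Type} (μ : A → ℕ) : PB μ fun a => sizeT (μ a) :=
  (PB.const 1).add ((PB.self.add (PB.const 1)).mul ((PB.const 1).add
      ((PB.const 1).add (PB.self.mul ((PB.const 1).add PB.self)))))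

theorem sz_basisState : ∃ c, ∀ (a : BasisArg) (l₁ l₂ : List El), a.2.2 = l₁ ++ l₂ →
    sz (l₁.foldl (basisStep a.1.1 a.2.1 a.2.2 a.1.2.1 a.1.2.2) ([[]], [])) ≤
      1 + sizeT (sz a) + (1 + sz a * (1 + (sz a + sizeT (sz a) + sz a + 4) ^ c)) := by
  have hcol : PT fun q : BasisArg × (List (List ℤ) × El) =>
      relColumn (findOrder q.1.1.1 q.1.2.1 q.1.2.2 q.1.1.2.2 q.2.1 q.2.2) := by fun_prop
  obtain ⟨-, -, -, ⟨c, hc⟩, -⟩ := hcol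
  refine ⟨c, fun a l₁ l₂ e => ?_⟩
  obtain ⟨⟨ds, r0, r1⟩, g₀, gs⟩ := a
  dsimp only at e ⊢
  have hS0 : sz ((ds, r0, r1), g₀, gs) = 1 + (1 + sz ds + (1 + sz r0 + sz r1)) + (1 + sz g₀ + sz gs) := rfl
  replace hc : ∀ (T : List (List ℤ)) (g : El), sz (relColumn (findOrder ds g₀ gs r1 T g)) ≤
      (1 + sz ((ds, r0, r1), g₀, gs) + (1 + sz T + sz g) + 2) ^ c :=
    fun T g => hc (((ds, r0, r1), g₀, gs), (T, g))
  generalize sz ((ds, r0, r1), g₀, gs) = S at *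
  have hsz : ∀ l l' : List El, gs = l ++ l' → l.length ≤ S := by
    intro l l' e
    have := length_le_sz gs
    have h3 : l.length ≤ gs.length := by rw [e]; simp
    omega
  have hT : ∀ l l' : List El, gs = l ++ l' →
      sz (l.foldl (basisStep ds g₀ gs r0 r1) ([[]], [])).1 ≤ sizeT S := by
    intro l l' e
    have h1 := hsz l l' e
    have h2 : sz r0 ≤ S := by omega
    have h3 := length_le_sz r0
    refine sz_T_le.trans ?_
    unfold sizeT
    gcongr
    omega
  have hC : ∀ l l' : List El, gs = l ++ l' →
      (l.foldl (basisStep ds g₀ gs r0 r1) ([[]], [])).2.length = l.length ∧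
      ∀ y ∈ (l.foldl (basisStep ds g₀ gs r0 r1) ([[]], [])).2, sz y ≤ (S + sizeT S + S + 4) ^ c := by
    intro l
    induction l using List.reverseRecOn with
    | nil => simp
    | append_singleton l g ih =>
      intro l' e
      obtain ⟨ih1, ih2⟩ := ih ([g] ++ l') (by simp [e])
      have h5 := hT l ([g] ++ l') (by simp [e])
      rw [List.foldl_append, List.foldl_cons, List.foldl_nil]
      generalize l.foldl (basisStep ds g₀ gs r0 r1) ([[]], []) = s at *
      refine ⟨by simp [basisStep, ih1], fun y hy => ?_⟩
      simp only [basisStep, List.mem_append, List.mem_singleton] at hy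
      rcases hy with hy | rfl
      · exact ih2 y hy
      · refine (hc s.1 g).trans (Nat.pow_le_pow_left ?_ c)
        have h6 : sz g ≤ sz gs := sz_mem_le (by simp [e])
        omega
  obtain ⟨h3, h4⟩ := hC l₁ l₂ e
  have h5 := hT l₁ l₂ e
  have h6 := sz_list_le _ _ h4
  rw [h3] at h6
  have h7 := Nat.mul_le_mul_right (1 + (S + sizeT S + S + 4) ^ c) (hsz l₁ l₂ e)
  generalize l₁.foldl (basisStep ds g₀ gs r0 r1) ([[]], []) = s at *
  obtain ⟨s, s'⟩ := s
  rw [sz_pair]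
  dsimp only at *
  omega

theorem pt_basis' : PT fun p : BasisArg => basis p.1.1 p.2.1 p.2.2 p.1.2.1 p.1.2.2 := by
  obtain ⟨c, hc⟩ := sz_basisState
  have hstep : PT fun q : BasisArg × ((List (List ℤ) × List (List ℤ)) × El) =>
      basisStep q.1.1.1 q.1.2.1 q.1.2.2 q.1.1.2.1 q.1.1.2.2 q.2.1 q.2.2 := by fun_prop
  have hN : PB (fun a : BasisArg => sz a) fun a =>
      1 + sizeT (sz a) + (1 + sz a * (1 + (sz a + sizeT (sz a) + sz a + 4) ^ c)) :=
    ((PB.const 1).add (pb_sizeT _)).add ((PB.const 1).add (PB.self.mul ((PB.const 1).add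
        ((((PB.self.add (pb_sizeT _)).add PB.self).add (PB.const 4)).pow c))))
  exact PolyOn.foldl (f := fun p : BasisArg => basisStep p.1.1 p.2.1 p.2.2 p.1.2.1 p.1.2.2) hstep
    (PT.snd (PT.snd PT.id')) (PT.const _) PB.self _ hN hc

@[fun_prop] theorem pt_basis {ds r0 r1 : α → List ℤ} {g : α → El} {gs : α → List El} (hd : PT ds) (h0 : PT r0)
    (h1 : PT r1) (hg : PT g) (hgs : PT gs) : PT fun a => basis (ds a) (g a) (gs a) (r0 a) (r1 a) :=
  PT.comp (f := fun a => (((ds a, (r0 a, r1 a)), (g a, gs a)) : BasisArg)) pt_basis' (by fun_prop)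

@[fun_prop] theorem pt_emptyOf {i : α → Item} (hi : PT i) : PT fun a => emptyOf (i a) := by
  unfold emptyOf itemBasis itemReach; fun_prop

@[fun_prop] theorem pt_latticeOf {i : α → Item} (hi : PT i) : PT fun a => latticeOf (i a) := by
  unfold latticeOf itemBasis itemReach; fun_prop

@[fun_prop] theorem pt_itemStep {i : α → Item} (hi : PT i) : PT fun a => itemStep (i a) := by
  unfold itemStep; fun_prop

@[fun_prop] theorem pt_groupsStep {r0 r2 : α → List ℤ} {L : α → List Fin0} (h0 : PT r0) (h2 : PT r2) (hL : PT L) :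
    PT fun a => groupsStep (r0 a) (r2 a) (L a) := by
  unfold groupsStep extendGroup extendElems; fun_prop

@[fun_prop] theorem pt_cellsOf {hs : α → List ℤ} {F : α → List (List ℤ)} (h : PT hs) (hF : PT F) :
    PT fun a => cellsOf (hs a) (F a) := by
  unfold cellsOf; fun_prop

@[fun_prop] theorem pt_tuplesStep {c : α → List El} {L : α → List (List El)} (hc : PT c) (hL : PT L) :
    PT fun a => tuplesStep (c a) (L a) := by
  unfold tuplesStep; fun_prop

@[fun_prop] theorem pt_isIso {g g' : α → Fin0} {X : α → List El} (hg : PT g) (hg' : PT g') (hX : PT X) :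
    PT fun a => isIso (g a) (g' a) (X a) := by
  unfold isIso isHom isInj; fun_prop

@[fun_prop] theorem pt_isosOf {r : α → List ℤ} {L : α → List Fin0} {g : α → Fin0} {X : α → List (List El)} (hr : PT r)
    (hL : PT L) (hg : PT g) (hX : PT X) : PT fun a => isosOf (r a) (L a) (g a) (X a) := by
  unfold isosOf isoImage; fun_prop

@[fun_prop] theorem pt_mkItem {R : α → Rng} {r : α → List ℤ} {L : α → List Fin0} {g : α → Fin0 × List (List El)}
    (hR : PT R) (hr : PT r) (hL : PT L) (hg : PT g) : PT fun a => mkItem (R a) (r a) (L a) (g a) := by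
  unfold mkItem mkGrp smallHeights; fun_prop

end DeltaSimplex

namespace DeltaSimplex
open Enc

instance : Enc ℕ := ⟨fun n => Val.int n⟩

/-! ### The initial list -/

/-- `0, …, n - 1`. -/
def rangeZ (n : ℕ) : List ℤ := (List.range n).map Nat.cast

theorem length_rangeZ (n : ℕ) : (rangeZ n).length = n := by simp [rangeZ]

theorem mem_rangeZ {n : ℕ} {z : ℤ} : z ∈ rangeZ n ↔ 0 ≤ z ∧ z < n := by
  simp only [rangeZ, List.mem_map, List.mem_range]
  constructor
  · rintro ⟨k, hk, rfl⟩; omega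
  · rintro ⟨h1, h2⟩; exact ⟨z.toNat, by omega, by omega⟩

/-- `1, …, n`. -/
def range1 (n : ℕ) : List ℤ := (rangeZ n).map fun z => z + 1

/-- `2, …, n`. -/
def range2 (n : ℕ) : List ℤ := (range1 n).filter fun z => leb 2 z

theorem mem_range1 {n : ℕ} {z : ℤ} : z ∈ range1 n ↔ 1 ≤ z ∧ z ≤ n := by
  simp only [range1, List.mem_map, mem_rangeZ]
  constructor
  · rintro ⟨k, hk, rfl⟩; omega
  · rintro ⟨h1, h2⟩; exact ⟨z - 1, by omega, by omega⟩

theorem mem_range2 {n : ℕ} {z : ℤ} : z ∈ range2 n ↔ 2 ≤ z ∧ z ≤ n := by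
  simp only [range2, List.mem_filter, mem_range1, leb_eq_true]; omega

theorem length_range1 (n : ℕ) : (range1 n).length = n := by simp [range1, length_rangeZ]

theorem length_range2_le (n : ℕ) : (range2 n).length ≤ n :=
  (List.length_filter_le _ _).trans (length_range1 n).le

def halveStep (s : ℤ × List ℤ) : ℤ × List ℤ := bif leb 2 s.1 then (s.1 / 2, 0 :: s.2) else s

/-- A list of length `log₂ Δ`. -/
def logList (Δ : ℤ) (r0 : List ℤ) : List ℤ := (r0.foldl (fun s _ => halveStep s) (Δ, [])).2

theorem length_logList (Δ : ℕ) : (logList Δ (rangeZ Δ)).length = Nat.log 2 Δ := by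
  have key : ∀ (l : List ℤ) (m : ℕ) (t : List ℤ), m ≤ l.length →
      (l.foldl (fun s _ => halveStep s) ((m : ℤ), t)).2.length = t.length + Nat.log 2 m := by
    intro l
    induction l with
    | nil => intro m t hm; simp at hm; subst hm; simp
    | cons a l ih =>
      intro m t hm
      rw [List.foldl_cons]
      by_cases h : 2 ≤ m
      · have h1 : leb 2 (m : ℤ) = true := by simp; omega
        have h2 : halveStep ((m : ℤ), t) = (((m / 2 : ℕ) : ℤ), 0 :: t) := by simp [halveStep, h1]
        simp only [List.length_cons] at hm
        rw [h2, ih _ _ (by omega), Nat.log_of_one_lt_of_le (by norm_num) h]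
        simp; omega
      · have h1 : leb 2 (m : ℤ) = false := by simp [leb]; omega
        have h2 : halveStep ((m : ℤ), t) = ((m : ℤ), t) := by simp [halveStep, h1]
        have h3 : ∀ l : List ℤ, l.foldl (fun s _ => halveStep s) ((m : ℤ), t) = ((m : ℤ), t) := by
          intro l
          induction l with
          | nil => rfl
          | cons a l ih => rw [List.foldl_cons, h2, ih]
        rw [h2, h3, Nat.log_of_lt (by omega)]; simp
  simpa [logList] using key (rangeZ Δ) Δ [] (length_rangeZ Δ).ge

/-- All elements of `∏ ℤ / dᵢ`. -/
def elems (r0 : List ℤ) : List ℤ → List (List ℤ)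
  | [] => [[]]
  | q :: ds => extendElems r0 (elems r0 ds) q

def groups (Δ i : ℕ) : List Fin0 := (groupsStep (rangeZ Δ) (range2 Δ))^[i] [([], [[]])]

theorem groups_succ (Δ i : ℕ) : groups Δ (i + 1) = groupsStep (rangeZ Δ) (range2 Δ) (groups Δ i) :=
  Function.iterate_succ_apply' _ _ _

theorem of_mem_groups {Δ i : ℕ} {g : Fin0} (hΔ : 1 ≤ Δ) (h : g ∈ groups Δ i) : g.1.length ≤ i ∧ (∀ q ∈ g.1, q ∈ range2 Δ) ∧
    g.2 = elems (rangeZ Δ) g.1 ∧ g.2.length ≤ Δ := by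
  induction i generalizing g with
  | zero => simp [groups] at h; subst h; simp [elems, hΔ]
  | succ i ih =>
    rw [groups_succ, groupsStep, List.mem_cons] at h
    rcases h with rfl | h
    · simp [elems, hΔ]
    · simp only [List.mem_flatMap, extendGroup] at h
      obtain ⟨g', hg', q, hq, h⟩ := h
      obtain ⟨h1, h2, h3, h4⟩ := ih hg'
      rcases hb : leb (q * (g'.2.length : ℤ)) (rangeZ Δ).length with _ | _
      · simp [hb] at h
      simp only [hb, cond_true, List.mem_singleton] at h
      subst h
      rw [leb_eq_true, length_rangeZ] at hb
      refine ⟨by simpa using h1, ?_, by simp [elems, h3], ?_⟩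
      · intro q' hq'
        rcases List.mem_cons.1 hq' with rfl | hq'
        exacts [hq, h2 q' hq']
      · have hq2 := mem_range2.1 hq
        have : ((rangeZ Δ).filter fun r => ltb r q).length ≤ q.toNat := by
          have e : (rangeZ Δ).filter (fun r => ltb r q) = rangeZ q.toNat := by
            obtain ⟨k, rfl⟩ : ∃ k : ℕ, q = k := ⟨q.toNat, by omega⟩
            unfold rangeZ
            rw [List.filter_map]
            congr 1
            have hk : k ≤ Δ := by omega
            obtain ⟨m, rfl⟩ := Nat.exists_eq_add_of_le hk
            rw [List.range_add, List.filter_append, List.filter_eq_self.2, List.filter_eq_nil_iff.2]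
            · simp
            · simp
            · simp
          rw [e, length_rangeZ]
        have h5 : (extendElems (rangeZ Δ) g'.2 q).length ≤ q.toNat * g'.2.length := by
          simp only [extendElems, List.length_flatMap, List.length_map]
          simpa using Nat.mul_le_mul_right _ this
        have h6 : ((q.toNat * g'.2.length : ℕ) : ℤ) ≤ Δ := by
          push_cast
          rwa [Int.toNat_of_nonneg (by omega)]
        simp only
        omega

theorem length_groups_le (Δ i : ℕ) : (groups Δ i).length ≤ (Δ + 1) ^ i := by
  induction i with
  | zero => simp [groups]
  | succ i ih =>
    have h1 : ∀ g : Fin0, ((range2 Δ).flatMap fun q => extendGroup (rangeZ Δ) g q).length ≤ Δ := by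
      intro g
      rw [List.length_flatMap]
      refine (List.sum_le_card_nsmul _ 1 ?_).trans (by simpa using length_range2_le Δ)
      simp only [List.mem_map]
      rintro _ ⟨q, -, rfl⟩
      unfold extendGroup
      rcases leb (q * (g.2.length : ℤ)) (rangeZ Δ).length <;> simp
    rw [groups_succ, groupsStep, List.length_cons, List.length_flatMap]
    have h2 := List.sum_le_card_nsmul ((groups Δ i).map fun g =>
      ((range2 Δ).flatMap fun q => extendGroup (rangeZ Δ) g q).length) Δ (by
        simp only [List.mem_map]
        rintro _ ⟨g, -, rfl⟩
        exact h1 g)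
    rw [List.length_map, smul_eq_mul] at h2
    have h3 : 1 ≤ (Δ + 1) ^ i := Nat.one_le_pow _ _ (by omega)
    calc _ ≤ (groups Δ i).length * Δ + 1 := by omega
      _ ≤ (Δ + 1) ^ i * Δ + (Δ + 1) ^ i := by gcongr
      _ = _ := by ring

end DeltaSimplex

namespace DeltaSimplex
open Enc

theorem mem_elems {Δ : ℕ} {ds x : List ℤ} (h : ∀ q ∈ ds, q ≤ Δ) :
    x ∈ elems (rangeZ Δ) ds ↔ List.Forall₂ (fun q r => 0 ≤ r ∧ r < q) ds x := by
  induction ds generalizing x with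
  | nil => simp [elems]
  | cons q ds ih =>
    have hq := h q (by simp)
    have ih := fun x => @ih x fun q hq => h q (by simp [hq])
    simp only [elems, extendElems, List.mem_flatMap, List.mem_filter, mem_rangeZ, ltb_eq_true, List.mem_map, ih]
    constructor
    · rintro ⟨r, ⟨⟨h1, -⟩, h2⟩, y, hy, rfl⟩
      exact .cons ⟨h1, h2⟩ hy
    · rintro (_ | @⟨_, r, _, y, ⟨h1, h2⟩, hy⟩)
      exact ⟨r, ⟨⟨h1, by omega⟩, h2⟩, y, hy, rfl⟩

def tuples (c : List El) (i : ℕ) : List (List El) := (tuplesStep c)^[i] [[]]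

theorem tuples_succ (c : List El) (i : ℕ) : tuples c (i + 1) = tuplesStep c (tuples c i) :=
  Function.iterate_succ_apply' _ _ _

theorem mem_tuples {c : List El} {i : ℕ} {X : List El} :
    X ∈ tuples c i ↔ X.length ≤ i ∧ ∀ x ∈ X, x ∈ c := by
  induction i generalizing X with
  | zero =>
    simp only [tuples, Function.iterate_zero, id_eq, List.mem_singleton, Nat.le_zero, List.length_eq_zero_iff]
    constructor
    · rintro rfl; simp
    · exact fun h => h.1
  | succ i ih =>
    rw [tuples_succ, tuplesStep, List.mem_cons]
    simp only [List.mem_flatMap, List.mem_map, ih]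
    constructor
    · rintro (rfl | ⟨x, hx, Y, ⟨h1, h2⟩, rfl⟩)
      · simp
      · simp only [List.length_cons, List.mem_cons]
        refine ⟨by omega, ?_⟩
        rintro y (rfl | hy)
        exacts [hx, h2 y hy]
    · rintro ⟨h1, h2⟩
      rcases X with _ | ⟨x, X⟩
      · exact .inl rfl
      · exact .inr ⟨x, h2 x (by simp), X, ⟨by simpa using h1, fun y hy => h2 y (by simp [hy])⟩, rfl⟩

theorem length_tuples_le (c : List El) (i : ℕ) : (tuples c i).length ≤ (c.length + 1) ^ i := by
  induction i with
  | zero => simp [tuples]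
  | succ i ih =>
    rw [tuples_succ, tuplesStep, List.length_cons, List.length_flatMap]
    simp only [List.length_map, List.map_const', List.sum_replicate, smul_eq_mul]
    have h3 : 1 ≤ (c.length + 1) ^ i := Nat.one_le_pow _ _ (by omega)
    calc _ ≤ c.length * (c.length + 1) ^ i + (c.length + 1) ^ i := by gcongr
      _ = _ := by ring

/-- The admissible inputs. -/
abbrev Input := {p : ℕ × ℕ // 1 ≤ p.1 ∧ 1 ≤ p.2}

instance : Enc Input := ⟨fun p => enc p.1⟩

/-- The measure for the running time. -/
def Input.mu (a : Input) : ℕ := a.1.1 * 2 ^ a.1.2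

namespace Input

theorem pb_two_pow : PB mu fun a => 2 ^ a.1.2 :=
  PB.self.mono fun a => Nat.le_mul_of_pos_left _ a.2.1

theorem pb_snd : PB mu fun a => a.1.2 := pb_two_pow.mono fun _ => Nat.lt_two_pow_self.le

theorem pb_fst : PB mu fun a => a.1.1 :=
  PB.self.mono fun a => Nat.le_mul_of_pos_right _ (by positivity)

/-- A bound for the heights of the right-hand sides. -/
def bound (a : Input) : ℕ := a.1.1 * a.1.2 * a.1.2

theorem pb_bound : PB mu bound := (pb_fst.mul pb_snd).mul pb_snd

theorem sz_natCast_le (n : ℕ) : sz (n : ℤ) ≤ 1 + n := by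
  have := PT.bits_natCast_le n
  rw [sz_int]; omega

theorem pb_sz : PB mu fun a : Input => sz a :=
  (((PB.const 1).add ((PB.const 1).add pb_fst)).add ((PB.const 1).add pb_snd)).mono fun a => by
    have : sz a = 1 + sz (a.1.1 : ℤ) + sz (a.1.2 : ℤ) := rfl
    have := sz_natCast_le a.1.1
    have := sz_natCast_le a.1.2
    omega

theorem polyOn_fst : PolyOn mu fun a : Input => (a.1.1 : ℤ) :=
  ⟨.instr .fst, fun _ => 1, PB.const 1, ((PB.const 1).add pb_fst).mono fun _ => sz_natCast_le _,
    fun _ => ⟨1, le_rfl, Run.instr .fst _⟩⟩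

theorem polyOn_snd : PolyOn mu fun a : Input => (a.1.2 : ℤ) :=
  ⟨.instr .snd, fun _ => 1, PB.const 1, ((PB.const 1).add pb_snd).mono fun _ => sz_natCast_le _,
    fun _ => ⟨1, le_rfl, Run.instr .snd _⟩⟩

end Input

/-- `(k, s) ↦ (0, 0 :: … :: k - 1 :: s)`. -/
def Prog.countdown : Prog :=
  .loop .pfst (.seq (.pair (.seq (.pair .pfst (.instr (.const 1))) (.instr .sub)) .psnd)
    (.pair .pfst (.pair .pfst .psnd)))

theorem run_countdown (k : ℕ) (s : List ℤ) : ∃ t ≤ k * (20 + k) + 2,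
    Run Prog.countdown (.pair (.int k) (enc s)) (.pair (.int 0) (enc (rangeZ k ++ s))) t := by
  induction k generalizing s with
  | zero => exact ⟨2, by omega, Run.loop_stop (Run.instr .fst _) (by simp [Instr.apply, Val.IsTrue])⟩
  | succ k ih =>
    obtain ⟨t, ht, hr⟩ := ih (k :: s)
    have h1 : Run (.seq (.pair .pfst (.instr (.const 1))) (.instr .sub)) (.pair (.int ((k + 1 : ℕ) : ℤ)) (enc s))
        (.int k) (1 + 1 + 1 + (1 + bits ((k + 1 : ℕ) : ℤ) + bits 1) + 1) := by
      have := ((Run.instr .fst (.pair (.int ((k + 1 : ℕ) : ℤ)) (enc s))).pair (Run.instr (.const 1) _)).seq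
        (Run.instr .sub _)
      convert this using 1
      · simp [Instr.apply]
      · rfl
    have h2 : Run (.pair .pfst (.pair .pfst .psnd)) (.pair (.int k) (enc s)) (.pair (.int k) (enc ((k : ℤ) :: s))) 5 :=
      (Run.instr .fst _).pair ((Run.instr .fst _).pair (Run.instr .snd _))
    have h3 : rangeZ (k + 1) ++ s = rangeZ k ++ (k : ℤ) :: s := by simp [rangeZ, List.range_succ]
    rw [h3]
    refine ⟨_, ?_, Run.loop_step (Run.instr .fst _) (by simp [Instr.apply, Val.IsTrue])
      ((h1.pair (Run.instr .snd _)).seq h2) hr⟩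
    have h4 := PT.bits_natCast_le (k + 1)
    have h5 : bits 1 = 1 := by decide
    simp only [Instr.cost]
    nlinarith

theorem PolyOn.rangeZ {α : Type} [Enc α] {μ : α → ℕ} {k : α → ℕ} (hk : PolyOn μ fun a => (k a : ℤ)) (hb : PB μ k) :
    PolyOn μ fun a => rangeZ (k a) := by
  obtain ⟨p, T, hT, -, h⟩ := hk.prodMk (PolyOn.comp (PT.const ([] : List ℤ)) hk)
  refine ⟨.seq (.seq p .countdown) .psnd, fun a => T a + (k a * (20 + k a) + 2) + 3,
    (hT.add ((hb.mul ((PB.const 20).add hb)).add (PB.const 2))).add (PB.const 3),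
    ((PB.const 1).add (hb.mul ((PB.const 2).add hb))).mono fun a => ?_, fun a => ?_⟩
  · refine (sz_list_le _ (1 + k a) fun z hz => ?_).trans (by rw [length_rangeZ]; exact le_of_eq (by ring))
    obtain ⟨h1, h2⟩ := mem_rangeZ.1 hz
    lift z to ℕ using h1
    have := Input.sz_natCast_le z
    omega
  · obtain ⟨t, ht, hr⟩ := h a
    obtain ⟨u, hu, hr'⟩ := run_countdown (k a) []
    rw [List.append_nil] at hr'
    exact ⟨_, by simp only [Instr.cost]; omega, (hr.seq hr').seq (Run.instr .snd _)⟩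

theorem pt_halveStep {α : Type} [Enc α] {s : α → ℤ × List ℤ} (hs : PT s) : PT fun a => halveStep (s a) := by
  unfold halveStep; fun_prop

theorem pt_logList {α : Type} [Enc α] {d : α → ℤ} {r : α → List ℤ} (hd : PT d) (hr : PT r) :
    PT fun a => logList (d a) (r a) := by
  unfold logList
  refine PT.snd (PT.foldl_linear (f := fun _ s _ => halveStep s) 3 (pt_halveStep (by fun_prop)) hr (by fun_prop) fun a s b => ?_)
  obtain ⟨m, l⟩ := s
  have h1 := PT.bits_div m 2
  have h2 := sz_pos a
  have h3 : sz (0 : ℤ) = 1 := by decide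
  unfold halveStep
  rcases leb 2 m <;> simp only [cond_true, cond_false, sz_pair, sz_cons, sz_int] at * <;> omega

/-! ### Sizes -/

theorem log_bound (Δ : ℕ) (h : 1 ≤ Δ) : (2 * Δ + 1) ^ (Nat.log 2 Δ + 1) ≤ (2 ^ Δ) ^ 4 := by
  have h1 : Δ < 2 ^ (Nat.log 2 Δ + 1) := Nat.lt_pow_succ_log_self (by norm_num) _
  have h2 : 2 ^ Nat.log 2 Δ ≤ Δ := Nat.pow_log_le_self 2 (by omega)
  generalize Nat.log 2 Δ = l at *
  have h3 : (l + 2) * (l + 1) ≤ 4 * 2 ^ l := by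
    clear h1 h2
    induction l with
    | zero => norm_num
    | succ l ih =>
      rcases l with _ | l
      · norm_num
      · rw [pow_succ]; nlinarith
  calc (2 * Δ + 1) ^ (l + 1) ≤ (2 ^ (l + 2)) ^ (l + 1) := by
        gcongr; rw [pow_succ]; omega
    _ = 2 ^ ((l + 2) * (l + 1)) := (pow_mul _ _ _).symm
    _ ≤ 2 ^ (Δ * 4) := Nat.pow_le_pow_right (by norm_num) (by omega)
    _ = _ := pow_mul _ _ _

theorem sz_small {Δ : ℕ} {z : ℤ} (h0 : 0 ≤ z) (h : z ≤ Δ) : sz z ≤ 1 + Δ := by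
  lift z to ℕ using h0
  have := Input.sz_natCast_le z
  omega

/-- A bound for the size of lists of at most `Δ` integers between `0` and `Δ`. -/
def sizeVec (Δ : ℕ) : ℕ := 1 + Δ * (2 + Δ)

theorem sz_vec {Δ : ℕ} {l : List ℤ} (hl : l.length ≤ Δ) (h : ∀ z ∈ l, 0 ≤ z ∧ z ≤ Δ) : sz l ≤ sizeVec Δ := by
  refine (sz_list_le _ (1 + Δ) fun z hz => sz_small (h z hz).1 (h z hz).2).trans ?_
  unfold sizeVec
  rw [← add_assoc]
  gcongr

theorem log_le (Δ : ℕ) : Nat.log 2 Δ ≤ Δ := Nat.log_le_self 2 Δ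

theorem sz_elems {Δ : ℕ} {ds x : List ℤ} (h : ∀ q ∈ ds, q ∈ range2 Δ) (hl : ds.length ≤ Δ)
    (hx : x ∈ elems (rangeZ Δ) ds) : sz x ≤ sizeVec Δ := by
  have h1 := (mem_elems fun q hq => (mem_range2.1 (h q hq)).2).1 hx
  refine sz_vec (h1.length_eq ▸ hl) fun z hz => ?_
  obtain ⟨i, hi, rfl⟩ := List.mem_iff_getElem.1 hz
  have h2 := h1.get (i := i) (by rw [h1.length_eq]; exact hi) hi
  have h3 := (mem_range2.1 (h _ (List.getElem_mem (by rw [h1.length_eq]; exact hi : i < ds.length)))).2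
  simp only [List.get_eq_getElem] at h2
  omega

/-- A bound for the size of the groups. -/
def sizeGrp (Δ : ℕ) : ℕ := 1 + sizeVec Δ + (1 + Δ * (1 + sizeVec Δ))

theorem sz_group {Δ i : ℕ} {g : Fin0} (hΔ : 1 ≤ Δ) (hi : i ≤ Nat.log 2 Δ) (h : g ∈ groups Δ i) :
    sz g ≤ sizeGrp Δ := by
  obtain ⟨h1, h2, h3, h4⟩ := of_mem_groups hΔ h
  have hl : g.1.length ≤ Δ := h1.trans (hi.trans (log_le Δ))
  have h5 : sz g.1 ≤ sizeVec Δ := sz_vec hl fun z hz => by have := mem_range2.1 (h2 z hz); omega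
  have h6 : sz g.2 ≤ 1 + Δ * (1 + sizeVec Δ) := (sz_list_le _ (sizeVec Δ) fun x hx =>
    sz_elems h2 hl (h3 ▸ hx)).trans (by gcongr)
  rw [← Prod.mk.eta (p := g), sz_pair]
  unfold sizeGrp; omega

theorem sz_cell {Δ i : ℕ} {g : Fin0} (hΔ : 1 ≤ Δ) (hi : i ≤ Nat.log 2 Δ) (h : g ∈ groups Δ i) {c : El}
    (hc : c ∈ cellsOf [0, 1] g.2) : sz c ≤ 3 + sizeVec Δ := by
  obtain ⟨h1, h2, h3, h4⟩ := of_mem_groups hΔ h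
  have hl : g.1.length ≤ Δ := h1.trans (hi.trans (log_le Δ))
  simp only [cellsOf, List.mem_flatMap, List.mem_map] at hc
  obtain ⟨z, hz, x, hx, rfl⟩ := hc
  have h5 := sz_elems h2 hl (h3 ▸ hx)
  have h6 : sz z ≤ 2 := by
    simp only [List.mem_cons, List.not_mem_nil, or_false] at hz
    rcases hz with rfl | rfl <;> decide
  rw [sz_pair]; omega

/-- A bound for the size of the lists of tuples. -/
def sizeTup (Δ : ℕ) : ℕ := 1 + (2 ^ Δ) ^ 4 * (1 + (1 + (Δ + 1) * (1 + (3 + sizeVec Δ))))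

theorem sz_tuples {Δ i j : ℕ} {g : Fin0} (hΔ : 1 ≤ Δ) (hi : i ≤ Nat.log 2 Δ) (h : g ∈ groups Δ i)
    (hj : j ≤ Nat.log 2 Δ + 1) : sz (tuples (cellsOf [0, 1] g.2) j) ≤ sizeTup Δ := by
  have hc : (cellsOf [0, 1] g.2).length ≤ 2 * Δ := by
    have := (of_mem_groups hΔ h).2.2.2
    simp [cellsOf]; omega
  refine (sz_list_le _ (1 + (Δ + 1) * (1 + (3 + sizeVec Δ))) fun X hX => ?_).trans ?_
  · obtain ⟨h1, h2⟩ := mem_tuples.1 hX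
    refine (sz_list_le _ (3 + sizeVec Δ) fun x hx => sz_cell hΔ hi h (h2 x hx)).trans ?_
    have := log_le Δ
    gcongr; omega
  · unfold sizeTup
    gcongr
    calc _ ≤ ((cellsOf [0, 1] g.2).length + 1) ^ j := length_tuples_le _ _
      _ ≤ (2 * Δ + 1) ^ (Nat.log 2 Δ + 1) := by
        refine (Nat.pow_le_pow_left (by omega) j).trans (Nat.pow_le_pow_right (by omega) hj)
      _ ≤ _ := log_bound Δ hΔ

/-- The groups with the tuples of their elements. -/
def groupTuples (Δ i j : ℕ) : List (Fin0 × List (List El)) :=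
  (groups Δ i).map fun g => (g, tuples (cellsOf [0, 1] g.2) j)

def growTuples (L : List (Fin0 × List (List El))) : List (Fin0 × List (List El)) :=
  L.map fun g => (g.1, tuplesStep (cellsOf [0, 1] g.1.2) g.2)

theorem iterate_growTuples (Δ i j : ℕ) : growTuples^[j] ((groups Δ i).map fun g => (g, [[]])) = groupTuples Δ i j := by
  induction j with
  | zero => rfl
  | succ j ih =>
    rw [Function.iterate_succ_apply', ih]
    simp [growTuples, groupTuples, tuples_succ]

theorem pt_growTuples {α : Type} [Enc α] {L : α → List (Fin0 × List (List El))} (hL : PT L) :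
    PT fun a => growTuples (L a) := by
  unfold growTuples; fun_prop

namespace Input

/-- The number of rounds for the groups. -/
def log (a : Input) : ℕ := Nat.log 2 a.1.2

def grps (a : Input) : List Fin0 := groups a.1.2 a.log

def rng (a : Input) : Rng := (rangeZ a.1.2, (range1 a.1.2, (range2 a.1.2, rangeZ (a.bound + 1))))

/-- The positive heights. -/
def heights (a : Input) : List ℤ := range1 a.bound

/-- The initial list: one item for every group. -/
def items₀ (a : Input) : List Item :=
  (groupTuples a.1.2 a.log (a.log + 1)).map fun g => mkItem a.rng a.heights a.grps g

theorem polyOn_range0 : PolyOn mu fun a : Input => rangeZ a.1.2 := polyOn_snd.rangeZ pb_snd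

theorem polyOn_range1 : PolyOn mu fun a : Input => range1 a.1.2 := by
  have : PT fun l : List ℤ => l.map fun z => z + 1 := by fun_prop
  exact (PolyOn.comp this polyOn_range0 :)

theorem polyOn_range2 : PolyOn mu fun a : Input => range2 a.1.2 := by
  have : PT fun l : List ℤ => l.filter fun z => leb 2 z := by fun_prop
  exact (PolyOn.comp this polyOn_range1 :)

theorem polyOn_bound : PolyOn mu fun a : Input => (a.bound : ℤ) := by
  have : PT fun p : ℤ × ℤ => p.1 * p.2 * p.2 := by fun_prop
  exact (PolyOn.comp this (polyOn_fst.prodMk polyOn_snd)).congr fun a => by simp [bound]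

end Input
end DeltaSimplex

namespace DeltaSimplex
open Enc

namespace Input

theorem pb_sizeVec : PB mu fun a => sizeVec a.1.2 :=
  (PB.const 1).add (pb_snd.mul ((PB.const 2).add pb_snd))

theorem pb_sizeGrp : PB mu fun a => sizeGrp a.1.2 :=
  ((PB.const 1).add pb_sizeVec).add ((PB.const 1).add (pb_snd.mul ((PB.const 1).add pb_sizeVec)))

theorem pb_sizeTup : PB mu fun a => sizeTup a.1.2 :=
  (PB.const 1).add ((pb_two_pow.pow 4).mul ((PB.const 1).add ((PB.const 1).add
    ((pb_snd.add (PB.const 1)).mul ((PB.const 1).add ((PB.const 3).add pb_sizeVec))))))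

theorem length_groups_le' (a : Input) {i : ℕ} (hi : i ≤ a.log) : (groups a.1.2 i).length ≤ (2 ^ a.1.2) ^ 4 := by
  refine (length_groups_le _ _).trans (le_trans ?_ (log_bound a.1.2 a.2.2))
  calc _ ≤ (2 * a.1.2 + 1) ^ i := Nat.pow_le_pow_left (by omega) i
    _ ≤ _ := Nat.pow_le_pow_right (by omega) (by unfold log at hi; omega)

theorem polyOn_log : PolyOn mu fun a : Input => logList a.1.2 (rangeZ a.1.2) := by
  have : PT fun p : ℤ × List ℤ => logList p.1 p.2 := pt_logList (by fun_prop) (by fun_prop)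
  exact (PolyOn.comp this (polyOn_snd.prodMk polyOn_range0) :)

theorem polyOn_grps : PolyOn mu grps := by
  have h : PT fun q : (List ℤ × List ℤ) × List Fin0 => groupsStep q.1.1 q.1.2 q.2 := by fun_prop
  have := PolyOn.iterate (f := fun e : List ℤ × List ℤ => groupsStep e.1 e.2) (s := fun _ => [([], [[]])])
    (polyOn_range0.prodMk polyOn_range2) h polyOn_log (PolyOn.of_pt (PT.const _) pb_sz)
    (fun a => 1 + (2 ^ a.1.2) ^ 4 * (1 + sizeGrp a.1.2))
    ((PB.const 1).add ((pb_two_pow.pow 4).mul ((PB.const 1).add pb_sizeGrp))) fun a i hi => by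
      rw [length_logList] at hi
      refine (sz_list_le _ (sizeGrp a.1.2) fun g hg => sz_group a.2.2 hi hg).trans ?_
      gcongr
      exact length_groups_le' a hi
  exact this.congr fun a => by rw [length_logList]; rfl

theorem polyOn_groupTuples : PolyOn mu fun a : Input => groupTuples a.1.2 a.log (a.log + 1) := by
  have h : PT fun q : ℤ × List (Fin0 × List (List El)) => growTuples q.2 := pt_growTuples (by fun_prop)
  have h0 : PT fun L : List Fin0 => L.map fun g => (g, ([[]] : List (List El))) := by fun_prop
  have h1 : PT fun L : List ℤ => 0 :: L := by fun_prop
  have := PolyOn.iterate (f := fun (_ : ℤ) => growTuples) polyOn_snd h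
    (PolyOn.comp h1 polyOn_log) (PolyOn.comp h0 polyOn_grps)
    (fun a => 1 + (2 ^ a.1.2) ^ 4 * (1 + (1 + sizeGrp a.1.2 + sizeTup a.1.2)))
    ((PB.const 1).add ((pb_two_pow.pow 4).mul ((PB.const 1).add (((PB.const 1).add pb_sizeGrp).add pb_sizeTup))))
    fun a i hi => by
      rw [List.length_cons, length_logList] at hi
      dsimp only [grps]
      rw [iterate_growTuples]
      refine (sz_list_le _ (1 + sizeGrp a.1.2 + sizeTup a.1.2) fun g hg => ?_).trans ?_
      · obtain ⟨g', hg', rfl⟩ := List.mem_map.1 hg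
        have h1 := sz_group a.2.2 le_rfl hg'
        have h2 := sz_tuples a.2.2 le_rfl hg' hi
        rw [sz_pair]; omega
      · gcongr
        rw [groupTuples, List.length_map]
        exact length_groups_le' a le_rfl
  exact this.congr fun a => by
    rw [List.length_cons, length_logList]
    exact iterate_growTuples _ _ _

theorem polyOn_rangeB : PolyOn mu fun a : Input => rangeZ (a.bound + 1) := by
  have : PT fun z : ℤ => z + 1 := by fun_prop
  exact PolyOn.rangeZ (((PolyOn.comp this polyOn_bound)).congr fun a => by simp) (pb_bound.add (PB.const 1))

theorem polyOn_rng : PolyOn mu rng :=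
  polyOn_range0.prodMk (polyOn_range1.prodMk (polyOn_range2.prodMk polyOn_rangeB))

theorem polyOn_heights : PolyOn mu heights := by
  have : PT fun l : List ℤ => l.map fun z => z + 1 := by fun_prop
  exact (PolyOn.comp this (polyOn_bound.rangeZ pb_bound) :)

theorem polyOn_items₀ : PolyOn mu items₀ := by
  have h : PT fun q : Rng × (List ℤ × (List Fin0 × List (Fin0 × List (List El)))) =>
      q.2.2.2.map fun g => mkItem q.1 q.2.1 q.2.2.1 g := by fun_prop
  exact (PolyOn.comp h (polyOn_rng.prodMk (polyOn_heights.prodMk (polyOn_grps.prodMk polyOn_groupTuples))) :)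

/-- A list of length `n + 1`. -/
theorem polyOn_rounds : PolyOn mu fun a : Input => rangeZ (a.1.1 + 1) := by
  have : PT fun z : ℤ => z + 1 := by fun_prop
  exact PolyOn.rangeZ (((PolyOn.comp this polyOn_fst)).congr fun a => by simp) (pb_fst.add (PB.const 1))

end Input

/-! ### The enumeration of multisets -/

theorem dropZ_natCast {β : Type} (l : List β) (k : ℕ) : dropZ l k = l.drop k := by
  have key : ∀ (l : List β) (m : ℕ), ((((List.range l.length).map fun i => ((i + m : ℕ) : ℤ)).zip l).filter
      fun p => leb k p.1).map (fun p => p.2) = l.drop (k - m) := by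
    intro l
    induction l with
    | nil => simp
    | cons b l ih =>
      intro m
      have h2 : ((List.range l.length).map fun i => ((i + 1 + m : ℕ) : ℤ)) =
          (List.range l.length).map fun i => ((i + (m + 1) : ℕ) : ℤ) := by
        simp only [List.map_inj_left]
        intro i _; congr 1; omega
      rw [List.length_cons, List.range_succ_eq_map, List.map_cons, List.map_map, List.zip_cons_cons]
      simp only [Function.comp_def, Nat.succ_eq_add_one]
      rw [h2]
      by_cases h : k ≤ m
      · rw [List.filter_cons_of_pos (by simpa using h), List.map_cons, ih, Nat.sub_eq_zero_of_le h,
          Nat.sub_eq_zero_of_le (by omega)]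
        simp
      · rw [List.filter_cons_of_neg (by simpa using h), ih]
        obtain ⟨j, rfl⟩ := Nat.exists_eq_add_of_lt (not_le.1 h)
        rw [show m + j + 1 - m = j + 1 by omega, show m + j + 1 - (m + 1) = j by omega]; simp
  simpa [dropZ, idx] using key l 0

theorem suffixes_eq {β : Type} (l : List β) : suffixes l = (List.range l.length).map fun k => l.drop k := by
  simp [suffixes, idx, dropZ_natCast]

theorem suffixes_nil {β : Type} : suffixes ([] : List β) = [] := rfl

theorem suffixes_cons {β : Type} (b : β) (l : List β) : suffixes (b :: l) = (b :: l) :: suffixes l := by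
  simp [suffixes_eq, List.range_succ_eq_map]

/-- The multisets of a given size, as sorted lists. -/
def multisets {β : Type} : ℕ → List β → List (List β)
  | 0, _ => [[]]
  | j + 1, l => (suffixes l).flatMap fun t => match t with
    | [] => []
    | c :: t => (multisets j (c :: t)).map fun w => c :: w

theorem multisets_nil {β : Type} (j : ℕ) : multisets (j + 1) ([] : List β) = [] := rfl

theorem multisets_cons {β : Type} (j : ℕ) (c : β) (l : List β) :
    multisets (j + 1) (c :: l) = (multisets j (c :: l)).map (fun w => c :: w) ++ multisets (j + 1) l := by
  simp [multisets, suffixes_cons]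

theorem length_multisets {β : Type} (j : ℕ) (l : List β) : (multisets j l).length = Nat.multichoose l.length j := by
  induction j generalizing l with
  | zero => simp [multisets]
  | succ j ihj =>
    induction l with
    | nil => simp [multisets_nil]
    | cons c l ih =>
      rw [multisets_cons, List.length_append, List.length_map, ihj, ih, List.length_cons, Nat.multichoose_succ_succ]
      omega

theorem iterate_flatMap {β : Type} (f : β → List β) (j : ℕ) (L : List β) :
    (fun L : List β => L.flatMap f)^[j] L = L.flatMap fun i => (fun L : List β => L.flatMap f)^[j] [i] := by
  induction j generalizing L with
  | zero => simp
  | succ j ih =>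
    rw [Function.iterate_succ_apply, ih, List.flatMap_assoc]
    congr 1; funext i
    rw [Function.iterate_succ_apply, ih (List.flatMap f [i])]
    simp

/-- All items after some rounds. -/
theorem iterate_itemStep (j : ℕ) (i : Item) :
    ((fun L : List Item => L.flatMap itemStep)^[j] [i]).map (fun i => (i.1, i.2.2)) =
      (multisets j i.2.1).map fun w => (i.1, w.reverse ++ i.2.2) := by
  induction j generalizing i with
  | zero => simp [multisets]
  | succ j ih =>
    obtain ⟨x, suf, rows⟩ := i
    rw [Function.iterate_succ_apply, iterate_flatMap]
    simp only [List.flatMap_singleton, itemStep, List.flatMap_map, List.map_flatMap, ih, multisets]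
    induction suf with
    | nil => simp [suffixes_nil]
    | cons c suf ih2 => rw [suffixes_cons, List.flatMap_cons, List.flatMap_cons, ih2]; simp [Function.comp_def]

theorem iterate_itemStep_list (j : ℕ) (L : List Item) :
    ((fun L : List Item => L.flatMap itemStep)^[j] L).map (fun i => (i.1, i.2.2)) =
      L.flatMap fun i => (multisets j i.2.1).map fun w => (i.1, w.reverse ++ i.2.2) := by
  rw [iterate_flatMap, List.map_flatMap]
  simp only [iterate_itemStep]

theorem itemStep_invariant {L₀ : List Item} (h0 : ∀ i ∈ L₀, i.2.2 = []) (j : ℕ) :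
    ∀ i ∈ (fun L : List Item => L.flatMap itemStep)^[j] L₀, ∃ i₀ ∈ L₀, i.1 = i₀.1 ∧ i.2.1.Sublist i₀.2.1 ∧
      i.2.2.length = j ∧ ∀ c ∈ i.2.2, c ∈ i₀.2.1 := by
  induction j with
  | zero => intro i hi; exact ⟨i, hi, rfl, List.Sublist.refl _, by simp [h0 i hi], by simp [h0 i hi]⟩
  | succ j ih =>
    intro i hi
    rw [Function.iterate_succ_apply'] at hi
    simp only [List.mem_flatMap, itemStep, List.mem_map, suffixes_eq, List.mem_range] at hi
    obtain ⟨i', hi', t, ⟨k, hk, rfl⟩, rfl⟩ := hi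
    obtain ⟨i₀, h1, h2, h3, h4, h5⟩ := ih i' hi'
    refine ⟨i₀, h1, h2, (List.drop_sublist _ _).trans h3, by simp [h4], fun c hc => ?_⟩
    rcases List.mem_cons.1 hc with rfl | hc
    · rw [List.drop_eq_getElem_cons hk, List.headD_cons]
      exact h3.subset (List.getElem_mem hk)
    · exact h5 c hc

end DeltaSimplex

namespace DeltaSimplex
open Enc

theorem filter_rangeZ {k n : ℕ} (hk : k ≤ n) (p : ℤ → Bool) (h : ∀ i : ℕ, i < n → (p i = true ↔ i < k)) :
    (rangeZ n).filter p = rangeZ k := by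
  unfold rangeZ
  rw [List.filter_map]
  congr 1
  obtain ⟨m, rfl⟩ := Nat.exists_eq_add_of_le hk
  rw [List.range_add, List.filter_append, List.filter_eq_self.2, List.filter_eq_nil_iff.2]
  · simp
  · simp only [List.mem_map, List.mem_range, Function.comp_apply]
    rintro _ ⟨i, hi, rfl⟩
    rw [h _ (by omega)]; omega
  · simp only [List.mem_range, Function.comp_apply]
    intro i hi
    exact (h i (by omega)).2 hi

theorem smallHeights_eq {Δ : ℕ} {F : List (List ℤ)} (hF : 1 ≤ F.length) :
    smallHeights (range1 Δ) F = range1 (Δ / F.length) := by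
  unfold smallHeights range1
  rw [List.filter_map, filter_rangeZ (Nat.div_le_self _ _)]
  intro i hi
  simp only [Function.comp_apply, leb_eq_true, List.length_map, length_rangeZ]
  rw [Nat.lt_iff_add_one_le, Nat.le_div_iff_mul_le hF]
  norm_cast

theorem length_cells_le {Δ : ℕ} (F : List (List ℤ)) :
    (cellsOf (smallHeights (range1 Δ) F) F).length ≤ Δ := by
  simp only [cellsOf, List.length_flatMap, List.length_map, List.map_const', List.sum_replicate, smul_eq_mul]
  rcases Nat.eq_zero_or_pos F.length with h | h
  · simp [h]
  · rw [smallHeights_eq h, length_range1]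
    exact Nat.div_mul_le_self _ _

theorem multichoose_le {K Δ n j : ℕ} (hK : K ≤ Δ) (hn : 1 ≤ n) (hj : j ≤ n + 1) (hΔ : 1 ≤ Δ) :
    Nat.multichoose K j ≤ (n + Δ) ^ (Δ - 1) := by
  have h1 : 1 ≤ (n + Δ) ^ (Δ - 1) := Nat.one_le_pow _ _ (by omega)
  rcases K with _ | K
  · rcases j with _ | j <;> simp [h1]
  · rw [Nat.multichoose_eq, show K + 1 + j - 1 = K + j by omega, Nat.choose_symm_add.symm]
    calc (K + j).choose K ≤ (K + j) ^ K := Nat.choose_le_pow _ _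
      _ ≤ (n + Δ) ^ K := Nat.pow_le_pow_left (by omega) _
      _ ≤ _ := Nat.pow_le_pow_right (by omega) (by omega)

namespace Input

def itemsAfter (a : Input) (j : ℕ) : List Item := (fun L : List Item => L.flatMap itemStep)^[j] a.items₀

/-- All candidates. -/
def items (a : Input) : List Item := a.itemsAfter (a.1.1 + 1)

theorem items₀_rows (a : Input) : ∀ i ∈ a.items₀, i.2.2 = [] := by
  intro i hi
  obtain ⟨g, -, rfl⟩ := List.mem_map.1 hi
  rfl

theorem length_itemsAfter (a : Input) {j : ℕ} (hj : j ≤ a.1.1 + 1) :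
    (a.itemsAfter j).length ≤ sz a.items₀ * (a.1.1 + a.1.2) ^ (a.1.2 - 1) := by
  have h := congrArg List.length (iterate_itemStep_list j a.items₀)
  rw [List.length_map, List.length_flatMap] at h
  unfold itemsAfter
  rw [h]
  refine (List.sum_le_card_nsmul _ ((a.1.1 + a.1.2) ^ (a.1.2 - 1)) ?_).trans ?_
  · simp only [List.mem_map]
    rintro _ ⟨i, hi, rfl⟩
    rw [List.length_map, length_multisets]
    obtain ⟨g, -, rfl⟩ := List.mem_map.1 hi
    exact multichoose_le (length_cells_le _) a.2.1 hj a.2.2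
  · rw [List.length_map, smul_eq_mul]
    exact Nat.mul_le_mul_right _ (length_le_sz _)

/-- A bound for the size of the items. -/
def sizeItem (a : Input) : ℕ := 2 * sz a.items₀ + (3 + (a.1.1 + 1) * (1 + sz a.items₀))

theorem pb_items₀ : PB mu fun a => sz a.items₀ := polyOn_items₀.choose_spec.choose_spec.2.1

theorem pb_sizeItem : PB mu sizeItem :=
  ((PB.const 2).mul pb_items₀).add ((PB.const 3).add ((pb_fst.add (PB.const 1)).mul ((PB.const 1).add pb_items₀)))

theorem sz_item (a : Input) {j : ℕ} (hj : j ≤ a.1.1 + 1) : ∀ i ∈ a.itemsAfter j, sz i ≤ a.sizeItem := by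
  intro i hi
  obtain ⟨i₀, h1, h2, h3, h4, h5⟩ := itemStep_invariant a.items₀_rows j i hi
  obtain ⟨x, suf, rows⟩ := i
  obtain ⟨x₀, suf₀, rows₀⟩ := i₀
  dsimp only at h2 h3 h4 h5
  subst h2
  have h6 := sz_mem_le h1
  have h7 := sz_sublist h3
  have h8 := sz_list_le rows (sz a.items₀) fun c hc => by
    have := sz_mem_le (h5 c hc)
    simp only [sz_pair] at h6; omega
  rw [h4] at h8
  have h9 := Nat.mul_le_mul_right (1 + sz a.items₀) hj
  simp only [sz_pair] at h6 ⊢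
  unfold sizeItem
  omega

end Input

/-- A program for `(s, b) ↦ s.flatMap g`. -/
theorem exists_flatMap_prog {g : Item → List β} [Enc β] (hg : PT g) :
    ∃ (p : Prog) (Q : Input → ℕ), PB Input.mu Q ∧ ∀ (a : Input) (L : List Item),
      L.length ≤ sz a.items₀ * (a.1.1 + a.1.2) ^ (a.1.2 - 1) → (∀ i ∈ L, sz i ≤ a.sizeItem) →
      ∀ x : Val, ∃ t ≤ (a.1.1 + a.1.2) ^ (a.1.2 - 1) * Q a, Run p (.pair x (enc L)) (enc (L.flatMap g)) t := by
  obtain ⟨q, U, ⟨c, hc⟩, ⟨d, hd⟩, hU⟩ := hg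
  refine ⟨.flatMap (.seq .psnd q), fun a => 200 * ((sz a.items₀ + 1) * ((a.sizeItem + 2) ^ c + 2 + (a.sizeItem + 2) ^ d + 1)),
    (PB.const 200).mul ((Input.pb_items₀.add (PB.const 1)).mul (((((Input.pb_sizeItem.add (PB.const 2)).pow c).add
      (PB.const 2)).add ((Input.pb_sizeItem.add (PB.const 2)).pow d)).add (PB.const 1))), fun a L hL hs x => ?_⟩
  obtain ⟨t, ht, hr⟩ := run_flatMap (p := .seq .psnd q) g x ((a.sizeItem + 2) ^ c + 2) ((a.sizeItem + 2) ^ d) L fun i hi => by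
    have h1 : sz i + 2 ≤ a.sizeItem + 2 := by have := hs i hi; omega
    obtain ⟨t, ht, hr⟩ := hU i
    refine ⟨(length_le_sz _).trans ((hd i).trans (Nat.pow_le_pow_left h1 d)), _, ?_, (Run.instr .snd (.pair x (enc i))).seq hr⟩
    have := (hc i).trans (Nat.pow_le_pow_left h1 c)
    simp only [Instr.cost]; omega
  refine ⟨t, ht.trans ?_, hr⟩
  have h1 : 1 ≤ (a.1.1 + a.1.2) ^ (a.1.2 - 1) := Nat.one_le_pow _ _ (by have := a.2.1; omega)
  generalize (a.1.1 + a.1.2) ^ (a.1.2 - 1) = N at *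
  have h2 : L.length + 1 ≤ N * (sz a.items₀ + 1) := by nlinarith
  exact (Nat.mul_le_mul_left 200 (Nat.mul_le_mul_right _ h2)).trans (le_of_eq (by ring))

/-- The whole program. -/
theorem exists_main_prog : ∃ (p : Prog) (c : ℕ), ∀ a : Input, ∃ t ≤ (a.1.1 + a.1.2) ^ (a.1.2 - 1) * (a.mu + 2) ^ c,
    Run p (enc a) (enc (a.items.flatMap emptyOf, a.items.flatMap latticeOf)) t := by
  obtain ⟨p₁, Q₁, hQ₁, h₁⟩ := exists_flatMap_prog (g := itemStep) (by fun_prop)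
  obtain ⟨p₂, Q₂, hQ₂, h₂⟩ := exists_flatMap_prog (g := emptyOf) (by fun_prop)
  obtain ⟨p₃, Q₃, hQ₃, h₃⟩ := exists_flatMap_prog (g := latticeOf) (by fun_prop)
  obtain ⟨p₀, T, hT, -, h₀⟩ := (PolyOn.of_pt (PT.const (0 : ℤ)) Input.pb_sz).prodMk
    (Input.polyOn_rounds.prodMk Input.polyOn_items₀)
  obtain ⟨c, hc⟩ : PB Input.mu fun a => T a + ((a.1.1 + 1) * (Q₁ a + 45) + 20) + Q₂ a + Q₃ a + 20 :=
    (((hT.add (((Input.pb_fst.add (PB.const 1)).mul (hQ₁.add (PB.const 45))).add (PB.const 20))).add hQ₂).add hQ₃).add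
      (PB.const 20)
  let dup : Prog := .pair (.instr (.const 0)) (.instr .id)
  refine ⟨.seq (.seq p₀ (.fold (.seq (.pair (.instr (.const 0)) (.seq .psnd .pfst)) p₁)))
    (.seq dup (.pair p₂ p₃)), c, fun a => ?_⟩
  have hN : 1 ≤ (a.1.1 + a.1.2) ^ (a.1.2 - 1) := Nat.one_le_pow _ _ (by have := a.2.1; omega)
  obtain ⟨t₀, ht₀, hr₀⟩ := h₀ a
  obtain ⟨t₁, ht₁, hr₁⟩ := run_fold (p := .seq (.pair (.instr (.const 0)) (.seq .psnd .pfst)) p₁)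
    (fun (L : List Item) (_ : ℤ) => L.flatMap itemStep) (.int 0)
    (fun l' s => ∃ j, j + l'.length = a.1.1 + 1 ∧ s = a.itemsAfter j) ((a.1.1 + a.1.2) ^ (a.1.2 - 1) * Q₁ a + 10)
    (by
      rintro s b l ⟨j, hj, rfl⟩
      rw [List.length_cons] at hj
      refine ⟨⟨j + 1, by omega, (Function.iterate_succ_apply' _ _ _).symm⟩, ?_⟩
      obtain ⟨t, ht, hr⟩ := h₁ a (a.itemsAfter j) (a.length_itemsAfter (by omega)) (a.sz_item (by omega)) (.int 0)
      refine ⟨_, ?_, ((Run.instr (.const 0) _).pair ((Run.instr .snd _).seq (Run.instr .fst _))).seq hr⟩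
      simp only [Instr.cost]; omega) (rangeZ (a.1.1 + 1)) a.items₀ ⟨0, by simp [length_rangeZ], rfl⟩
  rw [PolyOn.foldl_iterate, length_rangeZ] at hr₁
  rw [length_rangeZ] at ht₁
  obtain ⟨t₂, ht₂, hr₂⟩ := h₂ a a.items (a.length_itemsAfter le_rfl) (a.sz_item le_rfl) (.int 0)
  obtain ⟨t₃, ht₃, hr₃⟩ := h₃ a a.items (a.length_itemsAfter le_rfl) (a.sz_item le_rfl) (.int 0)
  have hdup : Run dup (enc a.items) (.pair (.int 0) (enc a.items)) 3 :=
    (Run.instr (.const 0) _).pair (Run.instr .id _)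
  refine ⟨_, ?_, (hr₀.seq hr₁).seq (hdup.seq (hr₂.pair hr₃))⟩
  refine le_trans ?_ (Nat.mul_le_mul_left _ (hc a))
  generalize (a.1.1 + a.1.2) ^ (a.1.2 - 1) = N at *
  have e1 : N * (T a + ((a.1.1 + 1) * (Q₁ a + 45) + 20) + Q₂ a + Q₃ a + 20) =
    N * T a + (N * ((a.1.1 + 1) * Q₁ a) + N * ((a.1.1 + 1) * 45) + N * 20) + N * Q₂ a + N * Q₃ a + N * 20 := by ring
  have e2 : (a.1.1 + 1) * (N * Q₁ a + 10 + 35) = N * ((a.1.1 + 1) * Q₁ a) + (a.1.1 + 1) * 45 := by ring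
  have e3 : T a ≤ N * T a := Nat.le_mul_of_pos_left _ hN
  have e4 : (a.1.1 + 1) * 45 ≤ N * ((a.1.1 + 1) * 45) := Nat.le_mul_of_pos_left _ hN
  rw [e1]
  rw [e2] at ht₁
  omega

/-! ### The bound for the running time -/

theorem time_bound (c : ℕ) : ∃ C : ℝ, 0 < C ∧ ∀ n Δ t : ℕ, 1 ≤ n → 1 ≤ Δ →
    t ≤ (n + Δ) ^ (Δ - 1) * (n * 2 ^ Δ + 2) ^ c →
    (t : ℝ) ≤ C * (C * ((n : ℝ) + (Δ : ℝ))) ^ (Δ - 1) * (n : ℝ) ^ (Real.logb 2 (Δ : ℝ) + C) := by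
  refine ⟨8 ^ c + c, by positivity, fun n Δ t hn hΔ ht => ?_⟩
  have hn' : (1 : ℝ) ≤ n := by exact_mod_cast hn
  have hΔ' : (1 : ℝ) ≤ Δ := by exact_mod_cast hΔ
  obtain ⟨m, rfl⟩ : ∃ m, Δ = m + 1 := ⟨Δ - 1, by omega⟩
  simp only [Nat.add_sub_cancel] at *
  have h8 : (1 : ℝ) ≤ 8 ^ c := one_le_pow₀ (by norm_num)
  have hc : (0 : ℝ) ≤ c := Nat.cast_nonneg c
  have h2 : ((n * 2 ^ (m + 1) + 2 : ℕ) : ℝ) ≤ 4 * n * 2 ^ m := by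
    push_cast
    have : (1 : ℝ) ≤ 2 ^ m := one_le_pow₀ (by norm_num)
    rw [pow_succ]
    nlinarith
  have h3 : (n : ℝ) ^ c ≤ (n : ℝ) ^ (Real.logb 2 ((m + 1 : ℕ) : ℝ) + (8 ^ c + c)) := by
    rw [← Real.rpow_natCast]
    apply Real.rpow_le_rpow_of_exponent_le hn'
    have := Real.logb_nonneg (b := 2) (by norm_num) hΔ'
    linarith
  have h4 : ((2 : ℝ) ^ m) ^ c ≤ (8 ^ c + c) ^ m := by
    rw [← pow_mul, mul_comm, pow_mul]
    refine pow_le_pow_left₀ (by positivity) ?_ m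
    have : (2 : ℝ) ^ c ≤ 8 ^ c := pow_le_pow_left₀ (by norm_num) (by norm_num) c
    linarith
  have h5 : (4 : ℝ) ^ c ≤ 8 ^ c + c := by
    have : (4 : ℝ) ^ c ≤ 8 ^ c := pow_le_pow_left₀ (by norm_num) (by norm_num) c
    linarith
  calc (t : ℝ) ≤ (((n + (m + 1)) ^ m * (n * 2 ^ (m + 1) + 2) ^ c : ℕ) : ℝ) := by exact_mod_cast ht
    _ = ((n : ℝ) + ((m + 1 : ℕ) : ℝ)) ^ m * ((n * 2 ^ (m + 1) + 2 : ℕ) : ℝ) ^ c := by push_cast; ring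
    _ ≤ ((n : ℝ) + ((m + 1 : ℕ) : ℝ)) ^ m * (4 * n * 2 ^ m) ^ c := by gcongr
    _ = 4 ^ c * (((2 : ℝ) ^ m) ^ c * ((n : ℝ) + ((m + 1 : ℕ) : ℝ)) ^ m) * n ^ c := by rw [mul_pow, mul_pow]; ring
    _ ≤ (8 ^ c + c) * ((8 ^ c + c) ^ m * ((n : ℝ) + ((m + 1 : ℕ) : ℝ)) ^ m) *
        (n : ℝ) ^ (Real.logb 2 ((m + 1 : ℕ) : ℝ) + (8 ^ c + c)) := by gcongr
    _ = _ := by rw [← mul_pow]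

theorem time_polynomial (c Δ : ℕ) : ∃ q : Polynomial ℕ, ∀ n t : ℕ,
    t ≤ (n + Δ) ^ (Δ - 1) * (n * 2 ^ Δ + 2) ^ c → t ≤ q.eval n :=
  ⟨(Polynomial.X + Polynomial.C Δ) ^ (Δ - 1) * (Polynomial.X * Polynomial.C (2 ^ Δ) + Polynomial.C 2) ^ c, fun n t h => by
    simpa using h⟩

end DeltaSimplex

namespace DeltaSimplex
open Matrix

/-! ### Systems and their groups -/

theorem exists_equiv_of_ker_eq {M G G' : Type*} [AddCommGroup M] [AddCommGroup G] [AddCommGroup G']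
    {φ : M →ₗ[ℤ] G} {ψ : M →ₗ[ℤ] G'} (hφ : Function.Surjective φ) (hψ : Function.Surjective ψ)
    (h : ∀ y, φ y = 0 ↔ ψ y = 0) : ∃ f : G ≃+ G', ∀ y, f (φ y) = ψ y := by
  have hk : LinearMap.ker φ = LinearMap.ker ψ := by ext y; exact h y
  refine ⟨((φ.quotKerEquivOfSurjective hφ).symm.trans ((Submodule.quotEquivOfEq _ _ hk).trans
    (ψ.quotKerEquivOfSurjective hψ))).toAddEquiv, fun y => ?_⟩
  have h1 : (φ.quotKerEquivOfSurjective hφ).symm (φ y) = Submodule.Quotient.mk y := by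
    rw [LinearEquiv.symm_apply_eq]; rfl
  change ψ.quotKerEquivOfSurjective hψ (Submodule.quotEquivOfEq _ _ hk
    ((φ.quotKerEquivOfSurjective hφ).symm (φ y))) = _
  rw [h1]; rfl

namespace System
variable {n : ℕ} {G G' : Type*} [AddCommGroup G] [AddCommGroup G']

/-- The sum of the elements `yᵢ gᵢ`. -/
abbrev comb (g : Fin (n + 1) → G) : (Fin (n + 1) → ℤ) →ₗ[ℤ] G := Fintype.linearCombination ℤ g

/-- The group `ℤⁿ⁺¹ / A ℤⁿ`, with the images of the unit vectors and of the right-hand side. -/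
structure Presents (σ : System n) (g : Fin (n + 1) → G) (β : G) : Prop where
  inj : Function.Injective (σ.A *ᵥ ·)
  surj : Function.Surjective (comb g)
  ker : ∀ y, comb g y = 0 ↔ ∃ x, σ.A *ᵥ x = y
  rhs : comb g σ.b = β

/-- Equality of systems up to the order of the inequalities and a unimodular substitution. -/
def Equivalent (σ τ : System n) : Prop :=
  ∃ (π : Equiv.Perm (Fin (n + 1))) (U : Matrix (Fin n) (Fin n) ℤ) (x₀ : Fin n → ℤ), IsUnit U.det ∧
    τ.A = σ.A.submatrix π id * U ∧ ∀ i, τ.b i = σ.b (π i) + (σ.A *ᵥ x₀) (π i)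

theorem submatrix_mulVec_perm (A : Matrix (Fin (n + 1)) (Fin n) ℤ) (π : Equiv.Perm (Fin (n + 1))) (x : Fin n → ℤ)
    (i : Fin (n + 1)) : (A.submatrix π id *ᵥ x) i = (A *ᵥ x) (π i) := rfl

theorem comb_comp_perm (g : Fin (n + 1) → G) (π : Equiv.Perm (Fin (n + 1))) (y : Fin (n + 1) → ℤ) :
    comb (g ∘ π) (y ∘ π) = comb g y := by
  simp only [Fintype.linearCombination_apply, Function.comp_apply]
  exact Equiv.sum_comp π fun i => y i • g i

theorem comb_symm (g : Fin (n + 1) → G) (π : Equiv.Perm (Fin (n + 1))) (y : Fin (n + 1) → ℤ) :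
    comb g (y ∘ π.symm) = comb (g ∘ π) y := by
  rw [← comb_comp_perm g π]; congr 1; ext i; simp

theorem map_comb (f : G →+ G') (g : Fin (n + 1) → G) (y : Fin (n + 1) → ℤ) :
    f (comb g y) = comb (f ∘ g) y := by
  simp [Fintype.linearCombination_apply, map_sum, map_zsmul]

/-- Equivalent systems present isomorphic data. -/
theorem Presents.exists_equiv {σ τ : System n} {g : Fin (n + 1) → G} {g' : Fin (n + 1) → G'} {β : G} {β' : G'}
    (h : σ.Presents g β) (h' : τ.Presents g' β') (e : σ.Equivalent τ) :
    ∃ (f : G ≃+ G') (π : Equiv.Perm (Fin (n + 1))), (∀ i, f (g (π i)) = g' i) ∧ f β = β' := by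
  obtain ⟨π, U, x₀, hU, hA, hb⟩ := e
  have key : ∀ y, comb g' (y ∘ π) = 0 ↔ comb g y = 0 := by
    intro y
    rw [h.ker, h'.ker]
    constructor
    · rintro ⟨x, hx⟩
      refine ⟨U *ᵥ x, ?_⟩
      rw [hA, ← mulVec_mulVec] at hx
      ext i
      obtain ⟨i, rfl⟩ := π.surjective i
      exact congrFun hx i
    · rintro ⟨x, rfl⟩
      refine ⟨U⁻¹ *ᵥ x, ?_⟩
      rw [hA, mulVec_mulVec, Matrix.mul_assoc, Matrix.mul_nonsing_inv _ hU, Matrix.mul_one]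
      rfl
  let ψ : (Fin (n + 1) → ℤ) →ₗ[ℤ] G' := (comb g').comp (LinearMap.funLeft ℤ ℤ π)
  have hψ : ∀ y, ψ y = comb g' (y ∘ π) := fun y => rfl
  obtain ⟨f, hf⟩ := exists_equiv_of_ker_eq (φ := comb g) (ψ := ψ) h.surj (fun z => by
    obtain ⟨y, rfl⟩ := h'.surj z
    exact ⟨y ∘ π.symm, by rw [hψ, Function.comp_assoc]; simp⟩) fun y => (key y).symm
  refine ⟨f, π, fun i => ?_, ?_⟩
  · have h1 := hf (Pi.single (π i) 1)
    rw [hψ] at h1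
    have h2 : (Pi.single (π i) 1 : Fin (n + 1) → ℤ) ∘ π = Pi.single i 1 := by
      ext j; simp [Pi.single_apply]
    rw [h2] at h1
    simpa using h1
  · rw [← h.rhs, hf, hψ, ← h'.rhs, ← sub_eq_zero, ← map_sub, h'.ker]
    refine ⟨U⁻¹ *ᵥ (-x₀), ?_⟩
    rw [hA, mulVec_mulVec, Matrix.mul_assoc, Matrix.mul_nonsing_inv _ hU, Matrix.mul_one]
    ext i
    rw [submatrix_mulVec_perm, Pi.sub_apply, hb, mulVec_neg]
    simp

/-- Systems that present isomorphic data are equivalent. -/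
theorem Presents.equivalent {σ τ : System n} {g : Fin (n + 1) → G} {g' : Fin (n + 1) → G'} {β : G} {β' : G'}
    (h : σ.Presents g β) (h' : τ.Presents g' β') (f : G ≃+ G') (π : Equiv.Perm (Fin (n + 1)))
    (hf : ∀ i, f (g (π i)) = g' i) (hβ : f β = β') : σ.Equivalent τ := by
  have hg : g' = f ∘ g ∘ π := by ext i; exact (hf i).symm
  have key : ∀ y, comb g' (y ∘ π) = f (comb g y) := by
    intro y
    rw [hg]
    exact (comb_comp_perm (f ∘ g) π y).trans (map_comb f.toAddMonoidHom g y).symm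
  have k2 : ∀ y, comb g' y = f (comb g (y ∘ π.symm)) := by
    intro y; rw [← key, Function.comp_assoc]; simp
  have h1 : ∀ x, ∃ z, σ.A.submatrix π id *ᵥ z = τ.A *ᵥ x := by
    intro x
    have h2 := (h'.ker (τ.A *ᵥ x)).2 ⟨x, rfl⟩
    rw [k2, map_eq_zero_iff f f.injective, h.ker] at h2
    obtain ⟨z, hz⟩ := h2
    refine ⟨z, ?_⟩
    ext i
    rw [submatrix_mulVec_perm, hz]; simp
  have h2 : ∀ x, ∃ z, τ.A *ᵥ z = σ.A.submatrix π id *ᵥ x := by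
    intro x
    have h2 := (h.ker (σ.A *ᵥ x)).2 ⟨x, rfl⟩
    rw [← map_eq_zero_iff f f.injective, ← key, h'.ker] at h2
    obtain ⟨z, hz⟩ := h2
    exact ⟨z, hz⟩
  have mat : ∀ {A B : Matrix (Fin (n + 1)) (Fin n) ℤ}, (∀ x, ∃ z, A *ᵥ z = B *ᵥ x) →
      ∃ U : Matrix (Fin n) (Fin n) ℤ, B = A * U := by
    intro A B hAB
    choose z hz using hAB
    refine ⟨of fun i j => z (Pi.single j 1) i, ?_⟩
    ext i j
    have := congrFun (hz (Pi.single j 1)) i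
    rw [mulVec_single_one] at this
    exact this.symm
  obtain ⟨U, hU⟩ := mat h1
  obtain ⟨V, hV⟩ := mat h2
  have hVU : V * U = 1 := by
    refine Matrix.toLin'.injective (LinearMap.ext fun x => h'.inj ?_)
    simp only [toLin'_apply, one_mulVec, mulVec_mulVec]
    rw [← Matrix.mul_assoc, ← hV, ← hU]
  have hdet : IsUnit U.det := by
    have : V.det * U.det = 1 := by rw [← det_mul, hVU, det_one]
    exact IsUnit.of_mul_eq_one_right _ this
  have h3 : comb g' (τ.b - σ.b ∘ π) = 0 := by
    rw [map_sub, h'.rhs, key, h.rhs, hβ, sub_self]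
  obtain ⟨z, hz⟩ := (h'.ker _).1 h3
  refine ⟨π, U, U *ᵥ z, hdet, hU, fun i => ?_⟩
  have h4 := congrFun hz i
  rw [hU, ← mulVec_mulVec, submatrix_mulVec_perm, Pi.sub_apply, Function.comp_apply] at h4
  rw [h4]; ring

/-! ### Equivalent systems define equivalent polyhedra -/

/-- The slack of an inequality. -/
def slack (σ : System n) (x : Fin n → ℝ) (i : Fin (n + 1)) : ℝ := σ.b i - ∑ j, (σ.A i j : ℝ) * x j

theorem mem_polyhedron {σ : System n} {x : Fin n → ℝ} : x ∈ σ.polyhedron ↔ ∀ i, 0 ≤ σ.slack x i := by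
  simp [polyhedron, slack]

/-- The affine map of a unimodular substitution. -/
def affine (U : Matrix (Fin n) (Fin n) ℤ) (x₀ : Fin n → ℤ) (x : Fin n → ℝ) (i : Fin n) : ℝ :=
  (∑ j, (U i j : ℝ) * x j) + (x₀ i : ℝ)

/-- The system for the preimage under an affine map. -/
def pullback (σ : System n) (U : Matrix (Fin n) (Fin n) ℤ) (x₀ : Fin n → ℤ) : System n :=
  ⟨σ.A * U, σ.b - σ.A *ᵥ x₀⟩

theorem slack_pullback (σ : System n) (U : Matrix (Fin n) (Fin n) ℤ) (x₀ : Fin n → ℤ) (x : Fin n → ℝ) :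
    (σ.pullback U x₀).slack x = σ.slack (affine U x₀ x) := by
  ext i
  simp only [slack, pullback, affine, Pi.sub_apply, Matrix.mul_apply, mulVec, dotProduct]
  push_cast
  simp only [mul_add, Finset.sum_add_distrib, Finset.mul_sum, Finset.sum_mul]
  rw [Finset.sum_comm]
  simp only [mul_assoc]
  ring

theorem affine_affine (U V : Matrix (Fin n) (Fin n) ℤ) (x₀ y₀ : Fin n → ℤ) (x : Fin n → ℝ) :
    affine U x₀ (affine V y₀ x) = affine (U * V) (U *ᵥ y₀ + x₀) x := by
  ext i
  simp only [affine, Matrix.mul_apply, mulVec, dotProduct, Pi.add_apply]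
  push_cast
  simp only [mul_add, Finset.sum_add_distrib, Finset.mul_sum, Finset.sum_mul]
  rw [Finset.sum_comm]
  simp only [mul_assoc, add_assoc]

theorem affine_one (x : Fin n → ℝ) : affine 1 0 x = x := by
  ext i; simp [affine, Matrix.one_apply]

theorem affine_inv {U : Matrix (Fin n) (Fin n) ℤ} (hU : IsUnit U.det) (x₀ : Fin n → ℤ) (x : Fin n → ℝ) :
    affine U x₀ (affine U⁻¹ (-(U⁻¹ *ᵥ x₀)) x) = x := by
  rw [affine_affine, mulVec_neg, mulVec_mulVec, Matrix.mul_nonsing_inv _ hU, one_mulVec, neg_add_cancel, affine_one]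

theorem inv_affine {U : Matrix (Fin n) (Fin n) ℤ} (hU : IsUnit U.det) (x₀ : Fin n → ℤ) (x : Fin n → ℝ) :
    affine U⁻¹ (-(U⁻¹ *ᵥ x₀)) (affine U x₀ x) = x := by
  rw [affine_affine, Matrix.nonsing_inv_mul _ hU, add_neg_cancel, affine_one]

theorem unimodularEquiv_iff {S T : Set (Fin n → ℝ)} : UnimodularEquiv S T ↔
    ∃ (U : Matrix (Fin n) (Fin n) ℤ) (x₀ : Fin n → ℤ), IsUnit U.det ∧ ∀ x, x ∈ S ↔ affine U x₀ x ∈ T := by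
  constructor
  · rintro ⟨U, x₀, hU, rfl⟩
    refine ⟨U, x₀, hU, fun x => ⟨fun h => ⟨x, h, rfl⟩, ?_⟩⟩
    rintro ⟨y, hy, hxy⟩
    have h1 : affine U x₀ y = affine U x₀ x := hxy
    rw [← inv_affine hU x₀ x, ← h1, inv_affine hU]
    exact hy
  · rintro ⟨U, x₀, hU, h⟩
    refine ⟨U, x₀, hU, Set.ext fun y => ⟨?_, fun hy => ?_⟩⟩
    · rintro ⟨x, hx, rfl⟩; exact (h x).1 hx
    · exact ⟨affine U⁻¹ (-(U⁻¹ *ᵥ x₀)) y, (h _).2 (by rwa [affine_inv hU]), affine_inv hU x₀ y⟩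

theorem _root_.DeltaSimplex.UnimodularEquiv.symm {S T : Set (Fin n → ℝ)} (h : UnimodularEquiv S T) : UnimodularEquiv T S := by
  obtain ⟨U, x₀, hU, h⟩ := unimodularEquiv_iff.1 h
  refine unimodularEquiv_iff.2 ⟨U⁻¹, -(U⁻¹ *ᵥ x₀), ?_, fun y => ?_⟩
  · rw [Matrix.det_nonsing_inv]; exact hU.ringInverse
  · rw [h, affine_inv hU]

theorem mem_polyhedron_pullback {σ : System n} {U : Matrix (Fin n) (Fin n) ℤ} {x₀ : Fin n → ℤ} {x : Fin n → ℝ} :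
    x ∈ (σ.pullback U x₀).polyhedron ↔ affine U x₀ x ∈ σ.polyhedron := by
  rw [mem_polyhedron, mem_polyhedron, slack_pullback]

theorem Equivalent.unimodularEquiv {σ τ : System n} (h : σ.Equivalent τ) :
    UnimodularEquiv σ.polyhedron τ.polyhedron := by
  obtain ⟨π, U, x₀, hU, hA, hb⟩ := h
  refine UnimodularEquiv.symm (unimodularEquiv_iff.2 ⟨U, -x₀, hU, fun x => ?_⟩)
  rw [← mem_polyhedron_pullback, mem_polyhedron, mem_polyhedron]
  refine π.forall_congr fun i => ?_
  suffices τ.slack x i = (σ.pullback U (-x₀)).slack x (π i) by rw [this]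
  have hA' : ∀ j, τ.A i j = (σ.A * U) (π i) j := fun j => by rw [hA]; rfl
  simp only [slack, pullback, hA', hb, mulVec_neg, sub_neg_eq_add, Pi.add_apply]

end System
end DeltaSimplex

namespace DeltaSimplex
open Matrix

namespace System
variable {n : ℕ}

/-- The rows of the matrix have a positive relation, and the right-hand side is positive for it. -/
structure IsPos (σ : System n) (w : Fin (n + 1) → ℤ) : Prop where
  inj : ∀ x, σ.A *ᵥ x = 0 → x = 0
  pos : ∀ i, 0 < w i
  ker : w ᵥ* σ.A = 0
  rhs : 0 < w ⬝ᵥ σ.b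

/-- The determinant of the matrix without one row. -/
def minor (σ : System n) (i : Fin (n + 1)) : ℤ := (σ.A.submatrix i.succAbove id).det

theorem eq_zero_of_minor {σ : System n} {i : Fin (n + 1)} (hi : σ.minor i ≠ 0) {x : Fin n → ℝ}
    (h : ∀ j, j ≠ i → ∑ k, (σ.A j k : ℝ) * x k = 0) : x = 0 := by
  by_contra hx
  have h1 : ((σ.A.submatrix i.succAbove id).map (Int.cast : ℤ → ℝ)).det = 0 := by
    refine Matrix.exists_mulVec_eq_zero_iff.1 ⟨x, hx, ?_⟩
    ext j
    exact h _ (Fin.succAbove_ne i j)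
  have h2 : ((σ.A.submatrix i.succAbove id).map (Int.cast : ℤ → ℝ)).det = (σ.minor i : ℝ) :=
    (Int.castRingHom ℝ).map_det _ |>.symm
  rw [h2] at h1
  exact hi (by exact_mod_cast h1)

theorem exists_solution {σ : System n} {i : Fin (n + 1)} (hi : σ.minor i ≠ 0) :
    ∃ v : Fin n → ℝ, ∀ j, j ≠ i → σ.slack v j = 0 := by
  let M : Matrix (Fin n) (Fin n) ℝ := (σ.A.submatrix i.succAbove id).map (Int.cast : ℤ → ℝ)
  have h2 : M.det = (σ.minor i : ℝ) := (Int.castRingHom ℝ).map_det _ |>.symm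
  have h3 : IsUnit M.det := by
    rw [h2, isUnit_iff_ne_zero]; exact_mod_cast hi
  refine ⟨M⁻¹ *ᵥ fun j => σ.b (i.succAbove j), fun j hj => ?_⟩
  obtain ⟨k, rfl⟩ := Fin.exists_succAbove_eq hj
  have h4 : M *ᵥ (M⁻¹ *ᵥ fun j => (σ.b (i.succAbove j) : ℝ)) = fun j => (σ.b (i.succAbove j) : ℝ) := by
    rw [mulVec_mulVec, Matrix.mul_nonsing_inv _ h3, one_mulVec]
  have h5 := congrFun h4 k
  exact sub_eq_zero.2 h5.symm

theorem slack_sum {σ : System n} {m : ℕ} (l : Fin m → ℝ) (hl : ∑ j, l j = 1) (v : Fin m → Fin n → ℝ) (i : Fin (n + 1)) :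
    σ.slack (∑ j, l j • v j) i = ∑ j, l j * σ.slack (v j) i := by
  simp only [slack, Finset.sum_apply, Pi.smul_apply, smul_eq_mul, mul_sub, Finset.sum_sub_distrib, ← Finset.sum_mul, hl,
    one_mul, Finset.mul_sum]
  rw [Finset.sum_comm]
  congr 1
  exact Finset.sum_congr rfl fun _ _ => Finset.sum_congr rfl fun _ _ => by ring

namespace IsPos
variable {σ : System n} {w : Fin (n + 1) → ℤ}

theorem minor_ne_zero (h : σ.IsPos w) (i : Fin (n + 1)) : σ.minor i ≠ 0 := by
  intro h0
  obtain ⟨x, hx, h1⟩ := Matrix.exists_mulVec_eq_zero_iff.2 h0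
  refine hx (h.inj x ?_)
  have h2 : ∀ j, j ≠ i → (σ.A *ᵥ x) j = 0 := by
    intro j hj
    obtain ⟨k, rfl⟩ := Fin.exists_succAbove_eq hj
    exact congrFun h1 k
  have h3 : w ⬝ᵥ (σ.A *ᵥ x) = 0 := by rw [dotProduct_mulVec, h.ker, zero_dotProduct]
  rw [dotProduct, Finset.sum_eq_single i (fun j _ hj => by rw [h2 j hj, mul_zero]) (by simp)] at h3
  ext j
  by_cases hj : j = i
  · subst hj
    exact (mul_eq_zero.1 h3).resolve_left (h.pos j).ne'
  · exact h2 j hj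

theorem sum_slack_of_ker (h : w ᵥ* σ.A = 0) (x : Fin n → ℝ) : ∑ i, (w i : ℝ) * σ.slack x i = ((w ⬝ᵥ σ.b : ℤ) : ℝ) := by
  have h1 : ∀ j, ∑ i, (w i : ℝ) * (σ.A i j : ℝ) = 0 := by
    intro j
    have := congrFun h j
    simp only [vecMul, dotProduct, Pi.zero_apply] at this
    exact_mod_cast this
  simp only [slack, mul_sub, Finset.sum_sub_distrib, dotProduct, Finset.mul_sum]
  rw [Finset.sum_comm]
  simp only [← mul_assoc, ← Finset.sum_mul, h1, zero_mul, Finset.sum_const_zero, sub_zero]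
  push_cast
  rfl

theorem sum_slack (h : σ.IsPos w) (x : Fin n → ℝ) : ∑ i, (w i : ℝ) * σ.slack x i = ((w ⬝ᵥ σ.b : ℤ) : ℝ) :=
  sum_slack_of_ker h.ker x

theorem eq_of_slack (h : σ.IsPos w) {x y : Fin n → ℝ} {i : Fin (n + 1)} (hxy : ∀ j, j ≠ i → σ.slack x j = σ.slack y j) :
    x = y := by
  refine sub_eq_zero.1 (eq_zero_of_minor (h.minor_ne_zero i) fun j hj => ?_)
  have := hxy j hj
  simp only [slack] at this
  simp only [Pi.sub_apply, mul_sub, Finset.sum_sub_distrib]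
  linarith

/-- The vertices. -/
noncomputable def vertex (h : σ.IsPos w) (i : Fin (n + 1)) : Fin n → ℝ :=
  (exists_solution (h.minor_ne_zero i)).choose

theorem slack_vertex_ne (h : σ.IsPos w) {i j : Fin (n + 1)} (hj : j ≠ i) : σ.slack (h.vertex i) j = 0 :=
  (exists_solution (h.minor_ne_zero i)).choose_spec j hj

theorem rhs_pos (h : σ.IsPos w) : (0 : ℝ) < ((w ⬝ᵥ σ.b : ℤ) : ℝ) := by exact_mod_cast h.rhs

theorem w_pos (h : σ.IsPos w) (i : Fin (n + 1)) : (0 : ℝ) < w i := by exact_mod_cast h.pos i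

theorem slack_vertex_self (h : σ.IsPos w) (i : Fin (n + 1)) :
    (w i : ℝ) * σ.slack (h.vertex i) i = ((w ⬝ᵥ σ.b : ℤ) : ℝ) := by
  rw [← h.sum_slack (h.vertex i), Finset.sum_eq_single i (fun j _ hj => by rw [h.slack_vertex_ne hj, mul_zero]) (by simp)]

theorem slack_vertex_pos (h : σ.IsPos w) (i : Fin (n + 1)) : 0 < σ.slack (h.vertex i) i :=
  pos_of_mul_pos_right (h.slack_vertex_self i ▸ h.rhs_pos) (h.w_pos i).le

theorem vertex_mem (h : σ.IsPos w) (i : Fin (n + 1)) : h.vertex i ∈ σ.polyhedron := by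
  rw [mem_polyhedron]
  intro j
  by_cases hj : j = i
  · exact hj ▸ (h.slack_vertex_pos i).le
  · exact (h.slack_vertex_ne hj).ge

theorem sum_vertex (h : σ.IsPos w) (l : Fin (n + 1) → ℝ) (hl : ∑ j, l j = 1) (i : Fin (n + 1)) :
    σ.slack (∑ j, l j • h.vertex j) i = l i * σ.slack (h.vertex i) i := by
  rw [slack_sum l hl, Finset.sum_eq_single i (fun j _ hj => by rw [h.slack_vertex_ne hj.symm, mul_zero]) (by simp)]

/-- The barycentric coordinates. -/
theorem sum_coords (h : σ.IsPos w) (x : Fin n → ℝ) : ∑ i, σ.slack x i / σ.slack (h.vertex i) i = 1 := by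
  have h1 : ∀ i, σ.slack x i / σ.slack (h.vertex i) i = (w i * σ.slack x i) / ((w ⬝ᵥ σ.b : ℤ) : ℝ) := by
    intro i
    rw [← h.slack_vertex_self i, mul_div_mul_left _ _ (h.w_pos i).ne']
  simp only [h1, ← Finset.sum_div, h.sum_slack]
  exact div_self h.rhs_pos.ne'

theorem eq_sum_vertex (h : σ.IsPos w) (x : Fin n → ℝ) :
    x = ∑ i, (σ.slack x i / σ.slack (h.vertex i) i) • h.vertex i :=
  h.eq_of_slack (i := 0) fun j _ => by
    rw [h.sum_vertex _ (h.sum_coords x), div_mul_cancel₀ _ (h.slack_vertex_pos j).ne']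

theorem convex_polyhedron (σ : System n) : Convex ℝ σ.polyhedron := by
  intro x hx y hy a b ha hb hab i
  have h1 := hx i
  have h2 := hy i
  have h3 : ∑ j, (σ.A i j : ℝ) * (a • x + b • y) j = a * ∑ j, (σ.A i j : ℝ) * x j + b * ∑ j, (σ.A i j : ℝ) * y j := by
    simp only [Pi.add_apply, Pi.smul_apply, smul_eq_mul, Finset.mul_sum, ← Finset.sum_add_distrib]
    exact Finset.sum_congr rfl fun _ _ => by ring
  rw [h3]
  calc _ ≤ a * (σ.b i : ℝ) + b * (σ.b i : ℝ) := by gcongr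
    _ = (a + b) * (σ.b i : ℝ) := by ring
    _ = _ := by rw [hab, one_mul]

theorem polyhedron_eq (h : σ.IsPos w) : σ.polyhedron = convexHull ℝ (Set.range h.vertex) := by
  apply subset_antisymm
  · intro x hx
    rw [h.eq_sum_vertex x]
    refine (convex_convexHull ℝ _).sum_mem (fun i _ => ?_) (h.sum_coords x) fun i _ => subset_convexHull _ _ ⟨i, rfl⟩
    exact div_nonneg (mem_polyhedron.1 hx i) (h.slack_vertex_pos i).le
  · refine convexHull_min ?_ (convex_polyhedron σ)
    rintro _ ⟨i, rfl⟩
    exact h.vertex_mem i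

theorem isSimplex (h : σ.IsPos w) : IsSimplex σ.polyhedron := by
  refine ⟨h.vertex, ?_, h.polyhedron_eq⟩
  rw [affineIndependent_iff]
  intro s l hl h0 i hi
  classical
  have h1 : ∑ j ∈ s, l j * σ.slack (h.vertex j) i = 0 := by
    simp only [slack, mul_sub, Finset.sum_sub_distrib, ← Finset.sum_mul, hl, zero_mul, Finset.mul_sum, zero_sub,
      neg_eq_zero]
    rw [Finset.sum_comm]
    refine Finset.sum_eq_zero fun k _ => ?_
    have h2 := congrFun h0 k
    simp only [Finset.sum_apply, Pi.smul_apply, smul_eq_mul, Pi.zero_apply] at h2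
    calc _ = (σ.A i k : ℝ) * ∑ j ∈ s, l j * h.vertex j k := by
          rw [Finset.mul_sum]; exact Finset.sum_congr rfl fun _ _ => by ring
      _ = 0 := by rw [h2, mul_zero]
  rw [Finset.sum_eq_single i (fun j _ hj => by rw [h.slack_vertex_ne hj.symm, mul_zero]) (fun h => (h hi).elim)] at h1
  exact (mul_eq_zero.1 h1).resolve_right (h.slack_vertex_pos i).ne'

theorem extremePoints_eq (h : σ.IsPos w) : σ.polyhedron.extremePoints ℝ = Set.range h.vertex := by
  apply subset_antisymm
  · rw [h.polyhedron_eq]; exact extremePoints_convexHull_subset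
  · rintro _ ⟨i, rfl⟩
    rw [mem_extremePoints_iff_left]
    refine ⟨h.vertex_mem i, fun x hx y hy hxy => h.eq_of_slack (i := i) fun j hj => ?_⟩
    obtain ⟨a, b, ha, hb, hab, he⟩ := hxy
    have h1 : σ.slack (h.vertex i) j = a * σ.slack x j + b * σ.slack y j := by
      have := slack_sum (σ := σ) ![a, b] (by simpa using hab) ![x, y] j
      simpa [he] using this
    rw [h.slack_vertex_ne hj] at h1 ⊢
    have h2 := mem_polyhedron.1 hx j
    have h3 := mem_polyhedron.1 hy j
    nlinarith [mul_nonneg ha.le h2, mul_nonneg hb.le h3]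

theorem vertex_injective (h : σ.IsPos w) : Function.Injective h.vertex := by
  intro i j hij
  by_contra hne
  have h1 := h.slack_vertex_pos i
  rw [hij, h.slack_vertex_ne hne] at h1
  exact lt_irrefl _ h1

end IsPos

theorem exists_left_kernel (A : Matrix (Fin (n + 1)) (Fin n) ℤ) : ∃ w : Fin (n + 1) → ℤ, w ≠ 0 ∧ w ᵥ* A = 0 := by
  let M : Matrix (Fin (n + 1)) (Fin (n + 1)) ℤ := of fun i => Fin.snoc (A i) 0
  have h0 : M.det = 0 := det_eq_zero_of_column_eq_zero (Fin.last n) fun i => by simp [M]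
  obtain ⟨w, hw, h⟩ := Matrix.exists_vecMul_eq_zero_iff.2 h0
  refine ⟨w, hw, ?_⟩
  ext j
  have := congrFun h j.castSucc
  simpa [M, vecMul, dotProduct] using this

/-- The kernel of a nonzero functional that vanishes on the columns consists of their combinations. -/
theorem exists_real_solution {A : Matrix (Fin (n + 1)) (Fin n) ℤ} (hA : ∀ x : Fin n → ℝ, A.map (Int.cast : ℤ → ℝ) *ᵥ x = 0 → x = 0)
    {w : Fin (n + 1) → ℤ} (hw : w ≠ 0) (h : w ᵥ* A = 0) {y : Fin (n + 1) → ℝ} (hy : ∑ i, (w i : ℝ) * y i = 0) :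
    ∃ x, A.map (Int.cast : ℤ → ℝ) *ᵥ x = y := by
  let W : Fin (n + 1) → ℝ := fun i => w i
  have hW : W ⬝ᵥ W ≠ 0 := by
    rw [Ne, dotProduct_self_eq_zero]
    intro h0
    exact hw (funext fun i => by have h1 : (w i : ℝ) = 0 := congrFun h0 i; exact_mod_cast h1)
  have hk : ∀ x, W ⬝ᵥ (A.map (Int.cast : ℤ → ℝ) *ᵥ x) = 0 := by
    intro x
    have : W ᵥ* (A.map (Int.cast : ℤ → ℝ)) = 0 := by
      ext j
      have := congrFun h j
      simp only [vecMul, dotProduct, Pi.zero_apply, map_apply, W] at this ⊢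
      exact_mod_cast this
    rw [dotProduct_mulVec, this, zero_dotProduct]
  let f : ((Fin n → ℝ) × ℝ) →ₗ[ℝ] (Fin (n + 1) → ℝ) :=
    (A.map (Int.cast : ℤ → ℝ)).mulVecLin.coprod (LinearMap.toSpanSingleton ℝ _ W)
  have hf : ∀ x s, f (x, s) = A.map (Int.cast : ℤ → ℝ) *ᵥ x + s • W := fun x s => by simp [f]
  have hWf : ∀ x s, W ⬝ᵥ f (x, s) = s * (W ⬝ᵥ W) := fun x s => by
    rw [hf, dotProduct_add, hk, zero_add, dotProduct_smul, smul_eq_mul]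
  have hinj : Function.Injective f := by
    rw [← LinearMap.ker_eq_bot, LinearMap.ker_eq_bot']
    rintro ⟨x, s⟩ h0
    have h1 := hWf x s
    rw [h0, dotProduct_zero] at h1
    have hs : s = 0 := (mul_eq_zero.1 h1.symm).resolve_right hW
    subst hs
    rw [hf, zero_smul, add_zero] at h0
    rw [hA x h0]; rfl
  have hsurj := (LinearMap.injective_iff_surjective_of_finrank_eq_finrank (f := f) (by simp)).1 hinj
  obtain ⟨⟨x, s⟩, hx⟩ := hsurj y
  have h1 := hWf x s
  rw [hx] at h1
  have hs : s = 0 := by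
    have h2 : W ⬝ᵥ y = 0 := hy
    rw [h2] at h1
    exact (mul_eq_zero.1 h1.symm).resolve_right hW
  subst hs
  exact ⟨x, by rw [← hx, hf, zero_smul, add_zero]⟩

end System
end DeltaSimplex

namespace DeltaSimplex
open Matrix

namespace System
variable {n : ℕ} {σ τ : System n} {w w' : Fin (n + 1) → ℤ}

/-! ### Rank and minors -/

theorem map_mulVec_eq_zero {K : Type*} [Field K] [CharZero K] {i : Fin (n + 1)} (hi : σ.minor i ≠ 0) {x : Fin n → K}
    (h : σ.A.map (Int.cast : ℤ → K) *ᵥ x = 0) : x = 0 := by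
  by_contra hx
  have h1 : ((σ.A.submatrix i.succAbove id).map (Int.cast : ℤ → K)).det = 0 :=
    Matrix.exists_mulVec_eq_zero_iff.1 ⟨x, hx, funext fun j => congrFun h (i.succAbove j)⟩
  have h2 : ((σ.A.submatrix i.succAbove id).map (Int.cast : ℤ → K)).det = (σ.minor i : K) :=
    (Int.castRingHom K).map_det _ |>.symm
  rw [h2] at h1
  exact hi (by exact_mod_cast h1)

theorem IsPos.rank_eq (h : σ.IsPos w) : (σ.A.map (Int.cast : ℤ → ℚ)).rank = n := by
  have hinj : Function.Injective (σ.A.map (Int.cast : ℤ → ℚ)).mulVecLin := by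
    rw [← LinearMap.ker_eq_bot, LinearMap.ker_eq_bot']
    exact fun x hx => map_mulVec_eq_zero (h.minor_ne_zero 0) hx
  rw [Matrix.rank, LinearMap.finrank_range_of_inj hinj, Module.finrank_fin_fun]

theorem inj_of_rank (h : (σ.A.map (Int.cast : ℤ → ℚ)).rank = n) (x : Fin n → ℤ) (hx : σ.A *ᵥ x = 0) : x = 0 := by
  have h1 := LinearMap.finrank_range_add_finrank_ker (σ.A.map (Int.cast : ℤ → ℚ)).mulVecLin
  rw [Module.finrank_fin_fun] at h1
  have h2 : Module.finrank ℚ (LinearMap.ker (σ.A.map (Int.cast : ℤ → ℚ)).mulVecLin) = 0 := by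
    rw [Matrix.rank] at h; omega
  rw [Submodule.finrank_eq_zero, LinearMap.ker_eq_bot'] at h2
  have h3 := h2 (fun j => (x j : ℚ)) (by
    ext i
    have := congrFun hx i
    simp only [mulVec, dotProduct, mulVecLin_apply, map_apply, Pi.zero_apply] at this ⊢
    exact_mod_cast this)
  ext j
  have h4 : (x j : ℚ) = 0 := congrFun h3 j
  exact_mod_cast h4

theorem exists_eq_succAbove (I : Fin n ↪o Fin (n + 1)) : ∃ i : Fin (n + 1), ⇑I = i.succAbove := by
  obtain ⟨i, hi⟩ : ∃ i, i ∉ Set.range I := by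
    by_contra hI
    push Not at hI
    have := Fintype.card_le_of_surjective I hI
    simp at this
  refine ⟨i, (I.strictMono.range_inj (Fin.strictMono_succAbove i)).1 ?_⟩
  rw [Fin.range_succAbove]
  refine Set.eq_of_subset_of_ncard_le (fun j hj => ?_) ?_ (Set.toFinite _)
  · rintro rfl; exact hi hj
  · rw [← Set.image_univ, Set.ncard_image_of_injective _ I.injective, Set.ncard_univ, Set.ncard_compl, Set.ncard_singleton]
    simp

theorem IsPos.isModular_iff (h : σ.IsPos w) {Δ : ℕ} : σ.IsModular Δ ↔ ∀ i, |σ.minor i| ≤ (Δ : ℤ) := by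
  have hr := h.rank_eq
  unfold IsModular IsModularMatrix
  rw [and_iff_right hr]
  generalize (σ.A.map (Int.cast : ℤ → ℚ)).rank = r at hr
  subst hr
  constructor
  · exact fun H i => H i.succAboveOrderEmb (RelEmbedding.refl _)
  · intro H I J
    obtain ⟨i, hi⟩ := exists_eq_succAbove I
    have hJ : ⇑J = id := (J.strictMono.range_inj strictMono_id).1 (by
      rw [Set.range_id]; exact (Finite.injective_iff_surjective.1 J.injective).range_eq)
    rw [hi, hJ]
    exact H i

/-! ### Simplices come from positive systems -/

theorem real_injective (hA : ∀ x, σ.A *ᵥ x = 0 → x = 0) (hw : w ≠ 0) (h : w ᵥ* σ.A = 0) (x : Fin n → ℝ)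
    (hx : σ.A.map (Int.cast : ℤ → ℝ) *ᵥ x = 0) : x = 0 := by
  let M : Matrix (Fin (n + 1)) (Fin (n + 1)) ℤ := of fun i => Fin.snoc (σ.A i) (w i)
  have hdet : M.det ≠ 0 := by
    intro h0
    obtain ⟨z, hz, h1⟩ := Matrix.exists_mulVec_eq_zero_iff.2 h0
    have h2 : σ.A *ᵥ Fin.init z + z (Fin.last n) • w = 0 := by
      rw [← h1]
      ext i
      simp [M, mulVec, dotProduct, Fin.sum_univ_castSucc, Fin.init, mul_comm]
    have h3 : z (Fin.last n) * (w ⬝ᵥ w) = 0 := by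
      have : w ⬝ᵥ (σ.A *ᵥ Fin.init z + z (Fin.last n) • w) = 0 := by rw [h2, dotProduct_zero]
      rwa [dotProduct_add, dotProduct_mulVec, h, zero_dotProduct, zero_add, dotProduct_smul, smul_eq_mul] at this
    have h4 : z (Fin.last n) = 0 := (mul_eq_zero.1 h3).resolve_right fun h5 => hw (dotProduct_self_eq_zero.1 h5)
    rw [h4, zero_smul, add_zero] at h2
    have h5 := hA _ h2
    refine hz (funext fun i => ?_)
    induction i using Fin.lastCases with
    | last => exact h4
    | cast i => exact congrFun h5 i
  have h2 : (M.map (Int.cast : ℤ → ℝ)).det = (M.det : ℝ) := (Int.castRingHom ℝ).map_det _ |>.symm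
  by_contra hx0
  refine hdet (Int.cast_injective (α := ℝ) ?_)
  rw [← h2, Int.cast_zero]
  refine Matrix.exists_mulVec_eq_zero_iff.1 ⟨Fin.snoc x 0, fun h0 => hx0 (funext fun i => ?_), ?_⟩
  · have := congrFun h0 i.castSucc
    simpa using this
  · ext i
    have := congrFun hx i
    simpa [M, mulVec, dotProduct, Fin.sum_univ_castSucc] using this

theorem slack_add_smul (x d : Fin n → ℝ) (t : ℝ) (i : Fin (n + 1)) :
    σ.slack (x + t • d) i = σ.slack x i - t * (σ.A.map (Int.cast : ℤ → ℝ) *ᵥ d) i := by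
  simp only [slack, mulVec, dotProduct, Pi.add_apply, Pi.smul_apply, smul_eq_mul, map_apply, mul_add, Finset.sum_add_distrib,
    Finset.mul_sum]
  rw [sub_sub]
  congr 2
  exact Finset.sum_congr rfl fun _ _ => by ring

theorem eq_zero_of_isBounded (hb : Bornology.IsBounded σ.polyhedron) (hne : σ.polyhedron.Nonempty) {d : Fin n → ℝ}
    (hd : ∀ i, (σ.A.map (Int.cast : ℤ → ℝ) *ᵥ d) i ≤ 0) : d = 0 := by
  obtain ⟨x, hx⟩ := hne
  obtain ⟨R, hR⟩ := hb.exists_norm_le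
  by_contra h0
  have hpos : 0 < ‖d‖ := norm_pos_iff.2 h0
  have hR0 : 0 ≤ R := (norm_nonneg x).trans (hR x hx)
  have h1 : x + ((2 * R + 1) / ‖d‖) • d ∈ σ.polyhedron := by
    rw [mem_polyhedron] at hx ⊢
    intro i
    rw [slack_add_smul]
    have h2 : 0 ≤ (2 * R + 1) / ‖d‖ := by positivity
    have := mul_nonneg h2 (neg_nonneg.2 (hd i))
    linarith [hx i]
  have h2 : ‖((2 * R + 1) / ‖d‖) • d‖ = 2 * R + 1 := by
    rw [norm_smul, Real.norm_of_nonneg (by positivity), div_mul_cancel₀ _ hpos.ne']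
  have h3 := norm_sub_le (x + ((2 * R + 1) / ‖d‖) • d) x
  rw [add_sub_cancel_left, h2] at h3
  linarith [hR x hx, hR _ h1]

theorem exists_isPos (hn : 1 ≤ n) (hr : (σ.A.map (Int.cast : ℤ → ℚ)).rank = n) (hS : IsSimplex σ.polyhedron) :
    ∃ w, σ.IsPos w := by
  have hA := inj_of_rank hr
  obtain ⟨v, hv, hP⟩ := hS
  have hb : Bornology.IsBounded σ.polyhedron := by
    rw [hP]; exact ((Set.finite_range v).isCompact_convexHull ℝ).isBounded
  have hvm : ∀ i, v i ∈ σ.polyhedron := fun i => hP ▸ subset_convexHull _ _ ⟨i, rfl⟩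
  obtain ⟨w, ⟨k, hk⟩, hw⟩ : ∃ w : Fin (n + 1) → ℤ, (∃ k, 0 < w k) ∧ w ᵥ* σ.A = 0 := by
    obtain ⟨w, h0, h1⟩ := exists_left_kernel σ.A
    obtain ⟨k, hk⟩ := Function.ne_iff.1 h0
    rcases lt_or_gt_of_ne hk with h2 | h2
    · exact ⟨-w, ⟨k, neg_pos.2 h2⟩, by rw [neg_vecMul, h1, neg_zero]⟩
    · exact ⟨w, ⟨k, h2⟩, h1⟩
  have hw0 : w ≠ 0 := fun h => by rw [h] at hk; exact lt_irrefl _ hk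
  have hAr := real_injective hA hw0 hw
  have hpos : ∀ i, 0 < w i := by
    intro i
    by_contra! hi
    have hik : i ≠ k := by rintro rfl; omega
    have hwk : (0 : ℝ) < w k := by exact_mod_cast hk
    have hwi : (w i : ℝ) ≤ 0 := by exact_mod_cast hi
    let y : Fin (n + 1) → ℝ := -(Pi.single i (w k : ℝ)) + Pi.single k (w i : ℝ)
    obtain ⟨d, hd⟩ := exists_real_solution hAr hw0 hw (y := y) (by
      simp only [y, Pi.add_apply, Pi.neg_apply, Pi.single_apply, mul_add, mul_neg, Finset.sum_add_distrib,
        Finset.sum_neg_distrib, mul_ite, mul_zero, Finset.sum_ite_eq', Finset.mem_univ, if_true]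
      ring)
    have hd0 : d = 0 := eq_zero_of_isBounded hb ⟨_, hvm 0⟩ fun j => by
      rw [hd]
      simp only [y, Pi.add_apply, Pi.neg_apply, Pi.single_apply]
      split_ifs <;> linarith
    rw [hd0, mulVec_zero] at hd
    have := congrFun hd i
    simp [y, hik] at this
    omega
  refine ⟨w, hA, hpos, hw, ?_⟩
  have h1 : ∀ x, ∑ i, (w i : ℝ) * σ.slack x i = ((w ⬝ᵥ σ.b : ℤ) : ℝ) := IsPos.sum_slack_of_ker hw
  have hwp : ∀ i, (0 : ℝ) < w i := fun i => by exact_mod_cast hpos i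
  have h2 : (0 : ℝ) ≤ ((w ⬝ᵥ σ.b : ℤ) : ℝ) := by
    rw [← h1 (v 0)]
    exact Finset.sum_nonneg fun i _ => mul_nonneg (hwp i).le (mem_polyhedron.1 (hvm 0) i)
  rcases h2.lt_or_eq with h3 | h3
  · exact_mod_cast h3
  · have h4 : ∀ k i, σ.slack (v k) i = 0 := by
      intro k i
      have h5 := h1 (v k)
      rw [← h3, Finset.sum_eq_zero_iff_of_nonneg fun i _ => mul_nonneg (hwp i).le (mem_polyhedron.1 (hvm k) i)] at h5
      exact (mul_eq_zero.1 (h5 i (Finset.mem_univ i))).resolve_left (hwp i).ne'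
    have h5 : v 0 = v (Fin.last n) := by
      refine sub_eq_zero.1 (hAr _ ?_)
      ext i
      have h6 := slack_add_smul (σ := σ) (v (Fin.last n)) (v 0 - v (Fin.last n)) 1 i
      rw [one_smul, add_sub_cancel, h4, h4] at h6
      simp only [Pi.zero_apply]; linarith
    have := congrArg Fin.val (hv.injective h5)
    simp at this; omega

end System
end DeltaSimplex

namespace DeltaSimplex
open Matrix

theorem eq_of_primitive {ι : Type*} {p q : ι → ℤ} (hp : ∀ k : ℤ, (∀ j, k ∣ p j) → IsUnit k)
    (hq : ∀ k : ℤ, (∀ j, k ∣ q j) → IsUnit k) {c : ℝ} (hc : 0 < c) (h : ∀ j, (q j : ℝ) = c * p j) : p = q := by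
  obtain ⟨k, hk⟩ : ∃ k, p k ≠ 0 := by
    by_contra! h0
    have := hp 2 fun j => by simp [h0]
    rw [Int.isUnit_iff] at this
    omega
  have h1 : ∀ j, q k * p j = p k * q j := by
    intro j
    have : (q k : ℝ) * p j = p k * q j := by rw [h, h]; ring
    exact_mod_cast this
  obtain ⟨g, p', q', hg, hpq, hp', hq'⟩ := Int.exists_gcd_one' (m := p k) (n := q k) (Int.gcd_pos_iff.2 (.inl hk))
  have hco := Int.isCoprime_iff_gcd_eq_one.2 hpq
  have h2 : ∀ j, q' * p j = p' * q j := by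
    intro j
    have h3 := h1 j
    rw [hp', hq'] at h3
    have hg' : (g : ℤ) ≠ 0 := by omega
    exact mul_left_cancel₀ hg' (by linarith)
  have u1 := hp p' fun j => hco.dvd_of_dvd_mul_left (Dvd.intro _ (h2 j).symm)
  have u2 := hq q' fun j => hco.symm.dvd_of_dvd_mul_left (Dvd.intro _ (h2 j))
  have h4 : (q k : ℝ) = c * p k := h k
  have h5 : p' = q' := by
    rw [Int.isUnit_iff] at u1 u2
    rw [hp', hq'] at h4
    have hgr : (0 : ℝ) < g := by exact_mod_cast hg
    have h6 : (q' : ℝ) = c * p' := by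
      push_cast at h4
      exact mul_right_cancel₀ hgr.ne' (by linarith)
    rcases u1 with rfl | rfl <;> rcases u2 with rfl | rfl <;> push_cast at h6 <;> first | rfl | linarith
  subst h5
  ext j
  exact mul_left_cancel₀ u1.ne_zero (h2 j)

namespace System
variable {n : ℕ} {σ τ : System n} {w w' : Fin (n + 1) → ℤ}

/-! ### Reduced systems -/

/-- A row of the extended matrix. -/
def row (σ : System n) (i : Fin (n + 1)) : Fin (n + 1) → ℤ := Fin.snoc (σ.A i) (σ.b i)

@[simp] theorem row_castSucc (σ : System n) (i : Fin (n + 1)) (j : Fin n) : σ.row i j.castSucc = σ.A i j := by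
  simp [row]

@[simp] theorem row_last (σ : System n) (i : Fin (n + 1)) : σ.row i (Fin.last n) = σ.b i := by simp [row]

/-- The rows of the extended matrix are primitive. -/
def Reduced (σ : System n) : Prop := ∀ i (k : ℤ), (∀ j, k ∣ σ.row i j) → IsUnit k

theorem forall_dvd_row {i : Fin (n + 1)} {k : ℤ} : (∀ j, k ∣ σ.row i j) ↔ (∀ j, k ∣ σ.A i j) ∧ k ∣ σ.b i := by
  rw [Fin.forall_fin_succ']; simp

theorem eq_of_polyhedron_eq (hσ : σ.IsPos w) (hτ : τ.IsPos w') (rσ : σ.Reduced) (rτ : τ.Reduced)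
    (h : σ.polyhedron = τ.polyhedron) : ∃ π : Equiv.Perm (Fin (n + 1)), ∀ i, τ.row i = σ.row (π i) := by
  have h1 : ∀ i, ∃ j, hσ.vertex j = hτ.vertex i := fun i => by
    have : hτ.vertex i ∈ Set.range hσ.vertex := by
      rw [← hσ.extremePoints_eq, h, hτ.extremePoints_eq]; exact ⟨i, rfl⟩
    exact this
  choose f hf using h1
  have hinj : Function.Injective f := fun i j hij => hτ.vertex_injective (by rw [← hf, ← hf, hij])
  let π : Equiv.Perm (Fin (n + 1)) := Equiv.ofBijective f (Finite.injective_iff_bijective.1 hinj)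
  have hπ : ∀ i, hσ.vertex (π i) = hτ.vertex i := hf
  refine ⟨π, fun i => Eq.symm ?_⟩
  have h2 : ∀ x, τ.slack x i = τ.slack (hτ.vertex i) i / σ.slack (hσ.vertex (π i)) (π i) * σ.slack x (π i) := by
    intro x
    have h3 : σ.slack x (π i) = τ.slack x i / τ.slack (hτ.vertex i) i * σ.slack (hσ.vertex (π i)) (π i) := by
      conv_lhs => rw [hτ.eq_sum_vertex x]
      rw [slack_sum _ (hτ.sum_coords x), Finset.sum_eq_single i, hπ]
      · intro j _ hj
        rw [← hπ, hσ.slack_vertex_ne (fun h => hj (π.injective h).symm), mul_zero]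
      · simp
    have h4 := hτ.slack_vertex_pos i
    have h5 := hσ.slack_vertex_pos (π i)
    rw [h3]
    field_simp
  have hc : 0 < τ.slack (hτ.vertex i) i / σ.slack (hσ.vertex (π i)) (π i) :=
    div_pos (hτ.slack_vertex_pos i) (hσ.slack_vertex_pos (π i))
  generalize τ.slack (hτ.vertex i) i / σ.slack (hσ.vertex (π i)) (π i) = c at h2 hc
  have hb : (τ.b i : ℝ) = c * σ.b (π i) := by simpa [slack] using h2 0
  refine eq_of_primitive (rσ (π i)) (rτ i) hc fun j => ?_
  induction j using Fin.lastCases with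
  | last => simpa using hb
  | cast j =>
    have := h2 (Pi.single j 1)
    simp only [slack, Pi.single_apply, mul_ite, mul_one, mul_zero, Finset.sum_ite_eq', Finset.mem_univ, if_true] at this
    rw [row_castSucc, row_castSucc]
    linarith

theorem IsPos.pullback (h : σ.IsPos w) {U : Matrix (Fin n) (Fin n) ℤ} (hU : IsUnit U.det) (x₀ : Fin n → ℤ) :
    (σ.pullback U x₀).IsPos w where
  inj x hx := by
    have h1 : σ.A *ᵥ (U *ᵥ x) = 0 := by rw [mulVec_mulVec]; exact hx
    have h2 := congrArg (U⁻¹ *ᵥ ·) (h.inj _ h1)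
    simpa [mulVec_mulVec, Matrix.nonsing_inv_mul _ hU] using h2
  pos := h.pos
  ker := by
    change w ᵥ* (σ.A * U) = 0
    rw [← vecMul_vecMul, h.ker, zero_vecMul]
  rhs := by
    change 0 < w ⬝ᵥ (σ.b - σ.A *ᵥ x₀)
    rw [dotProduct_sub, dotProduct_mulVec, h.ker, zero_dotProduct, sub_zero]
    exact h.rhs

theorem Reduced.pullback (h : σ.Reduced) {U : Matrix (Fin n) (Fin n) ℤ} (hU : IsUnit U.det) (x₀ : Fin n → ℤ) :
    (σ.pullback U x₀).Reduced := by
  intro i k hk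
  rw [forall_dvd_row] at hk
  have h1 : ∀ j, k ∣ σ.A i j := by
    intro j
    have h2 : σ.A = (σ.A * U) * U⁻¹ := by rw [Matrix.mul_assoc, Matrix.mul_nonsing_inv _ hU, Matrix.mul_one]
    rw [h2, Matrix.mul_apply]
    exact Finset.dvd_sum fun l _ => (hk.1 l).mul_right _
  refine h i k (forall_dvd_row.2 ⟨h1, ?_⟩)
  have h3 : σ.b i = (σ.pullback U x₀).b i + (σ.A *ᵥ x₀) i := by simp [System.pullback]
  rw [h3]
  have h4 : k ∣ (σ.A *ᵥ x₀) i := by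
    rw [mulVec, dotProduct]
    exact Finset.dvd_sum fun l _ => (h1 l).mul_right _
  exact dvd_add hk.2 h4

/-- Reduced systems with unimodular equivalent polyhedra are equivalent. -/
theorem equivalent_of_unimodularEquiv (hσ : σ.IsPos w) (hτ : τ.IsPos w') (rσ : σ.Reduced) (rτ : τ.Reduced)
    (h : UnimodularEquiv σ.polyhedron τ.polyhedron) : τ.Equivalent σ := by
  obtain ⟨U, x₀, hU, h⟩ := unimodularEquiv_iff.1 h
  obtain ⟨π, hπ⟩ := eq_of_polyhedron_eq (hτ.pullback hU x₀) hσ (rτ.pullback hU x₀) rσ (by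
    ext x; rw [h, mem_polyhedron_pullback])
  refine ⟨π, U, -x₀, hU, ?_, fun i => ?_⟩
  · ext i j
    have := congrFun (hπ i) j.castSucc
    rw [row_castSucc, row_castSucc] at this
    exact this
  · have := congrFun (hπ i) (Fin.last n)
    rw [row_last, row_last] at this
    rw [this, mulVec_neg]
    simp [System.pullback, sub_eq_add_neg]

theorem IsPos.row_ne_zero (h : σ.IsPos w) (i : Fin (n + 1)) : σ.row i ≠ 0 := by
  intro h0
  have h1 := h.slack_vertex_pos i
  have h2 : ∀ j, σ.A i j = 0 := fun j => by rw [← row_castSucc, h0]; rfl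
  have h3 : σ.b i = 0 := by rw [← row_last, h0]; rfl
  simp [slack, h2, h3] at h1

theorem minor_eq_prod {k : Fin (n + 1) → ℤ} (h : ∀ i j, σ.A i j = k i * τ.A i j) (i : Fin (n + 1)) :
    σ.minor i = (∏ j, k (i.succAbove j)) * τ.minor i := by
  unfold minor
  rw [← det_mul_column]
  congr 1
  ext a b
  exact h _ _

theorem exists_reduced (h : σ.IsPos w) : ∃ (τ : System n) (w' : Fin (n + 1) → ℤ), τ.IsPos w' ∧ τ.Reduced ∧
    τ.polyhedron = σ.polyhedron ∧ ∀ i, |τ.minor i| ≤ |σ.minor i| := by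
  have h1 : ∀ i, ∃ (k : ℤ) (r : Fin (n + 1) → ℤ), 0 < k ∧ (∀ j, σ.row i j = k * r j) ∧
      ∀ d : ℤ, (∀ j, d ∣ r j) → IsUnit d := by
    intro i
    obtain ⟨r, hr, hg⟩ := Finset.extract_gcd (s := Finset.univ) (σ.row i) Finset.univ_nonempty
    refine ⟨Finset.univ.gcd (σ.row i), r, ?_, fun j => hr j (Finset.mem_univ j), fun d hd => ?_⟩
    · have h2 : Finset.univ.gcd (σ.row i) ≠ 0 := fun h0 =>
        h.row_ne_zero i (funext fun j => Finset.gcd_eq_zero_iff.1 h0 j (Finset.mem_univ j))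
      have h3 : 0 ≤ Finset.univ.gcd (σ.row i) := by
        rw [← Finset.normalize_gcd]; exact Int.nonneg_of_normalize_eq_self (normalize_idem _)
      omega
    · rw [isUnit_iff_dvd_one, ← hg]
      exact Finset.dvd_gcd fun j _ => hd j
  choose k r hk hr hd using h1
  let τ : System n := ⟨of fun i j => r i j.castSucc, fun i => r i (Fin.last n)⟩
  have hA : ∀ i j, σ.A i j = k i * τ.A i j := fun i j => by rw [← row_castSucc, hr]; rfl
  have hb : ∀ i, σ.b i = k i * τ.b i := fun i => by rw [← row_last, hr]
  have hrow : ∀ i, τ.row i = r i := fun i => by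
    ext j
    induction j using Fin.lastCases with
    | last => simp [τ]
    | cast j => simp [τ]
  have hs : ∀ x i, σ.slack x i = k i * τ.slack x i := by
    intro x i
    simp only [slack, hA, hb, Int.cast_mul, mul_sub, Finset.mul_sum, mul_assoc]
  refine ⟨τ, fun i => w i * k i, ⟨fun x hx => h.inj x ?_, fun i => mul_pos (h.pos i) (hk i), ?_, ?_⟩,
    fun i d hdi => hd i d (by rwa [hrow] at hdi), ?_, fun i => ?_⟩
  · ext i
    have := congrFun hx i
    simp only [mulVec, dotProduct, hA, mul_assoc, ← Finset.mul_sum, Pi.zero_apply] at this ⊢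
    rw [this, mul_zero]
  · ext j
    have := congrFun h.ker j
    simpa only [vecMul, dotProduct, hA, mul_assoc] using this
  · have := h.rhs
    simpa only [dotProduct, hb, mul_assoc] using this
  · ext x
    rw [mem_polyhedron, mem_polyhedron]
    refine forall_congr' fun i => ?_
    rw [hs]
    have : (0 : ℝ) < k i := by exact_mod_cast hk i
    exact (mul_nonneg_iff_of_pos_left this).symm
  · rw [minor_eq_prod hA, abs_mul]
    refine le_mul_of_one_le_left (abs_nonneg _) ?_
    rw [Finset.abs_prod]
    exact Finset.one_le_prod fun j _ => by rw [abs_of_pos (hk _)]; exact hk _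

theorem reduced_iff (hn : 1 ≤ n) (h : σ.IsPos w) {Δ : ℕ} (hΔ : ∀ i, |σ.minor i| ≤ (Δ : ℤ)) :
    σ.Reduced ↔ ∀ i (k : ℤ), 2 ≤ k → k ≤ Δ → ¬ ∀ j, k ∣ σ.row i j := by
  constructor
  · intro hr i k h2 _ hd
    have := hr i k hd
    rw [Int.isUnit_iff] at this
    omega
  · intro H i k hd
    have key : ∀ k : ℤ, (∀ j, k ∣ σ.row i j) → k ≤ Δ := by
      intro k hd
      obtain ⟨i', hi'⟩ : ∃ i', i' ≠ i := by
        have : Nontrivial (Fin (n + 1)) := Fin.nontrivial_iff_two_le.2 (by omega)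
        exact exists_ne i
      obtain ⟨l, hl⟩ := Fin.exists_succAbove_eq hi'.symm
      have h1 : k ∣ σ.minor i' := by
        rw [minor, det_apply]
        refine Finset.dvd_sum fun π _ => ?_
        have h2 : k ∣ ∏ j, (σ.A.submatrix i'.succAbove id) (π j) j := by
          refine dvd_trans ?_ (Finset.dvd_prod_of_mem _ (Finset.mem_univ (π.symm l)))
          simp only [Equiv.apply_symm_apply, submatrix_apply, hl]
          exact (forall_dvd_row.1 hd).1 _
        rw [Units.smul_def, smul_eq_mul]
        exact h2.mul_left _
      have h3 := Int.le_of_dvd (abs_pos.2 (h.minor_ne_zero i')) ((dvd_abs _ _).2 h1)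
      exact h3.trans (hΔ i')
    have h0 : k ≠ 0 := by
      rintro rfl
      refine h.row_ne_zero i (funext fun j => ?_)
      exact zero_dvd_iff.1 (hd j)
    rw [Int.isUnit_iff_natAbs_eq]
    by_contra hne
    have h1 : ∀ j, (k.natAbs : ℤ) ∣ σ.row i j := fun j => Int.natAbs_dvd.2 (hd j)
    exact H i k.natAbs (by omega) (key _ h1) h1

/-! ### Integer points -/

section
variable {G : Type*} [AddCommGroup G] {g : Fin (n + 1) → G} {β : G}

theorem slack_cast (x : Fin n → ℤ) (i : Fin (n + 1)) :
    σ.slack (fun j => (x j : ℝ)) i = ((σ.b - σ.A *ᵥ x) i : ℤ) := by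
  simp [slack, mulVec, dotProduct]

theorem Presents.comb_slack (h : σ.Presents g β) (x : Fin n → ℤ) : comb g (σ.b - σ.A *ᵥ x) = β := by
  rw [map_sub, h.rhs, (h.ker _).2 ⟨x, rfl⟩, sub_zero]

theorem Presents.exists_slack (h : σ.Presents g β) {y : Fin (n + 1) → ℤ} (hy : comb g y = β) :
    ∃ x, σ.b - σ.A *ᵥ x = y := by
  obtain ⟨x, hx⟩ := (h.ker (σ.b - y)).1 (by rw [map_sub, h.rhs, hy, sub_self])
  exact ⟨x, by rw [hx, sub_sub_cancel]⟩

theorem Presents.inter_eq_empty_iff (h : σ.Presents g β) :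
    σ.polyhedron ∩ integerPoints n = ∅ ↔ ¬ ∃ y, (∀ i, 0 ≤ y i) ∧ comb g y = β := by
  rw [Set.eq_empty_iff_forall_notMem, ← not_exists, not_iff_not]
  constructor
  · rintro ⟨_, hx, x, rfl⟩
    rw [mem_polyhedron] at hx
    exact ⟨_, fun i => by have := hx i; rw [slack_cast] at this; exact_mod_cast this, h.comb_slack x⟩
  · rintro ⟨y, hy, hc⟩
    obtain ⟨x, rfl⟩ := h.exists_slack hc
    refine ⟨_, mem_polyhedron.2 fun i => ?_, x, rfl⟩
    rw [slack_cast]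
    exact_mod_cast hy i

theorem Presents.vertices_integral_iff (h : σ.Presents g β) (hp : σ.IsPos w) :
    σ.polyhedron.extremePoints ℝ ⊆ integerPoints n ↔ ∀ i, ∃ t : ℤ, t • g i = β := by
  rw [hp.extremePoints_eq, Set.range_subset_iff]
  refine forall_congr' fun i => ⟨?_, ?_⟩
  · rintro ⟨x, hx⟩
    refine ⟨(σ.b - σ.A *ᵥ x) i, ?_⟩
    rw [← h.comb_slack x, Fintype.linearCombination_apply, Finset.sum_eq_single i]
    · intro j _ hj
      have := hp.slack_vertex_ne hj
      rw [hx, slack_cast] at this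
      rw [Int.cast_eq_zero.1 this, zero_smul]
    · simp
  · rintro ⟨t, ht⟩
    obtain ⟨x, hx⟩ := h.exists_slack (y := Pi.single i t) (by rw [Fintype.linearCombination_apply_single, ht])
    refine ⟨x, hp.eq_of_slack (i := i) fun j hj => ?_⟩
    rw [hp.slack_vertex_ne hj, slack_cast, hx]
    simp [hj]

theorem Presents.lattice_iff (h : σ.Presents g β) (hp : σ.IsPos w) :
    (σ.polyhedron.extremePoints ℝ ⊆ integerPoints n ∧
      σ.polyhedron ∩ integerPoints n = σ.polyhedron.extremePoints ℝ) ↔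
    (∀ i, ∃ t : ℤ, t • g i = β) ∧ ∀ y, (∀ i, 0 ≤ y i) → comb g y = β → ∃ i, ∀ j, j ≠ i → y j = 0 := by
  rw [h.vertices_integral_iff hp]
  refine and_congr_right fun hv => ?_
  have hv := (h.vertices_integral_iff hp).2 hv
  constructor
  · intro he y hy hc
    obtain ⟨x, rfl⟩ := h.exists_slack hc
    have h1 : (fun j => (x j : ℝ)) ∈ Set.range hp.vertex := by
      rw [← hp.extremePoints_eq, ← he]
      refine ⟨mem_polyhedron.2 fun i => ?_, x, rfl⟩
      rw [slack_cast]
      exact_mod_cast hy i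
    obtain ⟨i, hi⟩ := h1
    refine ⟨i, fun j hj => ?_⟩
    have := hp.slack_vertex_ne hj
    rw [hi, slack_cast] at this
    exact_mod_cast this
  · intro H
    refine subset_antisymm ?_ (Set.subset_inter extremePoints_subset hv)
    rintro _ ⟨hx, x, rfl⟩
    rw [mem_polyhedron] at hx
    obtain ⟨i, hi⟩ := H _ (fun i => by have := hx i; rw [slack_cast] at this; exact_mod_cast this) (h.comb_slack x)
    rw [hp.extremePoints_eq]
    refine ⟨i, hp.eq_of_slack (i := i) fun j hj => ?_⟩
    rw [hp.slack_vertex_ne hj, slack_cast, hi j hj, Int.cast_zero]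

end

end System
end DeltaSimplex

namespace DeltaSimplex
open Matrix

/-! ### The groups `ℤ × ∏ ℤ / dᵢ` -/

/-- The index of a cyclic subgroup of `ℤ × F`. -/
theorem index_zmultiples_prod {F : Type*} [AddCommGroup F] {x : ℤ × F} (hx : x.1 ≠ 0) :
    (AddSubgroup.zmultiples x).index = x.1.natAbs * Nat.card F := by
  set H := AddSubgroup.zmultiples x
  let f : ℤ × F →+ ℤ := AddMonoidHom.fst ℤ F
  have hf : Function.Surjective f := fun t => ⟨(t, 0), rfl⟩
  have h1 : (H.map f).index = (H ⊔ f.ker).index := by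
    rw [AddSubgroup.index_map, AddMonoidHom.range_eq_top.2 hf, AddSubgroup.index_top, mul_one]
  have h2 : H.map f = AddSubgroup.zmultiples x.1 := by
    rw [AddMonoidHom.map_zmultiples]; rfl
  rw [h2, Int.index_zmultiples] at h1
  have h3 := AddSubgroup.relIndex_mul_index (H := H) (K := H ⊔ f.ker) le_sup_left
  rw [AddSubgroup.relIndex_sup_left] at h3
  have h4 : H.relIndex f.ker = Nat.card F := by
    have h5 : H.addSubgroupOf f.ker = ⊥ := by
      rw [eq_bot_iff]
      rintro ⟨y, hy⟩ h6
      obtain ⟨t, rfl⟩ := AddSubgroup.mem_zmultiples_iff.1 (AddSubgroup.mem_addSubgroupOf.1 h6)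
      have h7 : t * x.1 = 0 := by simpa [f] using (AddMonoidHom.mem_ker.1 hy)
      have h8 : t = 0 := (mul_eq_zero.1 h7).resolve_right hx
      simp [h8]
    rw [AddSubgroup.relIndex, h5, AddSubgroup.index_bot]
    refine Nat.card_congr ⟨fun y => y.1.2, fun z => ⟨(0, z), rfl⟩, fun y => ?_, fun z => rfl⟩
    have : y.1.1 = 0 := y.2
    ext
    · exact this.symm
    · rfl
  rw [← h3, h4, ← h1, mul_comm]

/-- The finite group `∏ ℤ / dᵢ`. -/
abbrev FinPart (ds : List ℤ) : Type := (i : Fin ds.length) → ZMod (ds[i]).natAbs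

/-- The group `ℤ × ∏ ℤ / dᵢ`. -/
abbrev Grid (ds : List ℤ) : Type := ℤ × FinPart ds

/-- The factors are not trivial. -/
def Valid (ds : List ℤ) : Prop := ∀ q ∈ ds, 2 ≤ q

theorem Valid.neZero {ds : List ℤ} (h : Valid ds) (i : Fin ds.length) : NeZero (ds[i]).natAbs :=
  ⟨by have := h ds[i] (List.getElem_mem _); omega⟩

theorem Valid.finite {ds : List ℤ} (h : Valid ds) : Finite (FinPart ds) := by
  have := h.neZero
  infer_instance

theorem exists_finPart_equiv {k : ℕ} (m : Fin k → ℕ) :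
    Nonempty (((i : Fin k) → ZMod (m i)) ≃+ FinPart (List.ofFn fun i => (m i : ℤ))) := by
  set ds := List.ofFn fun i => (m i : ℤ) with hds
  have hl : ds.length = k := List.length_ofFn
  have h : ∀ j : Fin ds.length, m (Fin.cast hl j) = (ds[j]).natAbs := by
    intro j; simp [hds]; rfl
  exact ⟨{
    toFun f j := ZMod.ringEquivCongr (h j) (f (Fin.cast hl j))
    invFun x i := (ZMod.ringEquivCongr (h (Fin.cast hl.symm i))).symm (x (Fin.cast hl.symm i))
    left_inv f := by
      funext i
      exact (ZMod.ringEquivCongr (h (Fin.cast hl.symm i))).symm_apply_apply _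
    right_inv x := by
      funext j
      exact (ZMod.ringEquivCongr (h j)).apply_symm_apply _
    map_add' f f' := by
      funext j
      exact map_add (ZMod.ringEquivCongr (h j)) _ _ }⟩

theorem exists_finPart_equiv_of_finite (T : Type) [AddCommGroup T] [Finite T] :
    ∃ ds, Valid ds ∧ Nonempty (T ≃+ FinPart ds) := by
  classical
  obtain ⟨ι, _, m, hm, ⟨e⟩⟩ := AddCommGroup.equiv_directSum_zmod_of_finite' T
  let eq := Fintype.equivFin ι
  obtain ⟨f⟩ := exists_finPart_equiv fun k => m (eq.symm k)
  refine ⟨_, ?_, ⟨(e.trans (DirectSum.addEquivProd fun i => ZMod (m i))).trans (AddEquiv.trans ?_ f)⟩⟩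
  · intro q hq
    obtain ⟨k, rfl⟩ := List.mem_ofFn.1 hq
    have := hm (eq.symm k)
    omega
  · exact { toFun := fun x k => x (eq.symm k)
            invFun := (Equiv.piCongrLeft' (fun i => ZMod (m i)) eq).symm
            left_inv := (Equiv.piCongrLeft' (fun i => ZMod (m i)) eq).symm_apply_apply
            right_inv := (Equiv.piCongrLeft' (fun i => ZMod (m i)) eq).apply_symm_apply
            map_add' := fun _ _ => rfl }

theorem hom_apply {T : Type*} [AddCommGroup T] [Finite T] (D : ℤ × T →+ ℤ) (x : ℤ × T) : D x = x.1 * D (1, 0) := by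
  have h1 : ∀ f : T, D (0, f) = 0 := by
    intro f
    have h2 : (Nat.card T) • ((0, f) : ℤ × T) = 0 := by ext <;> simp
    have h3 := congrArg D h2
    rw [map_nsmul, map_zero, smul_eq_zero] at h3
    exact h3.resolve_left Nat.card_pos.ne'
  have h4 : x = x.1 • (1, 0) + (0, x.2) := by ext <;> simp
  conv_lhs => rw [h4]
  rw [map_add, map_zsmul, h1, add_zero, smul_eq_mul]

theorem exists_equiv_int_prod {Q : Type} [AddCommGroup Q] [AddGroup.FG Q] {D : Q →+ ℤ} {N : ℤ} (hN : N ≠ 0)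
    (htor : ∀ q, D q = 0 → N • q = 0) {q₀ : Q} (hq₀ : D q₀ ≠ 0) :
    ∃ (T : Type) (_ : AddCommGroup T) (_ : Finite T) (e : Q ≃+ ℤ × T), 0 < D (e.symm (1, 0)) := by
  classical
  obtain ⟨r, T, _, _, ⟨e⟩⟩ : ∃ (r : ℕ) (T : Type) (_ : AddCommGroup T) (_ : Finite T),
      Nonempty (Q ≃+ (Fin r →₀ ℤ) × T) := by
    obtain ⟨r, ι, _, p, hp, ex, ⟨e⟩⟩ := AddCommGroup.equiv_free_prod_directSum_zmod Q
    have hne : ∀ i, NeZero (p i ^ ex i) := fun i => ⟨pow_ne_zero _ (hp i).ne_zero⟩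
    exact ⟨r, _, inferInstance,
      Finite.of_equiv _ (DirectSum.addEquivProd fun i => ZMod (p i ^ ex i)).symm.toEquiv, ⟨e⟩⟩
  have hfree : ∀ a, D (e.symm (a, 0)) = 0 → a = 0 := by
    intro a ha
    have h1 := htor _ ha
    rw [← map_zsmul, map_eq_zero_iff _ e.symm.injective] at h1
    have h2 : N • a = 0 := congrArg Prod.fst h1
    exact (smul_eq_zero.1 h2).resolve_left hN
  have htors : ∀ f : T, D (e.symm (0, f)) = 0 := by
    intro f
    have h2 : (Nat.card T) • ((0, f) : (Fin r →₀ ℤ) × T) = 0 := by ext <;> simp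
    have h3 := congrArg D (congrArg e.symm h2)
    rw [map_nsmul, map_nsmul, map_zero, map_zero, smul_eq_zero] at h3
    exact h3.resolve_left Nat.card_pos.ne'
  have hr : r = 1 := by
    rcases r with _ | _ | r
    · refine absurd ?_ hq₀
      have := htors (e q₀).2
      rwa [show ((0 : Fin 0 →₀ ℤ), (e q₀).2) = e q₀ from Prod.ext (Subsingleton.elim _ _) rfl,
        AddEquiv.symm_apply_apply] at this
    · rfl
    · let u : Fin (r + 2) → ℤ := fun i => D (e.symm (Finsupp.single i 1, 0))
      have hu : ∀ i t, D (e.symm (Finsupp.single i t, 0)) = t * u i := by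
        intro i t
        have : ((Finsupp.single i t, 0) : (Fin (r + 2) →₀ ℤ) × T) = t • (Finsupp.single i 1, 0) := by ext <;> simp
        rw [this, map_zsmul, map_zsmul, smul_eq_mul]
      have h1 := hfree (Finsupp.single 0 (u 1) - Finsupp.single 1 (u 0)) (by
        have : ((Finsupp.single 0 (u 1) - Finsupp.single 1 (u 0), 0) : (Fin (r + 2) →₀ ℤ) × T) =
          (Finsupp.single 0 (u 1), 0) - (Finsupp.single 1 (u 0), 0) := by ext <;> simp
        rw [this, map_sub, map_sub, hu, hu]; ring)
      have h2 : u 1 = 0 := by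
        have := DFunLike.congr_fun h1 0
        simpa using this
      have h3 := hfree (Finsupp.single 1 1) h2
      simp at h3
  subst hr
  let e₁ : Q ≃+ ℤ × T := e.trans (AddEquiv.prodCongr (Finsupp.uniqueAddEquiv (0 : Fin 1)) (AddEquiv.refl T))
  have hne : D (e₁.symm (1, 0)) ≠ 0 := by
    intro h0
    have := hom_apply (D.comp e₁.symm.toAddMonoidHom) (e₁ q₀)
    simp only [AddMonoidHom.comp_apply, AddEquiv.toAddMonoidHom_eq_coe, AddMonoidHom.coe_coe,
      AddEquiv.symm_apply_apply, h0, mul_zero] at this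
    exact hq₀ this
  rcases lt_or_gt_of_ne hne with hneg | hpos
  · refine ⟨T, _, ‹_›, e₁.trans (AddEquiv.prodCongr (AddEquiv.neg ℤ) (AddEquiv.refl T)), ?_⟩
    change 0 < D (e₁.symm (-1, 0))
    have : ((-1, 0) : ℤ × T) = -(1, 0) := by ext <;> simp
    rw [this, map_neg, map_neg]
    omega
  · exact ⟨T, _, ‹_›, e₁, hpos⟩

namespace System
variable {n : ℕ} {σ τ : System n} {w w' : Fin (n + 1) → ℤ}

section
variable {G : Type*} [AddCommGroup G] {g : Fin (n + 1) → G} {β : G}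

theorem comb_succAbove (g : Fin (n + 1) → G) (y : Fin (n + 1) → ℤ) (i : Fin (n + 1)) :
    comb g y = y i • g i + Fintype.linearCombination ℤ (g ∘ i.succAbove) (y ∘ i.succAbove) := by
  rw [Fintype.linearCombination_apply, Fin.sum_univ_succAbove _ i, Fintype.linearCombination_apply]
  rfl

/-- The minors are the indices of the cyclic subgroups. -/
theorem Presents.natAbs_minor (h : σ.Presents g β) {i : Fin (n + 1)} (hi : σ.minor i ≠ 0) :
    (σ.minor i).natAbs = (AddSubgroup.zmultiples (g i)).index := by
  let ρ : (Fin n → ℤ) →ₗ[ℤ] G ⧸ AddSubgroup.zmultiples (g i) :=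
    (QuotientAddGroup.mk' (AddSubgroup.zmultiples (g i))).toIntLinearMap.comp
      (Fintype.linearCombination ℤ (g ∘ i.succAbove))
  have hρ : ∀ y, ρ y = QuotientAddGroup.mk (Fintype.linearCombination ℤ (g ∘ i.succAbove) y) := fun y => rfl
  have hsurj : Function.Surjective ρ := by
    intro q
    obtain ⟨x, rfl⟩ := QuotientAddGroup.mk_surjective q
    obtain ⟨y, rfl⟩ := h.surj x
    refine ⟨y ∘ i.succAbove, ?_⟩
    rw [hρ, comb_succAbove g y i, QuotientAddGroup.eq]
    exact AddSubgroup.mem_zmultiples_iff.2 ⟨y i, by abel⟩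
  let f : (Fin n → ℤ) →ₗ[ℤ] (Fin n → ℤ) := (σ.A.submatrix i.succAbove id).mulVecLin
  have hf : Function.Injective f := by
    rw [← LinearMap.ker_eq_bot, LinearMap.ker_eq_bot']
    intro x hx
    by_contra h0
    exact hi (Matrix.exists_mulVec_eq_zero_iff.1 ⟨x, h0, hx⟩)
  have hker : LinearMap.ker ρ = LinearMap.range f := by
    ext y
    rw [LinearMap.mem_ker, LinearMap.mem_range, hρ, QuotientAddGroup.eq_zero_iff, AddSubgroup.mem_zmultiples_iff]
    constructor
    · rintro ⟨t, ht⟩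
      obtain ⟨x, hx⟩ := (h.ker (i.insertNth (-t) y)).1 (by
        rw [comb_succAbove g _ i]
        have : (i.insertNth (-t) y : Fin (n + 1) → ℤ) ∘ i.succAbove = y := by ext j; simp
        rw [this, ← ht]; simp)
      refine ⟨x, funext fun j => ?_⟩
      have := congrFun hx (i.succAbove j)
      rw [Fin.insertNth_apply_succAbove] at this
      exact this
    · rintro ⟨x, rfl⟩
      have h1 := (h.ker _).2 ⟨x, rfl⟩
      rw [comb_succAbove g _ i] at h1
      refine ⟨-(σ.A *ᵥ x) i, ?_⟩
      rw [neg_smul]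
      exact neg_eq_of_add_eq_zero_right h1
  have h1 := Submodule.natAbs_det_equiv (LinearMap.range f) (LinearEquiv.ofInjective f hf)
  have h2 : (LinearMap.range f).subtype ∘ₗ
      AddMonoidHom.toIntLinearMap ((LinearEquiv.ofInjective f hf : (Fin n → ℤ) ≃ₗ[ℤ] LinearMap.range f) : _ →+ _) = f := by
    ext; rfl
  rw [h2] at h1
  have h3 : LinearMap.det f = σ.minor i := LinearMap.det_toLin' _
  rw [h3, ← hker] at h1
  rw [h1]
  exact Nat.card_congr (ρ.quotKerEquivOfSurjective hsurj).toEquiv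

end

theorem Presents.isPos {F : Type*} [AddCommGroup F] {g : Fin (n + 1) → ℤ × F} {β : ℤ × F} (h : σ.Presents g β)
    (hg : ∀ i, 0 < (g i).1) (hβ : 0 < β.1) : σ.IsPos fun i => (g i).1 := by
  have hc : ∀ y, (comb g y).1 = (fun i => (g i).1) ⬝ᵥ y := by
    intro y
    rw [Fintype.linearCombination_apply, Prod.fst_sum]
    simp [dotProduct, mul_comm]
  refine ⟨fun x hx => h.inj (by simpa using hx), hg, ?_, ?_⟩
  · ext j
    have h1 := congrArg Prod.fst ((h.ker (σ.A *ᵥ Pi.single j 1)).2 ⟨_, rfl⟩)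
    rw [hc, dotProduct_mulVec, dotProduct_single_one] at h1
    exact h1
  · rw [← hc, h.rhs]; exact hβ

theorem Presents.abs_minor {F : Type*} [AddCommGroup F] {g : Fin (n + 1) → ℤ × F} {β : ℤ × F} (h : σ.Presents g β)
    (hg : ∀ i, 0 < (g i).1) (hβ : 0 < β.1) (i : Fin (n + 1)) : |σ.minor i| = (g i).1 * Nat.card F := by
  have h1 := h.natAbs_minor ((h.isPos hg hβ).minor_ne_zero i)
  rw [index_zmultiples_prod (hg i).ne'] at h1
  rw [Int.abs_eq_natAbs, h1]
  push_cast
  rw [abs_of_pos (hg i)]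

/-- Elements of the kernel of the positive relation are torsion modulo the columns. -/
theorem IsPos.exists_multiple (h : σ.IsPos w) {y : Fin (n + 1) → ℤ} (hy : w ⬝ᵥ y = 0) :
    ∃ x, σ.A *ᵥ x = σ.minor 0 • y := by
  let M := σ.A.submatrix (0 : Fin (n + 1)).succAbove id
  let x := M.adjugate *ᵥ (y ∘ (0 : Fin (n + 1)).succAbove)
  refine ⟨x, ?_⟩
  have h1 : M *ᵥ x = σ.minor 0 • (y ∘ (0 : Fin (n + 1)).succAbove) := by
    rw [mulVec_mulVec, mul_adjugate, smul_mulVec, one_mulVec]; rfl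
  have h2 : ∀ j : Fin n, (σ.A *ᵥ x) j.succ = (σ.minor 0 • y) j.succ := fun j => congrFun h1 j
  have h3 : w ⬝ᵥ (σ.A *ᵥ x) = w ⬝ᵥ (σ.minor 0 • y) := by
    rw [dotProduct_mulVec, h.ker, zero_dotProduct, dotProduct_smul, hy, smul_zero]
  ext i
  induction i using Fin.cases with
  | succ j => exact h2 j
  | zero =>
    simp only [dotProduct, Fin.sum_univ_succ, h2] at h3
    exact mul_left_cancel₀ (h.pos 0).ne' (add_right_cancel h3)

/-- Every positive system has a presentation. -/
theorem IsPos.exists_presents (h : σ.IsPos w) : ∃ (ds : List ℤ) (g : Fin (n + 1) → Grid ds) (β : Grid ds),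
    Valid ds ∧ σ.Presents g β ∧ (∀ i, 0 < (g i).1) ∧ 0 < β.1 := by
  let N := LinearMap.range σ.A.mulVecLin
  let Q := (Fin (n + 1) → ℤ) ⧸ N
  let D : Q →+ ℤ := (N.liftQ (dotProductBilin ℤ ℤ w) (by
    rintro _ ⟨x, rfl⟩
    change w ⬝ᵥ (σ.A *ᵥ x) = 0
    rw [dotProduct_mulVec, h.ker, zero_dotProduct])).toAddMonoidHom
  have hD : ∀ y, D (N.mkQ y) = w ⬝ᵥ y := fun y => rfl
  have htor : ∀ q, D q = 0 → σ.minor 0 • q = 0 := by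
    intro q hq
    obtain ⟨y, rfl⟩ := N.mkQ_surjective q
    rw [hD] at hq
    obtain ⟨x, hx⟩ := h.exists_multiple hq
    rw [← map_zsmul, ← hx, ← LinearMap.mem_ker, Submodule.ker_mkQ]
    exact ⟨x, rfl⟩
  have hfg : AddGroup.FG Q := Module.Finite.iff_addGroup_fg.1 inferInstance
  obtain ⟨T, _, _, e, hc⟩ := exists_equiv_int_prod (h.minor_ne_zero 0) htor (q₀ := N.mkQ (Pi.single 0 1)) (by
    rw [hD, dotProduct_single_one]; exact (h.pos 0).ne')
  obtain ⟨ds, hds, ⟨f⟩⟩ := exists_finPart_equiv_of_finite T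
  let φ : (Fin (n + 1) → ℤ) →ₗ[ℤ] Grid ds :=
    ((e.trans (AddEquiv.prodCongr (AddEquiv.refl ℤ) f)).toIntLinearEquiv.toLinearMap).comp N.mkQ
  have hφ : ∀ y, φ y = ((e (N.mkQ y)).1, f (e (N.mkQ y)).2) := fun y => rfl
  have hcomb : comb (fun i => φ (Pi.single i 1)) = φ := by
    refine LinearMap.pi_ext fun i t => ?_
    rw [Fintype.linearCombination_apply_single, ← map_smul, ← Pi.single_smul, smul_eq_mul, mul_one]
  have hpos : ∀ y, 0 < w ⬝ᵥ y → 0 < (φ y).1 := by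
    intro y hy
    have h1 := hom_apply (D.comp e.symm.toAddMonoidHom) (e (N.mkQ y))
    simp only [AddMonoidHom.comp_apply, AddEquiv.toAddMonoidHom_eq_coe, AddMonoidHom.coe_coe,
      AddEquiv.symm_apply_apply] at h1
    rw [hD] at h1
    rw [h1] at hy
    exact pos_of_mul_pos_left hy hc.le
  refine ⟨ds, fun i => φ (Pi.single i 1), φ σ.b, hds, ⟨fun x y hxy => ?_, ?_, fun y => ?_, ?_⟩, fun i => hpos _ ?_,
    hpos _ h.rhs⟩
  · refine sub_eq_zero.1 (h.inj _ ?_)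
    rw [mulVec_sub, sub_eq_zero]; exact hxy
  · rw [hcomb]
    exact (e.trans (AddEquiv.prodCongr (AddEquiv.refl ℤ) f)).surjective.comp N.mkQ_surjective
  · rw [hcomb]
    change (e.trans (AddEquiv.prodCongr (AddEquiv.refl ℤ) f)) (N.mkQ y) = 0 ↔ _
    rw [map_eq_zero_iff _ (AddEquiv.injective _), ← LinearMap.mem_ker, Submodule.ker_mkQ]
    rfl
  · rw [hcomb]
  · rw [dotProduct_single_one]; exact h.pos i

end System
end DeltaSimplex

namespace DeltaSimplex

/-! ### The elements of the groups as lists -/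

/-- The element of the group that is described by a list. -/
def tg (ds : List ℤ) (x : El) : Grid ds := (x.1, fun i => ((x.2.getD i 0 : ℤ) : ZMod (ds[i]).natAbs))

/-- The list has the right length. -/
def Ok (ds : List ℤ) (x : El) : Prop := x.2.length = ds.length

variable {ds : List ℤ}

theorem isZ_iff {x : El} (hx : Ok ds x) : El.isZ ds x = true ↔ tg ds x = 0 := by
  unfold El.isZ tg
  rw [Bool.and_eq_true, eqb_eq_true, List.all_eq_true, Prod.ext_iff]
  refine and_congr_right fun _ => ?_
  rw [funext_iff]
  constructor
  · intro h i
    have hi : i < x.2.length := hx.symm ▸ i.2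
    have h1 := h (ds[i], x.2[i]) (List.mem_iff_getElem.2 ⟨i, by simp [hi], by simp⟩)
    rw [eqb_eq_true, sub_eq_zero] at h1
    have h2 : x.2.getD i 0 = x.2[i] := List.getD_eq_getElem _ _ _
    change ((x.2.getD i 0 : ℤ) : ZMod (ds[i]).natAbs) = 0
    rw [h2, ZMod.intCast_zmod_eq_zero_iff_dvd, Int.natAbs_dvd]
    exact Dvd.intro _ h1.symm
  · intro h p hp
    obtain ⟨i, hi, rfl⟩ := List.mem_iff_getElem.1 hp
    have hi' : i < ds.length := by simp at hi; omega
    have hi2 : i < x.2.length := by simp at hi; omega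
    have h1 := h ⟨i, hi'⟩
    have h2 : x.2.getD i 0 = x.2[i] := List.getD_eq_getElem _ _ _
    change ((x.2.getD i 0 : ℤ) : ZMod (ds[i]).natAbs) = 0 at h1
    rw [h2, ZMod.intCast_zmod_eq_zero_iff_dvd, Int.natAbs_dvd] at h1
    rw [eqb_eq_true, sub_eq_zero]
    simp [Int.mul_ediv_cancel' h1]

theorem ok_sub {x y : El} (hx : Ok ds x) (hy : Ok ds y) : Ok ds (El.sub x y) := by
  simp only [Ok, El.sub, List.length_map, List.length_zip] at *; omega

theorem tg_sub {x y : El} (hx : Ok ds x) (hy : Ok ds y) : tg ds (El.sub x y) = tg ds x - tg ds y := by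
  refine Prod.ext rfl (funext fun i => ?_)
  have h1 : i < x.2.length := hx.symm ▸ i.2
  have h2 : i < y.2.length := hy.symm ▸ i.2
  have h3 : ((x.2.zip y.2).map fun p => p.1 - p.2).getD i 0 = x.2.getD i 0 - y.2.getD i 0 := by
    rw [List.getD_eq_getElem _ _ (by simp [h1, h2]), List.getD_eq_getElem _ _ h1, List.getD_eq_getElem _ _ h2]
    simp
  simp only [tg, El.sub, h3, Int.cast_sub]
  rfl

theorem ok_smul {x : El} (t : ℤ) (hx : Ok ds x) : Ok ds (El.smul t x) := by
  simpa [Ok, El.smul] using hx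

theorem tg_smul (t : ℤ) (x : El) : tg ds (El.smul t x) = t • tg ds x := by
  refine Prod.ext (by simp [tg, El.smul]) (funext fun i => ?_)
  have h3 : (x.2.map fun z => t * z).getD i 0 = t * x.2.getD i 0 := by
    rw [List.getD_eq_getElem?_getD, List.getD_eq_getElem?_getD, List.getElem?_map]
    rcases x.2[i.1]? with _ | z <;> simp
  change (((x.2.map fun z => t * z).getD i 0 : ℤ) : ZMod (ds[i]).natAbs) = t • ((x.2.getD i 0 : ℤ) : ZMod (ds[i]).natAbs)
  rw [h3, Int.cast_mul, zsmul_eq_mul]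

theorem eqG_iff {x y : El} (hx : Ok ds x) (hy : Ok ds y) : El.eqG ds x y = true ↔ tg ds x = tg ds y := by
  rw [El.eqG, isZ_iff (ok_sub hx hy), tg_sub hx hy, sub_eq_zero]

theorem memG_iff {l : List El} {x : El} (hl : ∀ y ∈ l, Ok ds y) (hx : Ok ds x) :
    El.memG ds l x = true ↔ ∃ y ∈ l, tg ds x = tg ds y := by
  rw [El.memG, List.any_eq_true]
  exact ⟨fun ⟨y, hy, h⟩ => ⟨y, hy, (eqG_iff hx (hl y hy)).1 h⟩, fun ⟨y, hy, h⟩ => ⟨y, hy, (eqG_iff hx (hl y hy)).2 h⟩⟩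

theorem ok_lin (y : List ℤ) (X : List El) : Ok ds (El.lin ds y X) := by
  simp [Ok, El.lin, idx]

theorem sum_map_zip {M : Type*} [AddCommMonoid M] (f : ℤ → El → M) (hf : ∀ x, f 0 x = 0) (y : List ℤ) (X : List El)
    (h : y.length ≤ X.length) (m : ℕ) (hm : y.length ≤ m) :
    ((y.zip X).map fun p => f p.1 p.2).sum = ∑ j ∈ Finset.range m, f (y.getD j 0) (X.getD j (0, [])) := by
  induction y generalizing X m with
  | nil => simp [hf]
  | cons a y ih =>
    rcases X with _ | ⟨x, X⟩
    · simp at h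
    rcases m with _ | m
    · simp at hm
    rw [Finset.sum_range_succ', List.zip_cons_cons, List.map_cons, List.sum_cons,
      ih X (by simpa using h) m (by simpa using hm), add_comm]
    simp

theorem tg_lin {y : List ℤ} {X : List El} (h : y.length ≤ X.length) {m : ℕ} (hm : y.length ≤ m) :
    tg ds (El.lin ds y X) = ∑ j ∈ Finset.range m, y.getD j 0 • tg ds (X.getD j (0, [])) := by
  refine Prod.ext ?_ (funext fun i => ?_)
  · rw [Prod.fst_sum]
    exact sum_map_zip (fun a x => a * x.1) (by simp) y X h m hm
  · have h2 : ((idx ds).map fun j => ((y.zip X).map fun p => p.1 * nth p.2.2 j 0).sum).getD i 0 =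
        ((y.zip X).map fun p => p.1 * p.2.2.getD i 0).sum := by
      rw [List.getD_eq_getElem _ _ (by simp [idx])]
      simp [idx, nth_natCast]
    have h3 : (tg ds (El.lin ds y X)).2 i = ((((y.zip X).map fun p => p.1 * p.2.2.getD i 0).sum : ℤ) : ZMod _) := by
      rw [← h2]; rfl
    rw [h3, sum_map_zip (fun a x => a * x.2.getD i 0) (by simp) y X h m hm, Prod.snd_sum, Finset.sum_apply]
    push_cast
    exact Finset.sum_congr rfl fun j _ => by simp [tg]

/-! ### Normal forms -/

/-- The list consists of remainders. -/
def IsCell (ds : List ℤ) (x : El) : Prop := List.Forall₂ (fun q r => 0 ≤ r ∧ r < q) ds x.2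

theorem IsCell.ok {x : El} (h : IsCell ds x) : Ok ds x := (List.Forall₂.length_eq h).symm

theorem IsCell.eq {x y : El} (hx : IsCell ds x) (hy : IsCell ds y) (h : tg ds x = tg ds y) : x = y := by
  refine Prod.ext (congrArg Prod.fst h :) (List.ext_getElem (hx.ok.trans hy.ok.symm) fun i h1 h2 => ?_)
  have hi : i < ds.length := hx.ok ▸ h1
  have h3 := congrFun (congrArg Prod.snd h) ⟨i, hi⟩
  have ex : x.2.getD i 0 = x.2[i] := List.getD_eq_getElem _ _ _
  have ey : y.2.getD i 0 = y.2[i] := List.getD_eq_getElem _ _ _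
  change ((x.2.getD i 0 : ℤ) : ZMod (ds[i]).natAbs) = ((y.2.getD i 0 : ℤ) : ZMod (ds[i]).natAbs) at h3
  rw [ex, ey, ZMod.intCast_eq_intCast_iff_dvd_sub, Int.natAbs_dvd] at h3
  have bx := List.Forall₂.get hx hi h1
  have b_y := List.Forall₂.get hy hi h2
  simp only [List.get_eq_getElem] at bx b_y
  have := Int.eq_zero_of_abs_lt_dvd h3 (by rw [abs_lt]; constructor <;> omega)
  omega

/-- The normal form of an element. -/
def rep (ds : List ℤ) (z : Grid ds) : El := (z.1, List.ofFn fun i => ((z.2 i).val : ℤ))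

theorem isCell_rep (hds : Valid ds) (z : Grid ds) : IsCell ds (rep ds z) := by
  have := hds.neZero
  refine List.forall₂_iff_get.2 ⟨by simp [rep], fun i h1 h2 => ?_⟩
  have h3 := ZMod.val_lt (z.2 ⟨i, h1⟩)
  have h4 := hds ds[i] (List.getElem_mem h1)
  simp only [rep, List.get_eq_getElem, List.getElem_ofFn]
  have h5 : (⟨i, h1⟩ : Fin ds.length).1 = i := rfl
  simp only [Fin.getElem_fin] at h3
  omega

theorem tg_rep (hds : Valid ds) (z : Grid ds) : tg ds (rep ds z) = z := by
  have := hds.neZero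
  refine Prod.ext rfl (funext fun i => ?_)
  have h1 : (rep ds z).2.getD i 0 = ((z.2 i).val : ℤ) := by
    rw [List.getD_eq_getElem _ _ (by simp [rep])]
    simp [rep]
  change (((rep ds z).2.getD i 0 : ℤ) : ZMod (ds[i]).natAbs) = _
  rw [h1]
  simp

theorem mem_cellsOf {Δ : ℕ} (hq : ∀ q ∈ ds, q ≤ Δ) {hs : List ℤ} {x : El} :
    x ∈ cellsOf hs (elems (rangeZ Δ) ds) ↔ x.1 ∈ hs ∧ IsCell ds x := by
  simp only [cellsOf, List.mem_flatMap, List.mem_map, mem_elems hq]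
  constructor
  · rintro ⟨h, hh, y, hy, rfl⟩; exact ⟨hh, hy⟩
  · rintro ⟨h1, h2⟩; exact ⟨x.1, h1, x.2, h2, rfl⟩

theorem nodup_rangeZ (n : ℕ) : (rangeZ n).Nodup := List.nodup_range.map Nat.cast_injective

theorem nodup_elems (Δ : ℕ) (ds : List ℤ) : (elems (rangeZ Δ) ds).Nodup := by
  induction ds with
  | nil => simp [elems]
  | cons q ds ih =>
    rw [elems, extendElems, List.nodup_flatMap]
    refine ⟨fun r _ => ih.map (List.cons_injective), ?_⟩
    refine ((nodup_rangeZ Δ).filter _).imp fun {a b} hab x hx hy => hab ?_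
    obtain ⟨u, -, rfl⟩ := List.mem_map.1 hx
    obtain ⟨v, -, h⟩ := List.mem_map.1 hy
    simp at h; exact h.1.symm

theorem nodup_cellsOf {hs : List ℤ} {F : List (List ℤ)} (h1 : hs.Nodup) (h2 : F.Nodup) : (cellsOf hs F).Nodup := by
  rw [cellsOf, List.nodup_flatMap]
  refine ⟨fun r _ => h2.map fun a b h => by simpa using h, ?_⟩
  refine h1.imp fun {a b} hab x hx hy => hab ?_
  obtain ⟨u, -, rfl⟩ := List.mem_map.1 hx
  obtain ⟨v, -, h⟩ := List.mem_map.1 hy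
  simp at h; exact h.1.symm

theorem card_finPart {Δ : ℕ} (hds : Valid ds) (hq : ∀ q ∈ ds, q ≤ Δ) :
    Nat.card (FinPart ds) = (elems (rangeZ Δ) ds).length := by
  have e : FinPart ds ≃ {x // x ∈ elems (rangeZ Δ) ds} :=
    { toFun := fun f => ⟨(rep ds (0, f)).2, (mem_elems hq).2 (isCell_rep hds _)⟩
      invFun := fun x => (tg ds (0, x.1)).2
      left_inv := fun f => congrArg Prod.snd (tg_rep hds (0, f))
      right_inv := fun x => by
        have h1 : IsCell ds (0, x.1) := (mem_elems hq).1 x.2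
        exact Subtype.ext (congrArg Prod.snd ((isCell_rep hds _).eq h1 (tg_rep hds _))) }
  have e' : {x // x ∈ elems (rangeZ Δ) ds} ≃ {x // x ∈ (elems (rangeZ Δ) ds).toFinset} :=
    Equiv.subtypeEquivRight fun x => List.mem_toFinset.symm
  rw [Nat.card_congr (e.trans e'), Nat.card_eq_fintype_card, Fintype.card_coe,
    List.toFinset_card_of_nodup (nodup_elems Δ ds)]

end DeltaSimplex

namespace DeltaSimplex

/-! ### The triangular basis of the relations -/

section
variable {G : Type*} [AddCommGroup G]

/-- The element with given coordinates. -/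
def rsum (γ : ℕ → G) (k : ℕ) (t : ℤ) (y : List ℤ) : G := t • γ 0 + ∑ j ∈ Finset.range k, y.getD j 0 • γ (j + 1)

theorem rsum_eq (γ : ℕ → G) (k : ℕ) (t : ℤ) (y : List ℤ) :
    rsum γ k t y = ∑ j ∈ Finset.range (k + 1), (t :: y).getD j 0 • γ j := by
  rw [rsum, Finset.sum_range_succ', add_comm]; rfl

/-- The state of the computation after `k` steps: `T` represents the cosets of the multiples of `γ₀`
in the group generated by `γ₀, …, γₖ`, and `cols` is a basis of the relations. -/
structure IsTriangular (γ : ℕ → G) (k : ℕ) (T cols : List (List ℤ)) : Prop where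
  length_cols : cols.length = k
  length_of_mem : ∀ y ∈ T, y.length = k
  exists_rep : ∀ z : ℕ → ℤ, ∃ t, ∃ y ∈ T, ∑ j ∈ Finset.range (k + 1), z j • γ j = rsum γ k t y
  unique : ∀ y ∈ T, ∀ y' ∈ T, ∀ t t', rsum γ k t y = rsum γ k t' y' → y = y'
  nodup : T.Nodup
  exists_coeff : ∀ z : ℕ → ℤ, ∑ j ∈ Finset.range (k + 1), z j • γ j = 0 →
    ∃ x : ℕ → ℤ, ∀ j < k + 1, z j = ∑ l ∈ Finset.range k, x l * (cols.getD l []).getD j 0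
  relation : ∀ l < k, ∑ j ∈ Finset.range (k + 1), (cols.getD l []).getD j 0 • γ j = 0
  independent : ∀ x : ℕ → ℤ, (∀ j < k + 1, ∑ l ∈ Finset.range k, x l * (cols.getD l []).getD j 0 = 0) →
    ∀ l < k, x l = 0
  length_le : ∀ l < k, (cols.getD l []).length ≤ k + 1

theorem IsTriangular.zero {γ : ℕ → G} (h0 : ∀ t : ℤ, t • γ 0 = 0 → t = 0) : IsTriangular γ 0 [[]] [] where
  length_cols := rfl
  length_of_mem := by simp
  exists_rep z := ⟨z 0, [], by simp, by simp [rsum]⟩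
  unique := by simp
  nodup := by simp
  exists_coeff z hz := ⟨0, fun j hj => by
    obtain rfl : j = 0 := by omega
    simpa using h0 (z 0) (by simpa using hz)⟩
  relation := by simp
  independent := by simp
  length_le := by simp

theorem mem_extendT {Δ : ℕ} {T : List (List ℤ)} {r : ℤ} (hr : r ≤ Δ) {c : List ℤ} :
    c ∈ extendT (rangeZ Δ) T r ↔ ∃ q, 0 ≤ q ∧ q < r ∧ ∃ y ∈ T, c = y ++ [q] := by
  simp only [extendT, List.mem_flatMap, List.mem_filter, mem_rangeZ, ltb_eq_true, List.mem_map]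
  constructor
  · rintro ⟨q, ⟨⟨h1, -⟩, h2⟩, y, hy, rfl⟩; exact ⟨q, h1, h2, y, hy, rfl⟩
  · rintro ⟨q, h1, h2, y, hy, rfl⟩; exact ⟨q, ⟨⟨h1, by omega⟩, h2⟩, y, hy, rfl⟩

theorem nodup_extendT {Δ : ℕ} {T : List (List ℤ)} (h : T.Nodup) (r : ℤ) : (extendT (rangeZ Δ) T r).Nodup := by
  rw [extendT, List.nodup_flatMap]
  refine ⟨fun q _ => h.map fun a b hab => List.append_cancel_right hab, ?_⟩
  refine ((nodup_rangeZ Δ).filter _).imp fun {a b} hab x hx hy => hab ?_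
  obtain ⟨u, -, rfl⟩ := List.mem_map.1 hx
  obtain ⟨v, -, h⟩ := List.mem_map.1 hy
  have := (List.append_inj' h rfl).2
  simpa using this.symm

theorem rsum_append (γ : ℕ → G) {k : ℕ} (t : ℤ) {y : List ℤ} (hy : y.length = k) (q : ℤ) :
    rsum γ (k + 1) t (y ++ [q]) = rsum γ k t y + q • γ (k + 1) := by
  rw [rsum, rsum, Finset.sum_range_succ, add_assoc, List.getD_append_right _ _ _ _ hy.le]
  congr 2
  · refine Finset.sum_congr rfl fun j hj => ?_
    rw [List.getD_append _ _ _ _ (by rw [hy]; exact Finset.mem_range.1 hj)]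
  · simp [hy]

theorem getD_relColumn {r : ℤ} {c : List ℤ} {k : ℕ} (hc : c.length = k + 1) (j : ℕ) :
    (relColumn (r, c)).getD j 0 = if j < k + 1 then -c.getD j 0 else if j = k + 1 then r else 0 := by
  rw [relColumn]
  split_ifs with h1 h2
  · rw [List.getD_append _ _ _ _ (by simp [hc, h1]), List.getD_eq_getElem _ _ (by simp [hc, h1]),
      List.getD_eq_getElem _ _ (by omega)]
    simp
  · subst h2
    rw [List.getD_append_right _ _ _ _ (by simp [hc])]
    simp [hc]
  · rw [List.getD_eq_default _ _ (by simp [hc]; omega)]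

variable {γ : ℕ → G} {k : ℕ} {T cols : List (List ℤ)}

theorem IsTriangular.exists_rsum_smul (h : IsTriangular γ k T cols) (t t' e : ℤ) (y y' : List ℤ) :
    ∃ s, ∃ u ∈ T, rsum γ k t y + e • rsum γ k t' y' = rsum γ k s u := by
  obtain ⟨s, u, hu, hs⟩ := h.exists_rep fun j => (t :: y).getD j 0 + e * (t' :: y').getD j 0
  refine ⟨s, u, hu, ?_⟩
  rw [← hs, rsum_eq, rsum_eq, Finset.smul_sum, ← Finset.sum_add_distrib]
  exact Finset.sum_congr rfl fun j _ => by rw [add_smul, mul_smul]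

theorem IsTriangular.step (h : IsTriangular γ k T cols) {Δ : ℕ} {r t : ℤ} {y : List ℤ} (hr : 0 < r) (hrΔ : r ≤ Δ)
    (hy : y ∈ T) (hrel : r • γ (k + 1) = rsum γ k t y)
    (hmin : ∀ q, 0 < q → q < r → ∀ s, ∀ u ∈ T, q • γ (k + 1) ≠ rsum γ k s u) :
    IsTriangular γ (k + 1) (extendT (rangeZ Δ) T r) (cols ++ [relColumn (r, t :: y)]) := by
  have hyl := h.length_of_mem y hy
  have hcl : (t :: y).length = k + 1 := by simp [hyl]
  have hold : ∀ l < k, (cols ++ [relColumn (r, t :: y)]).getD l [] = cols.getD l [] := fun l hl =>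
    List.getD_append _ _ _ _ (by rw [h.length_cols]; exact hl)
  have hnew : (cols ++ [relColumn (r, t :: y)]).getD k [] = relColumn (r, t :: y) := by
    rw [List.getD_append_right _ _ _ _ h.length_cols.le]; simp [h.length_cols]
  have hzero : ∀ l < k, (cols.getD l []).getD (k + 1) 0 = 0 := fun l hl =>
    List.getD_eq_default _ _ (h.length_le l hl)
  have hrel' : ∑ j ∈ Finset.range (k + 1), (t :: y).getD j 0 • γ j = r • γ (k + 1) := by rw [hrel, rsum_eq]
  -- the multiples of the new element
  have hmod : ∀ q s, ∀ u ∈ T, q • γ (k + 1) = rsum γ k s u → r ∣ q := by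
    intro q s u hu hq
    obtain ⟨s', u', hu', h1⟩ := h.exists_rsum_smul s t (-(q / r)) u y
    have h2 : (q % r) • γ (k + 1) = rsum γ k s' u' := by
      rw [← h1, ← hq, ← hrel, Int.emod_def, sub_smul, neg_smul, sub_eq_add_neg, mul_comm, mul_smul]
    by_contra hd
    have h3 := Int.emod_nonneg q hr.ne'
    have h4 : q % r ≠ 0 := fun h0 => hd (Int.dvd_of_emod_eq_zero h0)
    exact hmin _ (by omega) (Int.emod_lt_of_pos q hr) _ _ hu' h2
  refine ⟨by simp [h.length_cols], ?_, ?_, ?_, nodup_extendT h.nodup r, ?_, ?_, ?_, ?_⟩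
  · intro c hc
    obtain ⟨q, -, -, u, hu, rfl⟩ := (mem_extendT hrΔ).1 hc
    simp [h.length_of_mem u hu]
  · intro z
    obtain ⟨s, u, hu, h1⟩ := h.exists_rep fun j => z j + (z (k + 1) / r) * (t :: y).getD j 0
    refine ⟨s, u ++ [z (k + 1) % r], (mem_extendT hrΔ).2 ⟨_, Int.emod_nonneg _ hr.ne', Int.emod_lt_of_pos _ hr, u, hu, rfl⟩, ?_⟩
    rw [rsum_append γ s (h.length_of_mem u hu), ← h1, Finset.sum_range_succ]
    simp only [add_smul, mul_smul, Finset.sum_add_distrib, ← Finset.smul_sum, hrel']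
    rw [add_assoc, ← mul_smul, ← add_smul, mul_comm, Int.mul_ediv_add_emod]
  · intro c hc c' hc' s s' hs
    obtain ⟨q, hq0, hqr, u, hu, rfl⟩ := (mem_extendT hrΔ).1 hc
    obtain ⟨q', hq0', hqr', u', hu', rfl⟩ := (mem_extendT hrΔ).1 hc'
    rw [rsum_append γ s (h.length_of_mem u hu), rsum_append γ s' (h.length_of_mem u' hu')] at hs
    obtain ⟨s'', v, hv, h1⟩ := h.exists_rsum_smul s' s (-1) u' u
    have h2 : (q - q') • γ (k + 1) = rsum γ k s'' v := by
      rw [← h1, sub_smul, neg_one_smul, ← sub_eq_add_neg, sub_eq_sub_iff_add_eq_add, add_comm, hs, add_comm]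
    have h3 := Int.eq_zero_of_abs_lt_dvd (hmod _ _ _ hv h2) (by rw [abs_lt]; constructor <;> omega)
    obtain rfl : q = q' := by omega
    rw [h.unique u hu u' hu' s s' (add_right_cancel hs)]
  · intro z hz
    rw [Finset.sum_range_succ] at hz
    obtain ⟨s, u, hu, h1⟩ := h.exists_rep fun j => -z j
    have h2 : z (k + 1) • γ (k + 1) = rsum γ k s u := by
      rw [← h1]
      simp only [neg_smul, Finset.sum_neg_distrib]
      exact eq_neg_of_add_eq_zero_right hz
    obtain ⟨e, he⟩ := hmod _ _ _ hu h2
    obtain ⟨x, hx⟩ := h.exists_coeff (fun j => z j + e * (t :: y).getD j 0) (by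
      simp only [add_smul, mul_smul, Finset.sum_add_distrib, ← Finset.smul_sum, hrel']
      rw [← mul_smul, mul_comm, ← he]; exact hz)
    refine ⟨fun l => if l = k then e else x l, fun j hj => ?_⟩
    rw [Finset.sum_range_succ]
    beta_reduce
    rw [if_pos rfl, hnew, getD_relColumn hcl]
    have h3 : ∑ l ∈ Finset.range k, (if l = k then e else x l) * ((cols ++ [relColumn (r, t :: y)]).getD l []).getD j 0 =
        ∑ l ∈ Finset.range k, x l * (cols.getD l []).getD j 0 := by
      refine Finset.sum_congr rfl fun l hl => ?_
      have := Finset.mem_range.1 hl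
      rw [if_neg (by omega), hold l this]
    rw [h3]
    by_cases hj' : j < k + 1
    · rw [if_pos hj', ← hx j hj']; ring
    · obtain rfl : j = k + 1 := by omega
      rw [if_neg hj', if_pos rfl, Finset.sum_eq_zero fun l hl => by rw [hzero l (Finset.mem_range.1 hl), mul_zero], he]
      ring
  · intro l hl
    rw [Finset.sum_range_succ]
    by_cases hl' : l < k
    · rw [hold l hl', h.relation l hl', hzero l hl', zero_smul, add_zero]
    · obtain rfl : l = k := by omega
      rw [hnew, getD_relColumn hcl, if_neg (by omega), if_pos rfl, ← hrel', ← Finset.sum_add_distrib]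
      refine Finset.sum_eq_zero fun j hj => ?_
      rw [getD_relColumn hcl, if_pos (Finset.mem_range.1 hj), neg_smul, neg_add_cancel]
  · intro x hx
    have h1 : x k = 0 := by
      have h2 := hx (k + 1) (by omega)
      rw [Finset.sum_range_succ, hnew, getD_relColumn hcl, if_neg (by omega), if_pos rfl, Finset.sum_eq_zero, zero_add] at h2
      · exact (mul_eq_zero.1 h2).resolve_right hr.ne'
      · intro l hl
        have := Finset.mem_range.1 hl
        rw [hold l this, hzero l this, mul_zero]
    have h3 := h.independent x fun j hj => by
      have h2 := hx j (by omega)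
      rw [Finset.sum_range_succ, h1, zero_mul, add_zero] at h2
      refine Eq.trans (Finset.sum_congr rfl fun l hl => ?_) h2
      rw [hold l (Finset.mem_range.1 hl)]
    intro l hl
    by_cases hl' : l < k
    · exact h3 l hl'
    · obtain rfl : l = k := by omega
      exact h1
  · intro l hl
    by_cases hl' : l < k
    · rw [hold l hl']
      have := h.length_le l hl'
      omega
    · obtain rfl : l = k := by omega
      rw [hnew, relColumn]
      simp [hyl]

/-- There are at most as many coefficient vectors as cosets. -/
theorem IsTriangular.length_le_index (h : IsTriangular γ k T cols) (hi : (AddSubgroup.zmultiples (γ 0)).index ≠ 0) :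
    T.length ≤ (AddSubgroup.zmultiples (γ 0)).index := by
  have hfin : Finite (G ⧸ AddSubgroup.zmultiples (γ 0)) := Nat.finite_of_card_ne_zero hi
  have := Fintype.ofFinite (G ⧸ AddSubgroup.zmultiples (γ 0))
  let f : List ℤ → G ⧸ AddSubgroup.zmultiples (γ 0) := fun y => QuotientAddGroup.mk (rsum γ k 0 y)
  have h1 : (T.map f).Nodup := by
    refine (List.nodup_map_iff_inj_on h.nodup).2 fun y hy y' hy' hf => ?_
    obtain ⟨t, ht⟩ := AddSubgroup.mem_zmultiples_iff.1 (QuotientAddGroup.eq.1 hf)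
    refine h.unique y hy y' hy' t 0 ?_
    have h2 : rsum γ k t y = t • γ 0 + rsum γ k 0 y := by simp [rsum]
    rw [h2, ht]; abel
  have h2 := h1.length_le_card
  rwa [List.length_map, ← Nat.card_eq_fintype_card] at h2

end

end DeltaSimplex

namespace DeltaSimplex

/-- The elements of a list of rows. -/
def rowsTg (ds : List ℤ) (rows : List El) (j : ℕ) : Grid ds := tg ds (rows.getD j (0, []))

variable {ds : List ℤ}

theorem mem_findRep {r₀ w : El} {gs : List El} {T : List (List ℤ)} {c : List ℤ} {k : ℕ} (h0 : Ok ds r₀) (hpos : 0 < r₀.1)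
    (hw : Ok ds w) (hT : ∀ y ∈ T, y.length = k) (hk : k ≤ gs.length) :
    c ∈ findRep ds r₀ gs T w ↔ ∃ t, ∃ y ∈ T, c = t :: y ∧ tg ds w = rsum (rowsTg ds (r₀ :: gs)) k t y := by
  rw [findRep, List.mem_flatMap]
  have key : ∀ y ∈ T, c ∈ repOf ds r₀ y (El.sub w (El.lin ds y gs)) ↔
      ∃ t, c = t :: y ∧ tg ds w = rsum (rowsTg ds (r₀ :: gs)) k t y := by
    intro y hy
    have hlin := tg_lin (ds := ds) (X := gs) ((hT y hy).le.trans hk) (hT y hy).le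
    have h1 : ∀ t : ℤ, rsum (rowsTg ds (r₀ :: gs)) k t y = t • tg ds r₀ + tg ds (El.lin ds y gs) := by
      intro t; rw [hlin]; rfl
    simp only [h1]
    set u := El.sub w (El.lin ds y gs) with hu
    have hou : Ok ds u := ok_sub hw (ok_lin _ _)
    have h2 : ∀ t : ℤ, tg ds w = t • tg ds r₀ + tg ds (El.lin ds y gs) ↔ tg ds u = t • tg ds r₀ := by
      intro t; rw [hu, tg_sub hw (ok_lin _ _), sub_eq_iff_eq_add]
    simp only [h2]
    have h3 : El.eqG ds u (El.smul (u.1 / r₀.1) r₀) = true ↔ tg ds u = (u.1 / r₀.1) • tg ds r₀ := by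
      rw [eqG_iff hou (ok_smul _ h0), tg_smul]
    have h4 : ∀ t : ℤ, tg ds u = t • tg ds r₀ → t = u.1 / r₀.1 := by
      intro t ht
      have h5 : u.1 = t * r₀.1 := congrArg Prod.fst ht
      rw [h5, Int.mul_ediv_cancel _ hpos.ne']
    unfold repOf
    rcases hb : El.eqG ds u (El.smul (u.1 / r₀.1) r₀) with _ | _
    · simp only [cond_false, List.not_mem_nil, false_iff]
      rintro ⟨t, -, ht⟩
      rw [h4 t ht, ← h3, hb] at ht
      exact Bool.noConfusion ht
    · rw [h3] at hb
      simp only [cond_true, List.mem_singleton]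
      constructor
      · rintro rfl; exact ⟨_, rfl, hb⟩
      · rintro ⟨t, rfl, ht⟩; rw [h4 t ht]
  constructor
  · rintro ⟨y, hy, h⟩
    obtain ⟨t, h1, h2⟩ := (key y hy).1 h
    exact ⟨t, y, hy, h1, h2⟩
  · rintro ⟨t, y, hy, h1, h2⟩
    exact ⟨y, hy, (key y hy).2 ⟨t, h1, h2⟩⟩

theorem headD_flatMap_spec {β : Type} (f : ℤ → List β) (d : ℤ × β) (l : List ℤ) (hl : l.Pairwise (· < ·))
    (h : ∃ r ∈ l, f r ≠ []) : ∃ r ∈ l, ∃ c ∈ f r,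
      (l.flatMap fun r => (f r).map fun c => (r, c)).headD d = (r, c) ∧ ∀ r' ∈ l, r' < r → f r' = [] := by
  induction l with
  | nil => simp at h
  | cons a l ih =>
    rw [List.pairwise_cons] at hl
    rcases hf : f a with _ | ⟨c, t⟩
    · obtain ⟨r, hr, hne⟩ := h
      have hra : r ≠ a := by rintro rfl; exact hne hf
      obtain ⟨r', hr', c, hc, h1, h2⟩ := ih hl.2 ⟨r, (List.mem_cons.1 hr).resolve_left hra, hne⟩
      refine ⟨r', by simp [hr'], c, hc, by simpa [hf] using h1, fun q hq hqr => ?_⟩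
      rcases List.mem_cons.1 hq with rfl | hq
      exacts [hf, h2 q hq hqr]
    · refine ⟨a, by simp, c, by simp [hf], by simp [hf], fun q hq hqa => ?_⟩
      rcases List.mem_cons.1 hq with rfl | hq
      · exact absurd hqa (lt_irrefl _)
      · exact absurd (hl.1 q hq) (not_lt.2 hqa.le)

theorem pairwise_rangeZ (n : ℕ) : (rangeZ n).Pairwise (· < ·) :=
  List.Pairwise.map _ (fun _ _ h => by exact_mod_cast h) List.pairwise_lt_range

theorem pairwise_range1 (n : ℕ) : (range1 n).Pairwise (· < ·) :=
  List.Pairwise.map _ (fun _ _ h => by omega) (pairwise_rangeZ n)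

/-- The rows of a candidate. -/
structure IsRows (ds : List ℤ) (Δ : ℕ) (rows : List El) : Prop where
  valid : Valid ds
  ok : ∀ x ∈ rows, Ok ds x
  pos : ∀ x ∈ rows, 0 < x.1
  bound : ∀ x ∈ rows, x.1 * Nat.card (FinPart ds) ≤ Δ

namespace IsRows
variable {Δ : ℕ} {r₀ : El} {gs : List El}

theorem index_le (h : IsRows ds Δ (r₀ :: gs)) : (AddSubgroup.zmultiples (rowsTg ds (r₀ :: gs) 0)).index ≠ 0 ∧
    (AddSubgroup.zmultiples (rowsTg ds (r₀ :: gs) 0)).index ≤ Δ := by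
  have := h.valid.finite
  have h1 := h.pos r₀ (by simp)
  have h2 := h.bound r₀ (by simp)
  have h3 : 0 < Nat.card (FinPart ds) := Nat.card_pos
  rw [index_zmultiples_prod (show (rowsTg ds (r₀ :: gs) 0).1 ≠ 0 from h1.ne')]
  change r₀.1.natAbs * _ ≠ 0 ∧ r₀.1.natAbs * _ ≤ Δ
  refine ⟨mul_ne_zero (by omega) h3.ne', ?_⟩
  zify
  rwa [abs_of_pos h1]

theorem isTriangular (h : IsRows ds Δ (r₀ :: gs)) (k : ℕ) (hk : k ≤ gs.length) :
    IsTriangular (rowsTg ds (r₀ :: gs)) k ((gs.take k).foldl (basisStep ds r₀ gs (rangeZ Δ) (range1 Δ)) ([[]], [])).1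
      ((gs.take k).foldl (basisStep ds r₀ gs (rangeZ Δ) (range1 Δ)) ([[]], [])).2 := by
  have h0 := h.ok r₀ (by simp)
  have hpos := h.pos r₀ (by simp)
  induction k with
  | zero =>
    refine IsTriangular.zero fun t ht => ?_
    have h1 : t * r₀.1 = 0 := congrArg Prod.fst ht
    exact (mul_eq_zero.1 h1).resolve_right hpos.ne'
  | succ k ih =>
    have ih := ih (by omega)
    rw [List.take_add_one, List.foldl_append, List.getElem?_eq_getElem (by omega)]
    set s := (gs.take k).foldl (basisStep ds r₀ gs (rangeZ Δ) (range1 Δ)) ([[]], []) with hs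
    set g := gs[k] with hg
    have hgo : Ok ds g := h.ok g (by simp [hg])
    have hγ : rowsTg ds (r₀ :: gs) (k + 1) = tg ds g := by
      rw [rowsTg, List.getD_cons_succ, List.getD_eq_getElem _ _ (by omega)]
    have hmem : ∀ r c, c ∈ findRep ds r₀ gs s.1 (El.smul r g) ↔ ∃ t, ∃ y ∈ s.1, c = t :: y ∧
        r • rowsTg ds (r₀ :: gs) (k + 1) = rsum (rowsTg ds (r₀ :: gs)) k t y := by
      intro r c
      rw [mem_findRep h0 hpos (ok_smul r hgo) ih.length_of_mem (by omega), tg_smul, hγ]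
    obtain ⟨hi0, hiΔ⟩ := h.index_le
    set m := (AddSubgroup.zmultiples (rowsTg ds (r₀ :: gs) 0)).index with hm
    obtain ⟨r, hr, c, hc, h1, h2⟩ := headD_flatMap_spec (fun r => findRep ds r₀ gs s.1 (El.smul r g)) (1, []) (range1 Δ)
      (pairwise_range1 Δ) ⟨m, mem_range1.2 ⟨by omega, by omega⟩, by
        obtain ⟨t, ht⟩ := AddSubgroup.mem_zmultiples_iff.1
          (AddSubgroup.nsmul_index_mem (H := AddSubgroup.zmultiples (rowsTg ds (r₀ :: gs) 0)) (rowsTg ds (r₀ :: gs) (k + 1)))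
        obtain ⟨t', y, hy, h3⟩ := ih.exists_rep fun j => if j = 0 then t else 0
        refine List.ne_nil_of_mem ((hmem m (t' :: y)).2 ⟨t', y, hy, rfl, ?_⟩)
        rw [← h3, natCast_zsmul, ← ht]
        simp⟩
    have hfo : findOrder ds r₀ gs (range1 Δ) s.1 g = (r, c) := h1
    rw [mem_range1] at hr
    obtain ⟨t, y, hy, rfl, hrel⟩ := (hmem r c).1 hc
    have hstep := ih.step (by omega) hr.2 hy hrel fun q hq0 hqr s' u hu hq => by
      have := h2 q (mem_range1.2 ⟨by omega, by omega⟩) hqr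
      exact List.not_mem_nil (this ▸ (hmem q (s' :: u)).2 ⟨s', u, hu, rfl, hq⟩)
    have hguard : guardT (rangeZ Δ) (extendT (rangeZ Δ) s.1 r) = extendT (rangeZ Δ) s.1 r := by
      have h3 := (hstep.length_le_index hi0).trans hiΔ
      rw [guardT, leb_eq_true.2 (by rw [length_rangeZ]; exact_mod_cast h3), cond_true]
    simp only [Option.toList_some, List.foldl_cons, List.foldl_nil, basisStep, hfo, hguard]
    exact hstep

theorem isTriangular_basis (h : IsRows ds Δ (r₀ :: gs)) : IsTriangular (rowsTg ds (r₀ :: gs)) gs.length (basis ds r₀ gs (rangeZ Δ) (range1 Δ)).1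
    (basis ds r₀ gs (rangeZ Δ) (range1 Δ)).2 := by
  have := h.isTriangular gs.length le_rfl
  rwa [List.take_length] at this

end IsRows

end DeltaSimplex

namespace DeltaSimplex
open Matrix Enc

namespace System

/-- The system with a given extended matrix. -/
def ofRows (n : ℕ) (M : List (List ℤ)) : System n :=
  ⟨of fun i j => (M.getD i []).getD j 0, fun i => (M.getD i []).getD n 0⟩

theorem ofFn_getD {β : Type*} (l : List β) (d : β) {n : ℕ} (h : l.length = n) : List.ofFn (fun i : Fin n => l.getD i d) = l := by
  subst h
  refine List.ext_getElem (by simp) fun i h1 h2 => ?_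
  rw [List.getElem_ofFn, List.getD_eq_getElem _ _ h2]

theorem encode_ofRows {n : ℕ} {M : List (List ℤ)} (h : M.length = n + 1) (hr : ∀ r ∈ M, r.length = n + 1) :
    (ofRows n M).encode = enc M := by
  have key : ∀ r : List ℤ, r.length = n + 1 →
      List.ofFn (fun j : Fin n => Val.int (r.getD j 0)) ++ [Val.int (r.getD n 0)] = r.map Val.int := by
    intro r hr
    have h1 : List.ofFn (fun j : Fin (n + 1) => r.getD j 0) = r := ofFn_getD r 0 hr
    rw [List.ofFn_succ_last] at h1
    conv_rhs => rw [← h1]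
    simp [List.map_ofFn, Function.comp_def]
  have h2 : ∀ i : Fin (n + 1), (M.getD i []).length = n + 1 := fun i => by
    rw [List.getD_eq_getElem _ _ (by omega)]; exact hr _ (List.getElem_mem _)
  have h3 : List.ofFn (fun i : Fin (n + 1) => M.getD i []) = M := ofFn_getD M [] h
  rw [encode]
  have h4 : (List.ofFn fun i : Fin (n + 1) => Val.ofList (List.ofFn (fun j => Val.int ((ofRows n M).A i j)) ++ [Val.int ((ofRows n M).b i)])) =
      (List.ofFn (fun i : Fin (n + 1) => M.getD i [])).map fun r => Val.ofList (r.map Val.int) := by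
    rw [List.map_ofFn]
    congr 1
    funext i
    exact congrArg Val.ofList (key _ (h2 i))
  rw [h4, h3]
  rfl

end System

open DeltaSimplex.System

variable {ds : List ℤ} {Δ n : ℕ} {r₀ : El} {gs rows : List El}

/-- The generators that are given by the rows. -/
def gens (ds : List ℤ) (n : ℕ) (rows : List El) (i : Fin (n + 1)) : Grid ds := rowsTg ds rows i

theorem comb_gens (y : ℕ → ℤ) : comb (gens ds n rows) (fun i => y i) = ∑ j ∈ Finset.range (n + 1), y j • rowsTg ds rows j := by
  rw [Fintype.linearCombination_apply, Finset.sum_range]; rfl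

theorem exists_extend (y : Fin (n + 1) → ℤ) : ∃ z : ℕ → ℤ, (fun i : Fin (n + 1) => z i) = y :=
  ⟨fun j => if h : j < n + 1 then y ⟨j, h⟩ else 0, by ext i; simp [i.2]⟩

theorem length_candMatrix {s : List (List ℤ) × List (List ℤ)} {b : El} :
    (candMatrix ds rows s b).length = rows.length := by
  simp [candMatrix, mkMatrix, idx]

theorem length_of_mem_candMatrix {s : List (List ℤ) × List (List ℤ)} {b : El} :
    ∀ r ∈ candMatrix ds rows s b, r.length = s.2.length + 1 := by
  simp only [candMatrix, mkMatrix, List.mem_map]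
  rintro _ ⟨j, -, rfl⟩
  simp [mkRow]

theorem getD_candMatrix {s : List (List ℤ) × List (List ℤ)} {b : El} {i : ℕ} (hi : i < rows.length) :
    (candMatrix ds rows s b).getD i [] = mkRow s.2 (lift ds rows s.1 b) i := by
  rw [List.getD_eq_getElem _ _ (by rwa [length_candMatrix])]
  simp [candMatrix, mkMatrix, idx]

theorem mkRow_getD_lt {cols : List (List ℤ)} {l : List ℤ} {i j : ℕ} (hj : j < cols.length) :
    (mkRow cols l i).getD j 0 = (cols.getD j []).getD i 0 := by
  rw [mkRow, List.getD_append _ _ _ _ (by simpa using hj), List.getD_eq_getElem _ _ (by simpa using hj),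
    List.getElem_map, nth_natCast, List.getD_eq_getElem cols _ hj]

theorem mkRow_getD_length {cols : List (List ℤ)} {l : List ℤ} {i : ℕ} :
    (mkRow cols l i).getD cols.length 0 = l.getD i 0 := by
  rw [mkRow, List.getD_append_right _ _ _ _ (by simp)]
  simp [nth_natCast]

theorem IsRows.generates_iff (h : IsRows ds Δ (r₀ :: gs)) (hn : gs.length = n) (hΔ : ∀ q ∈ ds, q ≤ Δ) {B : ℕ} (hB : 1 ≤ B) :
    generates ds (r₀ :: gs) (cellsOf (range1 B) (elems (rangeZ Δ) ds)) (basis ds r₀ gs (rangeZ Δ) (range1 Δ)).1 = true ↔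
      Function.Surjective (comb (gens ds n (r₀ :: gs))) := by
  have hT := h.isTriangular_basis
  subst hn
  have h0 := h.ok r₀ (by simp)
  have hpos := h.pos r₀ (by simp)
  have key : ∀ c, Ok ds c → ((findRep ds r₀ gs (basis ds r₀ gs (rangeZ Δ) (range1 Δ)).1 c) ≠ [] ↔
      ∃ y, comb (gens ds gs.length (r₀ :: gs)) y = tg ds c) := by
    intro c hc
    have h1 : ∀ l : List (List ℤ), l ≠ [] ↔ ∃ x, x ∈ l := fun l =>
      ⟨List.exists_mem_of_ne_nil l, fun ⟨x, hx⟩ => List.ne_nil_of_mem hx⟩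
    rw [h1]
    simp only [mem_findRep h0 hpos hc hT.length_of_mem le_rfl]
    constructor
    · rintro ⟨_, t, y, hy, rfl, h1⟩
      exact ⟨fun i => (t :: y).getD i 0, by rw [h1, rsum_eq]; exact comb_gens fun j => (t :: y).getD j 0⟩
    · rintro ⟨y, hy⟩
      obtain ⟨z, rfl⟩ := exists_extend y
      obtain ⟨t, y, hy', h1⟩ := hT.exists_rep z
      exact ⟨t :: y, t, y, hy', rfl, by rw [← hy, comb_gens, h1]⟩
  have h1 : generates ds (r₀ :: gs) (cellsOf (range1 B) (elems (rangeZ Δ) ds)) (basis ds r₀ gs (rangeZ Δ) (range1 Δ)).1 = true ↔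
      ∀ c ∈ cellsOf (range1 B) (elems (rangeZ Δ) ds), ∃ y, comb (gens ds gs.length (r₀ :: gs)) y = tg ds c := by
    rw [generates, List.all_eq_true]
    refine forall₂_congr fun c hc => ?_
    rw [← key c ((mem_cellsOf hΔ).1 hc).2.ok]
    simp
  rw [h1]
  constructor
  · intro H w
    have h2 : ∀ f : FinPart ds, ∃ y, comb (gens ds gs.length (r₀ :: gs)) y = (1, f) := fun f => by
      have := H (rep ds (1, f)) ((mem_cellsOf hΔ).2 ⟨mem_range1.2 ⟨le_rfl, show (1 : ℤ) ≤ B by exact_mod_cast hB⟩, isCell_rep h.valid _⟩)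
      rwa [tg_rep h.valid] at this
    obtain ⟨y, hy⟩ := h2 w.2
    obtain ⟨y', hy'⟩ := h2 0
    refine ⟨y + (w.1 - 1) • y', ?_⟩
    rw [map_add, map_smul, hy, hy']
    ext <;> simp
  · intro H c _
    exact H _

/-- The matrix of a candidate presents its group. -/
theorem IsRows.presents (h : IsRows ds Δ (r₀ :: gs)) (hn : gs.length = n)
    (hs : Function.Surjective (comb (gens ds n (r₀ :: gs)))) {b : El} (hb : Ok ds b) :
    (ofRows n (candMatrix ds (r₀ :: gs) (basis ds r₀ gs (rangeZ Δ) (range1 Δ)) b)).Presents (gens ds n (r₀ :: gs))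
      (tg ds b) := by
  have hT := h.isTriangular_basis
  subst hn
  set s := basis ds r₀ gs (rangeZ Δ) (range1 Δ) with hsb
  have h0 := h.ok r₀ (by simp)
  have hpos := h.pos r₀ (by simp)
  set σ := ofRows gs.length (candMatrix ds (r₀ :: gs) s b) with hσ
  have hA : ∀ i j, σ.A i j = (s.2.getD j []).getD i 0 := by
    intro i j
    change ((candMatrix ds (r₀ :: gs) s b).getD i []).getD j 0 = _
    rw [getD_candMatrix i.2, mkRow_getD_lt (by rw [hT.length_cols]; exact j.2)]
  have hB : ∀ i, σ.b i = (lift ds (r₀ :: gs) s.1 b).getD i 0 := by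
    intro i
    change ((candMatrix ds (r₀ :: gs) s b).getD i []).getD gs.length 0 = _
    rw [getD_candMatrix i.2]
    have := mkRow_getD_length (cols := s.2) (l := lift ds (r₀ :: gs) s.1 b) (i := i)
    rwa [hT.length_cols] at this
  have hmul : ∀ (x : ℕ → ℤ) (i : Fin (gs.length + 1)), (σ.A *ᵥ fun l => x l) i =
      ∑ l ∈ Finset.range gs.length, x l * (s.2.getD l []).getD i 0 := by
    intro x i
    rw [Finset.sum_range, mulVec, dotProduct]
    exact Finset.sum_congr rfl fun l _ => by rw [hA, mul_comm]
  have hext : ∀ x : Fin gs.length → ℤ, ∃ z : ℕ → ℤ, (fun l : Fin gs.length => z l) = x := fun x =>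
    ⟨fun j => if h : j < gs.length then x ⟨j, h⟩ else 0, by ext i; simp [i.2]⟩
  refine ⟨?_, hs, fun y => ⟨fun hy => ?_, ?_⟩, ?_⟩
  · intro x x' hx
    have h1 : σ.A *ᵥ (x - x') = 0 := by rw [mulVec_sub, sub_eq_zero]; exact hx
    refine sub_eq_zero.1 ?_
    obtain ⟨z, hz⟩ := hext (x - x')
    rw [← hz] at h1 ⊢
    ext l
    refine hT.independent z (fun j hj => ?_) l l.2
    rw [← hmul z ⟨j, hj⟩, h1]; rfl
  · obtain ⟨z, rfl⟩ := exists_extend y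
    rw [comb_gens] at hy
    obtain ⟨x, hx⟩ := hT.exists_coeff z hy
    refine ⟨fun l => x l, ?_⟩
    ext i
    rw [hmul, hx i i.2]
  · rintro ⟨x, rfl⟩
    obtain ⟨z, rfl⟩ := hext x
    have h1 : (σ.A *ᵥ fun l => z l) = fun i : Fin (gs.length + 1) =>
        (fun j : ℕ => ∑ l ∈ Finset.range gs.length, z l * (s.2.getD l []).getD j 0) i := by
      ext i; rw [hmul]
    rw [h1, comb_gens fun j : ℕ => ∑ l ∈ Finset.range gs.length, z l * (s.2.getD l []).getD j 0]
    simp only [Finset.sum_smul, mul_smul]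
    rw [Finset.sum_comm]
    simp only [← Finset.smul_sum]
    refine Finset.sum_eq_zero fun l hl => ?_
    rw [hT.relation l (Finset.mem_range.1 hl), smul_zero]
  · obtain ⟨y, hy⟩ := hs (tg ds b)
    obtain ⟨z, rfl⟩ := exists_extend y
    obtain ⟨t, u, hu, h1⟩ := hT.exists_rep z
    rw [comb_gens] at hy
    have h2 : findRep ds r₀ gs s.1 b ≠ [] := List.ne_nil_of_mem
      ((mem_findRep h0 hpos hb hT.length_of_mem le_rfl).2 ⟨t, u, hu, rfl, by rw [← hy, h1]⟩)
    have h3 : lift ds (r₀ :: gs) s.1 b ∈ findRep ds r₀ gs s.1 b := by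
      rw [lift, List.headD_cons, List.tail_cons]
      obtain ⟨c, l, hc⟩ := List.exists_cons_of_ne_nil h2
      rw [hc]; simp
    obtain ⟨t', u', hu', h4, h5⟩ := (mem_findRep h0 hpos hb hT.length_of_mem le_rfl).1 h3
    rw [show σ.b = fun i : Fin (gs.length + 1) => (lift ds (r₀ :: gs) s.1 b).getD i 0 from funext hB, h4, h5, rsum_eq]
    exact comb_gens (fun i => (t' :: u').getD i 0)

end DeltaSimplex

namespace DeltaSimplex
open Matrix DeltaSimplex.System

section
variable {G : Type*} [AddCommGroup G] {n : ℕ}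

/-- Combinations with nonnegative coefficients. -/
def InSemigroup (g : Fin (n + 1) → G) (z : G) : Prop := ∃ y : Fin (n + 1) → ℤ, (∀ i, 0 ≤ y i) ∧ comb g y = z

/-- The group-theoretic form of the lattice condition. -/
def LatticeCond (g : Fin (n + 1) → G) (β : G) : Prop :=
  (∀ i, ∃ t : ℤ, t • g i = β) ∧ ∀ y : Fin (n + 1) → ℤ, (∀ i, 0 ≤ y i) → comb g y = β → ∃ i, ∀ j, j ≠ i → y j = 0

theorem InSemigroup.zero (g : Fin (n + 1) → G) : InSemigroup g 0 := ⟨0, fun _ => le_rfl, map_zero _⟩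

theorem comb_single (g : Fin (n + 1) → G) (i : Fin (n + 1)) : comb g (Pi.single i 1) = g i := by
  rw [Fintype.linearCombination_apply_single, one_smul]

theorem single_nonneg (i j : Fin (n + 1)) : (0 : ℤ) ≤ (Pi.single i 1 : Fin (n + 1) → ℤ) j := by
  rw [Pi.single_apply]; split_ifs <;> norm_num

theorem InSemigroup.add_gen {g : Fin (n + 1) → G} {z : G} {i : Fin (n + 1)} (h : InSemigroup g (z - g i)) : InSemigroup g z := by
  obtain ⟨y, hy, hz⟩ := h
  refine ⟨y + Pi.single i 1, fun j => add_nonneg (hy j) (single_nonneg i j), ?_⟩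
  rw [map_add, hz, comb_single, sub_add_cancel]

theorem sub_single_nonneg {y : Fin (n + 1) → ℤ} (hy : ∀ i, 0 ≤ y i) {i : Fin (n + 1)} (hi : y i ≠ 0) (j : Fin (n + 1)) :
    0 ≤ (y - Pi.single i 1 : Fin (n + 1) → ℤ) j := by
  have h1 := hy j
  rw [Pi.sub_apply, Pi.single_apply]
  split_ifs with h
  · subst h; omega
  · omega

theorem InSemigroup.cases {g : Fin (n + 1) → G} {z : G} (h : InSemigroup g z) : z = 0 ∨ ∃ i, InSemigroup g (z - g i) := by
  obtain ⟨y, hy, rfl⟩ := h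
  by_cases h0 : y = 0
  · exact .inl (by rw [h0, map_zero])
  · obtain ⟨i, hi⟩ := Function.ne_iff.1 h0
    refine .inr ⟨i, y - Pi.single i 1, sub_single_nonneg hy hi, ?_⟩
    rw [map_sub, comb_single]

theorem support_iff {g : Fin (n + 1) → G} {β : G} :
    (∀ y : Fin (n + 1) → ℤ, (∀ i, 0 ≤ y i) → comb g y = β → ∃ i, ∀ j, j ≠ i → y j = 0) ↔
      ∀ i j, i ≠ j → ¬ InSemigroup g (β - g i - g j) := by
  constructor
  · rintro H i j hij ⟨y, hy, hz⟩
    obtain ⟨k, hk⟩ := H (y + Pi.single i 1 + Pi.single j 1)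
      (fun l => add_nonneg (add_nonneg (hy l) (single_nonneg i l)) (single_nonneg j l)) (by
      rw [map_add, map_add, hz, comb_single, comb_single]; abel)
    have pos : ∀ l, l = i ∨ l = j → k = l := by
      intro l hl
      by_contra hlk
      have h1 := hk l (Ne.symm hlk)
      have h2 := hy l
      have h3 := single_nonneg i l
      have h4 := single_nonneg j l
      simp only [Pi.add_apply] at h1
      rcases hl with rfl | rfl
      · rw [Pi.single_eq_same] at h1; omega
      · rw [Pi.single_eq_same (i := l)] at h1; omega
    exact hij ((pos i (.inl rfl)).symm.trans (pos j (.inr rfl)))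
  · intro H y hy hz
    by_contra! hne
    obtain ⟨i, -, hi⟩ := hne 0
    obtain ⟨j, hji, hj⟩ := hne i
    refine H i j (Ne.symm hji) ⟨y - Pi.single i 1 - Pi.single j 1, ?_, ?_⟩
    · refine sub_single_nonneg (sub_single_nonneg hy hi) ?_
      rw [Pi.sub_apply, Pi.single_eq_of_ne hji, sub_zero]
      exact hj
    · rw [map_sub, map_sub, hz, comb_single, comb_single]

end

section
variable {F : Type*} [AddCommGroup F] {n : ℕ} {g : Fin (n + 1) → ℤ × F} {β : ℤ × F}

theorem fst_comb (g : Fin (n + 1) → ℤ × F) (y : Fin (n + 1) → ℤ) : (comb g y).1 = ∑ i, y i * (g i).1 := by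
  rw [Fintype.linearCombination_apply, Prod.fst_sum]; rfl

theorem InSemigroup.fst_nonneg (hg : ∀ i, 0 < (g i).1) {z : ℤ × F} (h : InSemigroup g z) : 0 ≤ z.1 := by
  obtain ⟨y, hy, rfl⟩ := h
  rw [fst_comb]
  exact Finset.sum_nonneg fun i _ => mul_nonneg (hy i) (hg i).le

/-- Generators have proportional multiples. -/
theorem smul_card [Finite F] (x y : ℤ × F) : (x.1 * Nat.card F) • y = (y.1 * Nat.card F) • x := by
  have h : ∀ (a : ℤ) (f : F), (a * Nat.card F) • f = 0 := fun a f => by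
    rw [mul_smul, natCast_zsmul, card_nsmul_eq_zero', smul_zero]
  ext
  · simp only [Prod.smul_fst, smul_eq_mul]; ring
  · rw [Prod.smul_snd, Prod.smul_snd, h, h]

/-- Right-hand sides of empty simplices are bounded. -/
theorem fst_le_of_not_inSemigroup [Finite F] {Δ : ℕ} (hg : ∀ i, 0 < (g i).1) (hΔ : ∀ i, (g i).1 * Nat.card F ≤ Δ)
    (hs : Function.Surjective (comb g)) (h : ¬ InSemigroup g β) : β.1 ≤ n * Δ * Δ := by
  obtain ⟨z, hz⟩ := hs β
  have hc : (1 : ℤ) ≤ Nat.card F := by exact_mod_cast Nat.card_pos (α := F)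
  set m : ℤ := (g 0).1 * Nat.card F with hm
  have hm0 : 0 < m := mul_pos (hg 0) (by omega)
  by_contra! hlt
  -- reduce all coefficients but the first
  let y : Fin (n + 1) → ℤ := Fin.cons (z 0 + ∑ j : Fin n, (z j.succ / m) * ((g j.succ).1 * Nat.card F)) fun j => z j.succ % m
  have hy : comb g y = β := by
    rw [← hz]
    simp only [Fintype.linearCombination_apply, Fin.sum_univ_succ, y, Fin.cons_zero, Fin.cons_succ, add_smul, Finset.sum_smul]
    rw [add_assoc, ← Finset.sum_add_distrib]
    congr 1
    refine Finset.sum_congr rfl fun j _ => ?_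
    rw [mul_smul, ← smul_card (g 0) (g j.succ), ← hm, ← mul_smul, ← add_smul, mul_comm, Int.mul_ediv_add_emod]
  refine h ⟨y, fun i => ?_, hy⟩
  induction i using Fin.cases with
  | succ j => exact Int.emod_nonneg _ hm0.ne'
  | zero =>
    have h1 : β.1 = y 0 * (g 0).1 + ∑ j : Fin n, y j.succ * (g j.succ).1 := by
      rw [← hy, fst_comb, Fin.sum_univ_succ]
    have h2 : ∑ j : Fin n, y j.succ * (g j.succ).1 ≤ ∑ j : Fin n, (Δ : ℤ) * Δ := by
      refine Finset.sum_le_sum fun j _ => ?_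
      have e1 : y j.succ = z j.succ % m := rfl
      have e2 := Int.emod_lt_of_pos (z j.succ) hm0
      have e3 : (g j.succ).1 ≤ Δ := le_trans (le_mul_of_one_le_right (hg _).le hc) (hΔ _)
      have e4 := hΔ 0
      rw [← hm] at e4
      rw [e1]
      exact mul_le_mul (by omega) e3 (hg _).le (by omega)
    rw [Finset.sum_const, Finset.card_univ, Fintype.card_fin, nsmul_eq_mul, ← mul_assoc] at h2
    have h3 : 0 < y 0 * (g 0).1 := by linarith
    exact (pos_of_mul_pos_left h3 (hg 0).le).le

/-- Right-hand sides of empty lattice-simplices are bounded. -/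
theorem fst_le_of_latticeCond [Finite F] {Δ : ℕ} (hn : 1 ≤ n) (hg : ∀ i, 0 < (g i).1) (hΔ : ∀ i, (g i).1 * Nat.card F ≤ Δ)
    (h : LatticeCond g β) : β.1 ≤ n * Δ * Δ := by
  have hc : (1 : ℤ) ≤ Nat.card F := by exact_mod_cast Nat.card_pos (α := F)
  obtain ⟨m, rfl⟩ : ∃ m, n = m + 1 := ⟨n - 1, by omega⟩
  obtain ⟨t, ht⟩ := h.1 0
  have h1 : t ≤ (g 1).1 * Nat.card F := by
    by_contra! hlt
    have hp : 0 < (g 0).1 * Nat.card F := mul_pos (hg 0) (by omega)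
    obtain ⟨i, hi⟩ := h.2 (Pi.single 0 (t - (g 1).1 * Nat.card F) + Pi.single 1 ((g 0).1 * Nat.card F)) (fun i => by
      rw [Pi.add_apply, Pi.single_apply, Pi.single_apply]
      split_ifs <;> omega) (by
      rw [map_add, Fintype.linearCombination_apply_single, Fintype.linearCombination_apply_single, smul_card (g 0) (g 1),
        ← add_smul, sub_add_cancel, ht])
    by_cases h0 : i = 0
    · have h3 := hi 1 (by rw [h0]; simp)
      simp only [Pi.add_apply, Pi.single_eq_same, Pi.single_eq_of_ne (show (1 : Fin (m + 2)) ≠ 0 by simp), zero_add] at h3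
      omega
    · have h3 := hi 0 (Ne.symm h0)
      simp only [Pi.add_apply, Pi.single_eq_same, Pi.single_eq_of_ne (show (0 : Fin (m + 2)) ≠ 1 by simp), add_zero] at h3
      omega
  have h2 : β.1 = t * (g 0).1 := by rw [← ht]; rfl
  have h3 : (g 0).1 ≤ Δ := le_trans (le_mul_of_one_le_right (hg _).le hc) (hΔ _)
  have h4 : t * (g 0).1 ≤ Δ * Δ := mul_le_mul (h1.trans (hΔ 1)) h3 (hg 0).le (by omega)
  rw [h2]
  refine h4.trans ?_
  rw [mul_assoc]
  exact le_mul_of_one_le_left (by positivity) (by exact_mod_cast hn)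

end

/-! ### The tests -/

variable {ds : List ℤ} {Δ n : ℕ} {rows : List El}

theorem gens_eq (hl : rows.length = n + 1) (i : Fin (n + 1)) : gens ds n rows i = tg ds (rows[i.1]'(i.2.trans_eq hl.symm)) := by
  rw [gens, rowsTg, List.getD_eq_getElem _ _ (i.2.trans_eq hl.symm)]

theorem exists_gens_eq (hl : rows.length = n + 1) {x : El} (hx : x ∈ rows) : ∃ i, gens ds n rows i = tg ds x := by
  obtain ⟨j, hj, rfl⟩ := List.mem_iff_getElem.1 hx
  exact ⟨⟨j, hj.trans_eq hl⟩, gens_eq hl _⟩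

theorem IsRows.gens_pos (h : IsRows ds Δ rows) (hl : rows.length = n + 1) (i : Fin (n + 1)) : 0 < (gens ds n rows i).1 := by
  rw [gens_eq hl]; exact h.pos _ (List.getElem_mem _)

theorem IsRows.gens_bound (h : IsRows ds Δ rows) (hl : rows.length = n + 1) (i : Fin (n + 1)) :
    (gens ds n rows i).1 * Nat.card (FinPart ds) ≤ Δ := by
  rw [gens_eq hl]; exact h.bound _ (List.getElem_mem _)

theorem reach_succ (acells : List El) (k : ℕ) :
    reach ds acells rows (rangeZ (k + 1)) = reachStep ds acells rows (reach ds acells rows (rangeZ k)) := by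
  simp [reach, rangeZ, List.range_succ]

theorem IsRows.mem_reach (h : IsRows ds Δ rows) (hl : rows.length = n + 1) (hΔ : ∀ q ∈ ds, q ≤ Δ) {B : ℕ} {x : El} (hx : Ok ds x)
    (hB : x.1 ≤ B) :
    El.memG ds (reach ds (cellsOf (rangeZ (B + 1)) (elems (rangeZ Δ) ds)) rows (rangeZ (B + 1))) x = true ↔
      InSemigroup (gens ds n rows) (tg ds x) := by
  set acells := cellsOf (rangeZ (B + 1)) (elems (rangeZ Δ) ds) with ha
  have hcell : ∀ c ∈ acells, IsCell ds c := fun c hc => ((mem_cellsOf hΔ).1 hc).2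
  have hsub : ∀ k, ∀ c ∈ reach ds acells rows (rangeZ k), c ∈ acells := by
    intro k c hc
    rcases k with _ | k
    · simp [reach, rangeZ] at hc
    · rw [reach_succ, reachStep] at hc; exact List.mem_of_mem_filter hc
  have hok : ∀ k, ∀ c ∈ reach ds acells rows (rangeZ k), Ok ds c := fun k c hc => (hcell c (hsub k c hc)).ok
  have sound : ∀ k, ∀ c ∈ reach ds acells rows (rangeZ k), InSemigroup (gens ds n rows) (tg ds c) := by
    intro k
    induction k with
    | zero => simp [reach, rangeZ]
    | succ k ih =>
      intro c hc
      have hco := (hcell c (hsub (k + 1) c hc)).ok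
      rw [reach_succ, reachStep, List.mem_filter, Bool.or_eq_true, isZ_iff hco, List.any_eq_true] at hc
      obtain ⟨hc, h0 | ⟨g, hg, hm⟩⟩ := hc
      · rw [h0]; exact InSemigroup.zero _
      · rw [memG_iff (hok k) (ok_sub hco (h.ok g hg)), tg_sub hco (h.ok g hg)] at hm
        obtain ⟨y, hy, hcy⟩ := hm
        obtain ⟨i, hi⟩ := exists_gens_eq (ds := ds) hl hg
        refine InSemigroup.add_gen (i := i) ?_
        rw [hi, hcy]
        exact ih y hy
  have complete : ∀ k : ℕ, ∀ c ∈ acells, InSemigroup (gens ds n rows) (tg ds c) → c.1 < k → c ∈ reach ds acells rows (rangeZ k) := by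
    intro k
    induction k with
    | zero =>
      intro c hc _ hlt
      have := (mem_rangeZ.1 ((mem_cellsOf hΔ).1 hc).1).1
      push_cast at hlt; omega
    | succ k ih =>
      intro c hc hs hlt
      have hco := (hcell c hc).ok
      rw [reach_succ, reachStep, List.mem_filter, Bool.or_eq_true, isZ_iff hco, List.any_eq_true]
      refine ⟨hc, hs.cases.imp id ?_⟩
      rintro ⟨i, hi⟩
      have hg : rows[i.1]'(i.2.trans_eq hl.symm) ∈ rows := List.getElem_mem _
      refine ⟨_, hg, ?_⟩
      rw [memG_iff (hok k) (ok_sub hco (h.ok _ hg)), tg_sub hco (h.ok _ hg), ← gens_eq hl]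
      have h1 := hi.fst_nonneg (h.gens_pos hl)
      have h2 := h.gens_pos hl i
      have h3 : (tg ds c - gens ds n rows i).1 = c.1 - (gens ds n rows i).1 := rfl
      have h4 := mem_rangeZ.1 ((mem_cellsOf hΔ).1 hc).1
      refine ⟨rep ds (tg ds c - gens ds n rows i), ih _ ?_ (by rwa [tg_rep h.valid]) ?_, (tg_rep h.valid _).symm⟩
      · refine (mem_cellsOf hΔ).2 ⟨mem_rangeZ.2 ?_, isCell_rep h.valid _⟩
        change 0 ≤ (tg ds c - gens ds n rows i).1 ∧ (tg ds c - gens ds n rows i).1 < _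
        omega
      · change (tg ds c - gens ds n rows i).1 < _
        push_cast at hlt; omega
  rw [memG_iff (hok _) hx]
  constructor
  · rintro ⟨y, hy, hxy⟩; rw [hxy]; exact sound _ y hy
  · intro hs
    have h1 := hs.fst_nonneg (h.gens_pos hl)
    have h2 : (tg ds x).1 = x.1 := rfl
    refine ⟨rep ds (tg ds x), complete _ _ ?_ (by rwa [tg_rep h.valid]) ?_, (tg_rep h.valid _).symm⟩
    · refine (mem_cellsOf hΔ).2 ⟨mem_rangeZ.2 ?_, isCell_rep h.valid _⟩
      change 0 ≤ (tg ds x).1 ∧ (tg ds x).1 < _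
      push_cast; omega
    · change (tg ds x).1 < _
      push_cast; omega

theorem IsRows.emptyTest_iff (h : IsRows ds Δ rows) (hl : rows.length = n + 1) (hΔ : ∀ q ∈ ds, q ≤ Δ) {B : ℕ} {b : El}
    (hb : Ok ds b) (hB : b.1 ≤ B) :
    emptyTest ds (reach ds (cellsOf (rangeZ (B + 1)) (elems (rangeZ Δ) ds)) rows (rangeZ (B + 1))) b = true ↔
      ¬ InSemigroup (gens ds n rows) (tg ds b) := by
  rw [← h.mem_reach hl hΔ hb hB, emptyTest]
  simp

theorem forall_zip_idx {β : Type} {l : List β} {p : ℤ × β → Prop} :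
    (∀ q ∈ (idx l).zip l, p q) ↔ ∀ (i : ℕ) (hi : i < l.length), p (i, l[i]) := by
  constructor
  · intro H i hi
    exact H _ (List.mem_iff_getElem.2 ⟨i, by simp [idx, hi], by simp [idx]⟩)
  · intro H q hq
    obtain ⟨i, hi, rfl⟩ := List.mem_iff_getElem.1 hq
    have hi' : i < l.length := by simp [idx] at hi; exact hi
    simpa [idx] using H i hi'

theorem IsRows.latticeTest_iff (h : IsRows ds Δ rows) (hl : rows.length = n + 1) (hΔ : ∀ q ∈ ds, q ≤ Δ) {B : ℕ} {b : El}
    (hb : Ok ds b) (hB : b.1 ≤ B) :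
    latticeTest ds rows (reach ds (cellsOf (rangeZ (B + 1)) (elems (rangeZ Δ) ds)) rows (rangeZ (B + 1))) b = true ↔
      LatticeCond (gens ds n rows) (tg ds b) := by
  rw [latticeTest, Bool.and_eq_true, List.all_eq_true, LatticeCond, support_iff]
  refine and_congr ?_ ?_
  · have key : ∀ g ∈ rows, vertexTest ds b g = true ↔ ∃ t : ℤ, t • tg ds g = tg ds b := by
      intro g hg
      rw [vertexTest, eqG_iff hb (ok_smul _ (h.ok g hg)), tg_smul]
      constructor
      · exact fun h1 => ⟨_, h1.symm⟩
      · rintro ⟨t, ht⟩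
        have h1 : b.1 = t * g.1 := (congrArg Prod.fst ht).symm
        rw [h1, Int.mul_ediv_cancel _ (h.pos g hg).ne', ht]
    constructor
    · intro H i
      have hg : rows[i.1]'(i.2.trans_eq hl.symm) ∈ rows := List.getElem_mem _
      rw [gens_eq hl]
      exact (key _ hg).1 (H _ hg)
    · intro H g hg
      obtain ⟨i, hi⟩ := exists_gens_eq (ds := ds) hl hg
      rw [key g hg, ← hi]
      exact H i
  · rw [List.all_eq_true, forall_zip_idx]
    have key : ∀ (i : ℕ) (hi : i < rows.length) (j : ℕ) (hj : j < rows.length),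
        pairTest ds (reach ds (cellsOf (rangeZ (B + 1)) (elems (rangeZ Δ) ds)) rows (rangeZ (B + 1))) b (i, rows[i]) (j, rows[j]) = true ↔
        (i ≠ j → ¬ InSemigroup (gens ds n rows) (tg ds b - tg ds rows[i] - tg ds rows[j])) := by
      intro i hi j hj
      have o1 := h.ok _ (List.getElem_mem hi)
      have o2 := h.ok _ (List.getElem_mem hj)
      have p1 := h.pos _ (List.getElem_mem hi)
      have p2 := h.pos _ (List.getElem_mem hj)
      rw [← tg_sub hb o1, ← tg_sub (ok_sub hb o1) o2, ← h.mem_reach hl hΔ (B := B) (ok_sub (ok_sub hb o1) o2) (by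
        change b.1 - rows[i].1 - rows[j].1 ≤ _
        omega), pairTest, Bool.or_eq_true, eqb_eq_true]
      simp only [Nat.cast_inj, Bool.not_eq_true', Bool.not_eq_true]
      tauto
    constructor
    · intro H i j hij
      have h1 := H i (i.2.trans_eq hl.symm)
      rw [List.all_eq_true, forall_zip_idx] at h1
      rw [gens_eq hl, gens_eq hl]
      exact (key i (i.2.trans_eq hl.symm) j (j.2.trans_eq hl.symm)).1 (h1 j (j.2.trans_eq hl.symm)) fun h => hij (Fin.ext h)
    · intro H i hi
      rw [List.all_eq_true, forall_zip_idx]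
      intro j hj
      rw [key i hi j hj]
      intro hij
      have := H ⟨i, hi.trans_eq hl⟩ ⟨j, hj.trans_eq hl⟩ (by simpa using hij)
      rwa [gens_eq hl, gens_eq hl] at this

end DeltaSimplex

namespace DeltaSimplex

/-! ### The list of groups is complete -/

theorem length_elems_cons {Δ : ℕ} {q : ℤ} {ds : List ℤ} (h0 : 0 ≤ q) (hq : q ≤ Δ) :
    (elems (rangeZ Δ) (q :: ds)).length = q.toNat * (elems (rangeZ Δ) ds).length := by
  have e : (rangeZ Δ).filter (fun r => ltb r q) = rangeZ q.toNat :=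
    filter_rangeZ (by omega) _ fun i _ => by rw [ltb_eq_true]; omega
  simp only [elems, extendElems, e, List.length_flatMap, List.length_map, List.map_const', List.sum_replicate, length_rangeZ,
    smul_eq_mul]

theorem Valid.le_of_card {ds : List ℤ} (h : Valid ds) {Δ : ℕ} (hc : Nat.card (FinPart ds) ≤ Δ) : ∀ q ∈ ds, q ≤ Δ := by
  have := h.finite
  have hpos : 0 < Nat.card (FinPart ds) := Nat.card_pos
  intro q hq
  obtain ⟨i, hi, rfl⟩ := List.mem_iff_getElem.1 hq
  rw [Nat.card_pi] at hc hpos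
  simp only [Nat.card_zmod] at hc hpos
  have h1 := Nat.le_of_dvd hpos (Finset.dvd_prod_of_mem (fun i : Fin ds.length => (ds[i]).natAbs) (Finset.mem_univ ⟨i, hi⟩))
  have h2 : ((ds[(⟨i, hi⟩ : Fin ds.length)]).natAbs : ℤ) = |ds[i]| := Int.natCast_natAbs _
  have h3 := le_abs_self ds[i]
  simp only [Fin.getElem_fin] at h1 h2 hc
  omega

theorem two_pow_le_length_elems {Δ : ℕ} {ds : List ℤ} (h : Valid ds) (hq : ∀ q ∈ ds, q ≤ Δ) :
    2 ^ ds.length ≤ (elems (rangeZ Δ) ds).length := by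
  induction ds with
  | nil => simp [elems]
  | cons q ds ih =>
    have h2 := h q (by simp)
    rw [length_elems_cons (by omega) (hq q (by simp)), List.length_cons, pow_succ, mul_comm]
    exact Nat.mul_le_mul (by omega) (ih (fun r hr => h r (by simp [hr])) fun r hr => hq r (by simp [hr]))

theorem mem_groups_of_length {Δ : ℕ} {ds : List ℤ} (h : Valid ds) (hq : ∀ q ∈ ds, q ≤ Δ)
    (hc : (elems (rangeZ Δ) ds).length ≤ Δ) {i : ℕ} (hi : ds.length ≤ i) : (ds, elems (rangeZ Δ) ds) ∈ groups Δ i := by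
  induction ds generalizing i with
  | nil =>
    rcases i with _ | i
    · simp [groups, elems]
    · simp [groups_succ, groupsStep, elems]
  | cons q ds ih =>
    obtain ⟨i, rfl⟩ : ∃ j, i = j + 1 := ⟨i - 1, by simp at hi; omega⟩
    have h2 := h q (by simp)
    have hqΔ := hq q (by simp)
    rw [length_elems_cons (by omega) hqΔ] at hc
    have h3 : (elems (rangeZ Δ) ds).length ≤ Δ := (Nat.le_mul_of_pos_left _ (by omega)).trans hc
    rw [groups_succ, groupsStep, List.mem_cons]
    right
    rw [List.mem_flatMap]
    refine ⟨_, ih (fun r hr => h r (by simp [hr])) (fun r hr => hq r (by simp [hr])) h3 (by simpa using hi), ?_⟩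
    rw [List.mem_flatMap]
    refine ⟨q, mem_range2.2 ⟨h2, hqΔ⟩, ?_⟩
    have h4 : leb (q * ((elems (rangeZ Δ) ds).length : ℤ)) (rangeZ Δ).length = true := by
      rw [leb_eq_true, length_rangeZ]
      have : (q.toNat : ℤ) = q := Int.toNat_of_nonneg (by omega)
      rw [← this]
      exact_mod_cast hc
    simp [extendGroup, h4, elems]

theorem mem_groups {Δ : ℕ} {ds : List ℤ} (h : Valid ds) (hc : Nat.card (FinPart ds) ≤ Δ) :
    (ds, elems (rangeZ Δ) ds) ∈ groups Δ (Nat.log 2 Δ) := by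
  have hq := h.le_of_card hc
  rw [card_finPart h hq] at hc
  refine mem_groups_of_length h hq hc ?_
  exact Nat.le_log_of_pow_le (by norm_num) ((two_pow_le_length_elems h hq).trans hc)

theorem of_mem_groups_log {Δ : ℕ} (hΔ : 1 ≤ Δ) {g : Fin0} (hg : g ∈ groups Δ (Nat.log 2 Δ)) :
    Valid g.1 ∧ (∀ q ∈ g.1, q ≤ Δ) ∧ g.2 = elems (rangeZ Δ) g.1 ∧ Nat.card (FinPart g.1) ≤ Δ := by
  obtain ⟨-, h2, h3, h4⟩ := of_mem_groups hΔ hg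
  have hv : Valid g.1 := fun q hq => (mem_range2.1 (h2 q hq)).1
  have hq : ∀ q ∈ g.1, q ≤ Δ := fun q hq => (mem_range2.1 (h2 q hq)).2
  exact ⟨hv, hq, h3, by rw [card_finPart hv hq, ← h3]; exact h4⟩

theorem nodup_groups (Δ i : ℕ) : ((groups Δ i).map Prod.fst).Nodup := by
  induction i with
  | zero => simp [groups]
  | succ i ih =>
    have hmem : ∀ (g x : Fin0) (q : ℤ), x ∈ extendGroup (rangeZ Δ) g q → x.1 = q :: g.1 := by
      intro g x q hx
      unfold extendGroup at hx
      rcases hb : leb (q * (g.2.length : ℤ)) (rangeZ Δ).length with _ | _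
      · simp [hb] at hx
      · simp only [hb, cond_true, List.mem_singleton] at hx
        rw [hx]
    rw [groups_succ, groupsStep, List.map_cons, List.nodup_cons]
    constructor
    · simp only [List.mem_map, List.mem_flatMap, not_exists, not_and]
      rintro x ⟨g, -, q, -, hx⟩ h0
      rw [hmem g x q hx] at h0
      exact List.cons_ne_nil _ _ h0
    · rw [List.map_flatMap, List.nodup_flatMap]
      constructor
      · intro g _
        rw [List.map_flatMap, List.nodup_flatMap]
        constructor
        · intro q _
          unfold extendGroup
          rcases leb (q * (g.2.length : ℤ)) (rangeZ Δ).length <;> simp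
        · refine (((pairwise_range1 Δ).imp fun h => h.ne).filter _).imp fun {a b} hab x hx hy => hab ?_
          obtain ⟨u, hu, rfl⟩ := List.mem_map.1 hx
          obtain ⟨v, hv, h⟩ := List.mem_map.1 hy
          rw [hmem _ _ _ hu, hmem _ _ _ hv] at h
          exact (List.cons.inj h).1.symm
      · refine (List.pairwise_map.1 ih).imp fun {a b} hab x hx hy => hab ?_
        beta_reduce at hx hy
        rw [List.map_flatMap, List.mem_flatMap] at hx hy
        obtain ⟨q, -, hx⟩ := hx
        obtain ⟨q', -, hy⟩ := hy
        obtain ⟨u, hu, rfl⟩ := List.mem_map.1 hx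
        obtain ⟨v, hv, h⟩ := List.mem_map.1 hy
        rw [hmem _ _ _ hu, hmem _ _ _ hv] at h
        exact (List.cons.inj h).2.symm

/-! ### Isomorphisms between the groups -/

/-- Isomorphisms that preserve the heights. -/
def IsHeight {ds ds' : List ℤ} (e : Grid ds' ≃+ Grid ds) : Prop := ∀ z, (e z).1 = z.1

/-- The tuple describes the isomorphism. -/
def Describes {ds ds' : List ℤ} (X : List El) (e : Grid ds' ≃+ Grid ds) : Prop :=
  ∀ c, IsCell ds' c → tg ds (El.lin ds (c.1 :: c.2) X) = e (tg ds' c)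

theorem IsHeight.symm {ds ds' : List ℤ} {e : Grid ds' ≃+ Grid ds} (h : IsHeight e) : IsHeight e.symm := fun z => by
  rw [← h, e.apply_symm_apply]

variable {ds ds' : List ℤ}

theorem tg_eq_sum (c : El) : tg ds c = c.1 • (1, 0) + ∑ i : Fin ds.length, c.2.getD i 0 • ((0, Pi.single i 1) : Grid ds) := by
  refine Prod.ext ?_ (funext fun j => ?_)
  · rw [Prod.fst_add, Prod.fst_sum]; simp [tg]
  · rw [Prod.snd_add, Prod.snd_sum, Pi.add_apply, Finset.sum_apply, Finset.sum_eq_single j]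
    · simp [tg]
    · intro i _ hij
      simp [hij.symm]
    · simp

theorem tg_lin_cons {c : El} {X : List El} (hc : IsCell ds' c) (hX : X.length = ds'.length + 1) :
    tg ds (El.lin ds (c.1 :: c.2) X) = c.1 • tg ds (X.getD 0 (0, [])) +
      ∑ i : Fin ds'.length, c.2.getD i 0 • tg ds (X.getD (i + 1) (0, [])) := by
  have h1 : (c.1 :: c.2).length = ds'.length + 1 := by rw [List.length_cons, hc.ok]
  rw [tg_lin (m := ds'.length + 1) (by omega) h1.le, Finset.sum_range_succ', add_comm, Finset.sum_range]
  rfl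

theorem IsHeight.card_eq {e : Grid ds' ≃+ Grid ds} (h : IsHeight e) : Nat.card (FinPart ds') = Nat.card (FinPart ds) := by
  have h1 : ∀ f, e (0, f) = (0, (e (0, f)).2) := fun f => Prod.ext (h _) rfl
  have h2 : ∀ f, e.symm (0, f) = (0, (e.symm (0, f)).2) := fun f => Prod.ext (h.symm _) rfl
  refine Nat.card_congr ⟨fun f => (e (0, f)).2, fun f => (e.symm (0, f)).2, fun f => ?_, fun f => ?_⟩
  · simp only; rw [← h1, e.symm_apply_apply]
  · simp only; rw [← h2, e.apply_symm_apply]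

theorem exists_equiv_of_isIso {Δ : ℕ} (hds : Valid ds) (hds' : Valid ds') (hq : ∀ q ∈ ds, q ≤ Δ) (hq' : ∀ q ∈ ds', q ≤ Δ)
    {X : List El} (hX : ∀ x ∈ X, Ok ds x) (h : isIso (ds, elems (rangeZ Δ) ds) (ds', elems (rangeZ Δ) ds') X = true) :
    ∃ e : Grid ds' ≃+ Grid ds, IsHeight e ∧ Describes X e := by
  simp only [isIso, Bool.and_eq_true, eqb_eq_true, isHom, isInj, List.all_eq_true] at h
  obtain ⟨⟨hlen, hhead⟩, hcard, hhom, hinj⟩ := h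
  have hlen : X.length = ds'.length + 1 := by exact_mod_cast hlen
  have := hds.finite
  have := hds'.finite
  have htors : ∀ i : Fin ds'.length, (((ds'[i]).natAbs : ℕ) : ℤ) • tg ds (X.getD (i + 1) (0, [])) = 0 := by
    intro i
    have h1 : (i : ℕ) + 1 < X.length := by omega
    have h2 := hhom (ds'[i], X[(i : ℕ) + 1]) (List.mem_iff_getElem.2 ⟨i, by simp; omega, by simp⟩)
    rw [isZ_iff (ok_smul _ (hX _ (List.getElem_mem h1))), tg_smul] at h2
    rw [List.getD_eq_getElem _ _ h1, Int.natCast_natAbs, abs_of_pos (by have := hds' _ (List.getElem_mem i.2); simp only [Fin.getElem_fin]; omega)]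
    exact h2
  let E : Grid ds' →+ Grid ds := (zmultiplesHom (Grid ds) (tg ds (X.getD 0 (0, [])))).comp (AddMonoidHom.fst ℤ (FinPart ds')) +
    ∑ i : Fin ds'.length, ((ZMod.lift (ds'[i]).natAbs ⟨zmultiplesHom (Grid ds) (tg ds (X.getD (i + 1) (0, []))), by
      simpa using htors i⟩).comp (Pi.evalAddMonoidHom _ i)).comp (AddMonoidHom.snd ℤ (FinPart ds'))
  have hE : ∀ c, IsCell ds' c → tg ds (El.lin ds (c.1 :: c.2) X) = E (tg ds' c) := by
    intro c hc
    rw [tg_lin_cons hc hlen]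
    simp only [E, AddMonoidHom.add_apply, AddMonoidHom.coe_comp, Function.comp_apply, AddMonoidHom.coe_fst, zmultiplesHom_apply,
      AddMonoidHom.finsetSum_apply, AddMonoidHom.coe_snd, Pi.evalAddMonoidHom_apply]
    congr 1
    refine Finset.sum_congr rfl fun i _ => ?_
    change _ = ZMod.lift (ds'[i]).natAbs _ ((c.2.getD i 0 : ℤ) : ZMod (ds'[i]).natAbs)
    rw [ZMod.lift_coe, zmultiplesHom_apply]
  have hht : ∀ z, (E z).1 = z.1 := by
    intro z
    have h1 := hom_apply ((AddMonoidHom.fst ℤ (FinPart ds)).comp E) z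
    have h2 : E (1, 0) = tg ds (X.getD 0 (0, [])) := by simp [E]
    have h3 : (X.getD 0 (0, [])).1 = 1 := by
      rcases X with _ | ⟨x, X⟩
      · simp at hlen
      · exact hhead
    simp only [AddMonoidHom.comp_apply, h2] at h1
    change (E z).1 = z.1 * (X.getD 0 (0, [])).1 at h1
    rw [h1, h3, mul_one]
  have hEinj : Function.Injective E := by
    rw [injective_iff_map_eq_zero]
    intro z hz
    have h1 : z.1 = 0 := by rw [← hht, hz]; rfl
    have hc := isCell_rep hds' z
    have h2 : rep ds' z = (0, (rep ds' z).2) := Prod.ext h1 rfl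
    have h3 := hE _ hc
    rw [tg_rep hds', hz] at h3
    have h4 := hinj (rep ds' z).2 ((mem_elems hq').2 hc)
    rw [Bool.or_eq_true] at h4
    have h5 : El.isZ ds (El.lin ds (0 :: (rep ds' z).2) X) = true := by
      rw [isZ_iff (ok_lin _ _), ← h3, ← h1]; rfl
    rw [h5] at h4
    have h6 : El.isZ ds' (0, (rep ds' z).2) = true := by simpa using h4
    rw [← h2, isZ_iff hc.ok, tg_rep hds'] at h6
    exact h6
  have hfin : Function.Bijective fun f : FinPart ds' => (E (0, f)).2 := by
    have h1 : Nat.card (FinPart ds') = Nat.card (FinPart ds) := by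
      rw [card_finPart hds hq, card_finPart hds' hq']; exact_mod_cast hcard.symm
    refine (Nat.bijective_iff_injective_and_card _).2 ⟨fun f f' hff => ?_, h1⟩
    have h2 : E (0, f) = E (0, f') := Prod.ext (by rw [hht, hht]) hff
    exact congrArg Prod.snd (hEinj h2)
  have hEsurj : Function.Surjective E := by
    intro w
    obtain ⟨f, hf⟩ := hfin.2 (w - w.1 • E (1, 0)).2
    refine ⟨w.1 • (1, 0) + (0, f), ?_⟩
    have h1 : E (0, f) = w - w.1 • E (1, 0) := by
      refine Prod.ext ?_ hf
      rw [hht, Prod.fst_sub, Prod.smul_fst, hht]; simp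
    rw [map_add, map_zsmul, h1, add_sub_cancel]
  exact ⟨AddEquiv.ofBijective E ⟨hEinj, hEsurj⟩, hht, hE⟩

theorem exists_isIso {Δ : ℕ} (hds : Valid ds) (hds' : Valid ds') (hq : ∀ q ∈ ds, q ≤ Δ) (hq' : ∀ q ∈ ds', q ≤ Δ)
    {e : Grid ds' ≃+ Grid ds} (he : IsHeight e) :
    ∃ X : List El, X.length = ds'.length + 1 ∧ (∀ x ∈ X, x ∈ cellsOf [0, 1] (elems (rangeZ Δ) ds)) ∧
      isIso (ds, elems (rangeZ Δ) ds) (ds', elems (rangeZ Δ) ds') X = true ∧ Describes X e := by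
  set X := rep ds (e (1, 0)) :: List.ofFn fun i : Fin ds'.length => rep ds (e (0, Pi.single i 1)) with hX
  have hlen : X.length = ds'.length + 1 := by simp [hX]
  have hget : ∀ i : Fin ds'.length, X.getD (i + 1) (0, []) = rep ds (e (0, Pi.single i 1)) := by
    intro i
    rw [hX, List.getD_cons_succ, List.getD_eq_getElem _ _ (by simp)]
    simp
  have hdesc : Describes X e := by
    intro c hc
    rw [tg_lin_cons hc hlen, tg_eq_sum (ds := ds') c, map_add, map_sum, map_zsmul]
    congr 1
    · change c.1 • tg ds (rep ds (e (1, 0))) = _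
      rw [tg_rep hds]
    · exact Finset.sum_congr rfl fun i _ => by rw [hget, tg_rep hds, map_zsmul]
  have hcell : ∀ x ∈ X, x ∈ cellsOf [0, 1] (elems (rangeZ Δ) ds) := by
    intro x hx
    rw [mem_cellsOf hq]
    rcases List.mem_cons.1 hx with rfl | hx
    · refine ⟨?_, isCell_rep hds _⟩
      change (e (1, 0)).1 ∈ _
      rw [he]; simp
    · obtain ⟨i, rfl⟩ := List.mem_ofFn.1 hx
      refine ⟨?_, isCell_rep hds _⟩
      change (e (0, Pi.single i 1)).1 ∈ _
      rw [he]; simp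
  refine ⟨X, hlen, hcell, ?_, hdesc⟩
  simp only [isIso, Bool.and_eq_true, eqb_eq_true, isHom, isInj, List.all_eq_true]
  refine ⟨⟨by exact_mod_cast hlen, ?_⟩, ?_, ?_, ?_⟩
  · change (e (1, 0)).1 = 1
    rw [he]
  · rw [← card_finPart hds hq, ← card_finPart hds' hq', he.card_eq]
  · intro p hp
    obtain ⟨i, hi, rfl⟩ := List.mem_iff_getElem.1 hp
    have hi' : i < ds'.length := by simp at hi; omega
    have h1 : (X.tail)[i]'(by simp [hlen]; omega) = rep ds (e (0, Pi.single ⟨i, hi'⟩ 1)) := by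
      simp [hX]
    rw [List.getElem_zip, h1, isZ_iff (ok_smul _ (isCell_rep hds _).ok), tg_smul, tg_rep hds, ← map_zsmul]
    have h2 : ds'[i] • ((0, Pi.single ⟨i, hi'⟩ 1) : Grid ds') = 0 := by
      refine Prod.ext (by simp) ?_
      rw [Prod.smul_snd, ← Pi.single_smul]
      have : ds'[i] • (1 : ZMod (ds'[(⟨i, hi'⟩ : Fin ds'.length)]).natAbs) = 0 := by
        rw [zsmul_eq_mul, mul_one, ZMod.intCast_zmod_eq_zero_iff_dvd, Int.natAbs_dvd]; rfl
      rw [this]; simp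
    rw [h2, map_zero]
  · intro y hy
    have hc : IsCell ds' (0, y) := (mem_elems hq').1 hy
    have h1 := hdesc (0, y) hc
    rcases hb : El.isZ ds (El.lin ds (0 :: y) X) with _ | _
    · simp
    · rw [isZ_iff (ok_lin _ _)] at hb
      have h2 : e (tg ds' (0, y)) = 0 := h1.symm.trans hb
      rw [map_eq_zero_iff _ e.injective, ← isZ_iff hc.ok] at h2
      simp [h2]

end DeltaSimplex

namespace DeltaSimplex

/-! ### The multisets as sorted lists -/

theorem of_mem_multisets {β : Type} {j : ℕ} {l w : List β} (h : w ∈ multisets j l) : w.length = j ∧ ∀ c ∈ w, c ∈ l := by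
  induction j generalizing l w with
  | zero => simp [multisets] at h; simp [h]
  | succ j ihj =>
    induction l with
    | nil => simp [multisets_nil] at h
    | cons c l ih =>
      rw [multisets_cons, List.mem_append, List.mem_map] at h
      rcases h with ⟨w, hw, rfl⟩ | h
      · obtain ⟨h1, h2⟩ := ihj hw
        exact ⟨by simp [h1], by simpa using h2⟩
      · exact ⟨(ih h).1, fun x hx => List.mem_cons_of_mem _ ((ih h).2 x hx)⟩

theorem exists_perm_multisets {β : Type} {j : ℕ} {l w : List β} (hw : w.length = j) (h : ∀ c ∈ w, c ∈ l) :
    ∃ w' ∈ multisets j l, w'.Perm w := by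
  classical
  induction j generalizing l w with
  | zero => exact ⟨[], by simp [multisets], by rw [List.length_eq_zero_iff.1 hw]⟩
  | succ j ihj =>
    induction l with
    | nil =>
      rcases w with _ | ⟨c, w⟩
      · simp at hw
      · simpa using h c
    | cons c l ih =>
      rw [multisets_cons]
      by_cases hc : c ∈ w
      · obtain ⟨w', h1, h2⟩ := ihj (w := w.erase c) (l := c :: l) (by rw [List.length_erase_of_mem hc]; omega)
          fun x hx => h x (List.mem_of_mem_erase hx)
        exact ⟨c :: w', List.mem_append_left _ (List.mem_map_of_mem h1), (h2.cons c).trans (List.perm_cons_erase hc).symm⟩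
      · obtain ⟨w', h1, h2⟩ := ih fun x hx => (List.mem_cons.1 (h x hx)).resolve_left fun e => hc (e ▸ hx)
        exact ⟨w', List.mem_append_right _ h1, h2⟩

theorem eq_of_perm_multisets {β : Type} {j : ℕ} {l w w' : List β} (hl : l.Nodup) (h : w ∈ multisets j l)
    (h' : w' ∈ multisets j l) (hp : w.Perm w') : w = w' := by
  induction j generalizing l w w' with
  | zero => simp [multisets] at h h'; rw [h, h']
  | succ j ihj =>
    induction l with
    | nil => simp [multisets_nil] at h
    | cons c l ih =>
      have hc := (List.nodup_cons.1 hl).1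
      rw [multisets_cons, List.mem_append, List.mem_map] at h h'
      rcases h with ⟨w, hw, rfl⟩ | h <;> rcases h' with ⟨w', hw', rfl⟩ | h'
      · rw [ihj hl hw hw' hp.cons_inv]
      · exact (hc ((of_mem_multisets h').2 c (hp.subset (by simp)))).elim
      · exact (hc ((of_mem_multisets h).2 c (hp.symm.subset (by simp)))).elim
      · exact ih (List.nodup_cons.1 hl).2 h h'

theorem nodup_multisets {β : Type} (j : ℕ) {l : List β} (hl : l.Nodup) : (multisets j l).Nodup := by
  induction j generalizing l with
  | zero => simp [multisets]
  | succ j ihj =>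
    induction l with
    | nil => simp [multisets_nil]
    | cons c l ih =>
      rw [multisets_cons]
      refine List.Nodup.append ((ihj hl).map (List.cons_injective)) (ih (List.nodup_cons.1 hl).2) ?_
      intro x hx hx'
      obtain ⟨w, -, rfl⟩ := List.mem_map.1 hx
      exact (List.nodup_cons.1 hl).1 ((of_mem_multisets hx').2 c (by simp))

/-! ### The lexicographic comparison -/

theorem lexLt_nil_left (l : List ℤ) : lexLt [] l = false := rfl

theorem lexLt_nil_right (k : List ℤ) : lexLt k [] = false := by
  rcases k with _ | _ <;> rfl

theorem foldl_lexStep {s : ℤ} (hs : s ≠ 0) (l : List (ℤ × ℤ)) : l.foldl lexStep s = s := by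
  induction l with
  | nil => rfl
  | cons p l ih =>
    have : eqb s 0 = false := by rw [Bool.eq_false_iff, Ne, eqb_eq_true]; exact hs
    rw [List.foldl_cons, lexStep, this]; exact ih

theorem lexLt_cons {a b : ℤ} {k l : List ℤ} : lexLt (a :: k) (b :: l) = true ↔ a < b ∨ a = b ∧ lexLt k l = true := by
  have h0 : eqb 0 0 = true := by rw [eqb_eq_true]
  unfold lexLt
  rw [List.zip_cons_cons, List.foldl_cons]
  rcases lt_trichotomy a b with h | h | h
  · have h1 : ltb a b = true := by rwa [ltb_eq_true]
    have : lexStep 0 (a, b) = -1 := by simp [lexStep, h0, h1]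
    rw [this, foldl_lexStep (by norm_num)]
    simp [h, ltb_eq_true]
  · have h1 : ltb a b = false := by rw [Bool.eq_false_iff, Ne, ltb_eq_true]; omega
    have h2 : ltb b a = false := by rw [Bool.eq_false_iff, Ne, ltb_eq_true]; omega
    have : lexStep 0 (a, b) = 0 := by simp [lexStep, h0, h1, h2]
    rw [this]; simp [h]
  · have h1 : ltb a b = false := by rw [Bool.eq_false_iff, Ne, ltb_eq_true]; omega
    have h2 : ltb b a = true := by rwa [ltb_eq_true]
    have : lexStep 0 (a, b) = 1 := by simp [lexStep, h0, h1, h2]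
    rw [this, foldl_lexStep (by norm_num), ltb_eq_true]
    omega

theorem lexLt_iff {k l : List ℤ} : lexLt k l = true ↔ k < l ∧ ¬ k <+: l := by
  induction k generalizing l with
  | nil => simp [lexLt_nil_left]
  | cons a k ih =>
    rcases l with _ | ⟨b, l⟩
    · simp [lexLt_nil_right]
    · rw [lexLt_cons, ih, List.cons_lt_cons_iff, List.cons_prefix_cons]
      constructor
      · rintro (h | ⟨h, h1, h2⟩)
        · exact ⟨.inl h, fun h' => h.ne h'.1⟩
        · exact ⟨.inr ⟨h, h1⟩, fun h' => h2 h'.2⟩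
      · rintro ⟨h | ⟨h, h1⟩, h2⟩
        · exact .inl h
        · exact .inr ⟨h, h1, fun h' => h2 ⟨h, h'⟩⟩

/-! ### The keys -/

variable {ds ds' : List ℤ}

open Classical in
theorem count_eq {l : List El} {x : El} (hl : ∀ y ∈ l, Ok ds y) (hx : Ok ds x) :
    El.count ds l x = ((l.map (tg ds)).count (tg ds x) : ℕ) := by
  rw [El.count, List.count, List.countP_map, List.countP_eq_length_filter]
  congr 2
  refine List.filter_congr fun y hy => ?_
  rw [Bool.eq_iff_iff, eqG_iff hx (hl y hy)]
  simp only [Function.comp_apply, beq_iff_eq]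
  exact eq_comm

theorem indicator_eq_iff {b c b' c' : El} (h : El.eqG ds b c = true ↔ El.eqG ds' b' c' = true) :
    indicator ds b c = indicator ds' b' c' := by
  rw [indicator, indicator, Bool.eq_iff_iff.2 h]

/-- The key of a candidate in its own coordinates. -/
def mainKey (Δ B : ℕ) (ds : List ℤ) (rows : List El) (b : El) : List ℤ :=
  key ds rows b (prefixOf ds, cellsOf (range1 B) (elems (rangeZ Δ) ds))

theorem key_isoImage {rows rows' cs X : List El} {b b' : El} {e : Grid ds' ≃+ Grid ds} (hX : Describes X e)
    (hcs : ∀ c ∈ cs, IsCell ds' c) (hr : ∀ x ∈ rows, Ok ds x) (hr' : ∀ x ∈ rows', Ok ds' x) (hb : Ok ds b) (hb' : Ok ds' b')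
    (hp : (rows.map (tg ds)).Perm (rows'.map fun x => e (tg ds' x))) (he : tg ds b = e (tg ds' b')) :
    key ds rows b (prefixOf ds', isoImage ds X cs) = key ds' rows' b' (prefixOf ds', cs) := by
  classical
  unfold key isoImage
  dsimp only
  rw [List.map_map, List.map_map]
  congr 2
  · refine List.map_congr_left fun c hc => ?_
    have h1 : rows'.map (fun x => e (tg ds' x)) = (rows'.map (tg ds')).map e := by simp
    rw [Function.comp_apply, count_eq hr (ok_lin _ _), count_eq hr' (hcs c hc).ok, hX c (hcs c hc), hp.count_eq, h1,
      List.count_map_of_injective _ _ e.injective]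
  · refine List.map_congr_left fun c hc => indicator_eq_iff ?_
    rw [eqG_iff hb (ok_lin _ _), eqG_iff hb' (hcs c hc).ok, hX c (hcs c hc), he, e.injective.eq_iff]

/-- A candidate: a group `ℤ × ∏ ℤ / dᵢ`, the generators, and the right hand side. -/
structure IsCand (n Δ B : ℕ) (ds : List ℤ) (rows : List El) (b : El) : Prop where
  valid : Valid ds
  card : Nat.card (FinPart ds) ≤ Δ
  rows_mem : rows.reverse ∈ multisets (n + 1)
    (cellsOf (range1 (Δ / (elems (rangeZ Δ) ds).length)) (elems (rangeZ Δ) ds))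
  mem : b ∈ cellsOf (range1 B) (elems (rangeZ Δ) ds)

namespace IsCand
variable {n Δ B : ℕ} {rows rows' : List El} {b b' : El}

theorem le (h : IsCand n Δ B ds rows b) : ∀ q ∈ ds, q ≤ Δ := h.valid.le_of_card h.card

theorem length (h : IsCand n Δ B ds rows b) : rows.length = n + 1 := by
  rw [← List.length_reverse]; exact (of_mem_multisets h.rows_mem).1

theorem isCell (h : IsCand n Δ B ds rows b) : IsCell ds b := ((mem_cellsOf h.le).1 h.mem).2

theorem row_mem (h : IsCand n Δ B ds rows b) : ∀ x ∈ rows,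
    1 ≤ x.1 ∧ x.1 ≤ (Δ / (elems (rangeZ Δ) ds).length : ℕ) ∧ IsCell ds x := by
  intro x hx
  have h1 := (mem_cellsOf h.le).1 ((of_mem_multisets h.rows_mem).2 x (by simpa using hx))
  have h2 := mem_range1.1 h1.1
  exact ⟨h2.1, h2.2, h1.2⟩

theorem row_le (h : IsCand n Δ B ds rows b) : ∀ x ∈ rows, x.1 ≤ Δ := fun x hx =>
  (h.row_mem x hx).2.1.trans (by exact_mod_cast Nat.div_le_self _ _)

theorem isRows (h : IsCand n Δ B ds rows b) : IsRows ds Δ rows where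
  valid := h.valid
  ok x hx := (h.row_mem x hx).2.2.ok
  pos x hx := (h.row_mem x hx).1
  bound x hx := by
    rw [card_finPart h.valid h.le]
    have h1 := (h.row_mem x hx).2.1
    calc x.1 * ((elems (rangeZ Δ) ds).length : ℤ)
        ≤ (Δ / (elems (rangeZ Δ) ds).length : ℕ) * ((elems (rangeZ Δ) ds).length : ℤ) :=
          mul_le_mul_of_nonneg_right h1 (by positivity)
      _ ≤ Δ := by exact_mod_cast Nat.div_mul_le_self _ _

theorem cells (h : IsCand n Δ B ds rows b) : ∀ c ∈ cellsOf (range1 B) (elems (rangeZ Δ) ds), IsCell ds c := fun _ hc =>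
  ((mem_cellsOf h.le).1 hc).2

theorem exists_of_isRows (h : IsRows ds Δ rows) (hl : rows.length = n + 1) (hcell : ∀ x ∈ rows, IsCell ds x)
    (hb : IsCell ds b) (hb1 : 1 ≤ b.1) (hB : b.1 ≤ B) :
    ∃ rows', rows'.Perm rows ∧ IsCand n Δ B ds rows' b := by
  have hc : Nat.card (FinPart ds) ≤ Δ := by
    obtain ⟨x, hx⟩ := List.exists_mem_of_length_pos (by omega : 0 < rows.length)
    have h1 := h.bound x hx
    have h2 := h.pos x hx
    have : ((1 : ℤ)) * Nat.card (FinPart ds) ≤ x.1 * Nat.card (FinPart ds) := mul_le_mul_of_nonneg_right h2 (by positivity)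
    exact_mod_cast (by linarith : ((Nat.card (FinPart ds) : ℕ) : ℤ) ≤ Δ)
  have hq := h.valid.le_of_card hc
  have := h.valid.finite
  have hpos : 0 < (elems (rangeZ Δ) ds).length := by rw [← card_finPart h.valid hq]; exact Nat.card_pos
  obtain ⟨w, h1, h2⟩ := exists_perm_multisets (l := cellsOf (range1 (Δ / (elems (rangeZ Δ) ds).length)) (elems (rangeZ Δ) ds))
    hl fun x hx => by
      rw [mem_cellsOf hq, mem_range1]
      refine ⟨⟨h.pos x hx, ?_⟩, hcell x hx⟩
      have h3 := h.bound x hx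
      rw [card_finPart h.valid hq] at h3
      have h4 := h.pos x hx
      obtain ⟨m, hm⟩ := Int.eq_ofNat_of_zero_le h4.le
      rw [hm] at h3 ⊢
      exact_mod_cast (Nat.le_div_iff_mul_le hpos).2 (by exact_mod_cast h3)
  exact ⟨w.reverse, (List.reverse_perm w).trans h2, h.valid, hc, by rwa [List.reverse_reverse],
    (mem_cellsOf hq).2 ⟨mem_range1.2 ⟨hb1, hB⟩, hb⟩⟩

theorem eq_of_prefix (h : IsCand n Δ B ds rows b) (h' : IsCand n Δ B ds' rows' b') (hB : Δ ≤ B)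
    (hk : mainKey Δ B ds rows b <+: mainKey Δ B ds' rows' b') : ds = ds' ∧ rows = rows' ∧ b = b' := by
  classical
  have hds : ds = ds' := by
    have h1 : prefixOf ds <+: mainKey Δ B ds' rows' b' := (List.prefix_append _ _).trans hk
    simp only [mainKey, key, prefixOf, List.cons_append, List.cons_prefix_cons] at h1
    obtain ⟨h2, h3⟩ := h1
    have h2 : ds.length = ds'.length := by exact_mod_cast h2
    exact (List.prefix_of_prefix_length_le h3 (List.prefix_append _ _) h2.le).eq_of_length h2
  subst hds
  have h1 : mainKey Δ B ds rows b = mainKey Δ B ds rows' b' := hk.eq_of_length (by simp [mainKey, key])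
  simp only [mainKey, key] at h1
  obtain ⟨h2, h3⟩ := List.append_inj (List.append_cancel_left h1) (by simp)
  rw [List.map_inj_left] at h2 h3
  refine ⟨rfl, ?_, ?_⟩
  · refine List.reverse_injective (eq_of_perm_multisets (nodup_cellsOf ((pairwise_range1 _).imp fun h => h.ne) (nodup_elems _ _))
      h.rows_mem h'.rows_mem ?_)
    refine (List.reverse_perm _).trans (List.Perm.trans ?_ (List.reverse_perm _).symm)
    rw [List.perm_iff_count]
    have hc : ∀ {rows : List El} {b : El}, IsCand n Δ B ds rows b → ∀ c, IsCell ds c → El.count ds rows c = (rows.count c : ℕ) := by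
      intro rows b h c hc
      rw [El.count, List.count, List.countP_eq_length_filter]
      congr 2
      refine List.filter_congr fun y hy => ?_
      have hy' := (h.row_mem y hy).2.2
      rw [Bool.eq_iff_iff, eqG_iff hc.ok hy'.ok, beq_iff_eq]
      exact ⟨fun e => (hc.eq hy' e).symm, fun e => by rw [e]⟩
    have hmem : ∀ {rows : List El} {b : El}, IsCand n Δ B ds rows b → ∀ c ∈ rows,
        c ∈ cellsOf (range1 B) (elems (rangeZ Δ) ds) := fun h c hc =>
      (mem_cellsOf h.le).2 ⟨mem_range1.2 ⟨(h.row_mem c hc).1, (h.row_le c hc).trans (by exact_mod_cast hB)⟩, (h.row_mem c hc).2.2⟩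
    intro c
    by_cases hcm : c ∈ rows ∨ c ∈ rows'
    · have hcm : c ∈ cellsOf (range1 B) (elems (rangeZ Δ) ds) := hcm.elim (hmem h c) (hmem h' c)
      have h4 := h2 c hcm
      rw [hc h c (h.cells c hcm), hc h' c (h.cells c hcm)] at h4
      exact_mod_cast h4
    · push Not at hcm
      rw [List.count_eq_zero_of_not_mem hcm.1, List.count_eq_zero_of_not_mem hcm.2]
  · have h4 := h3 b h.mem
    have h5 : El.eqG ds b b = true := (eqG_iff h.isCell.ok h.isCell.ok).2 rfl
    rw [indicator, indicator, h5, cond_true] at h4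
    have h6 : El.eqG ds b' b = true := by
      by_contra h6
      rw [Bool.not_eq_true] at h6
      simp [h6] at h4
    exact (h'.isCell.eq h.isCell ((eqG_iff h'.isCell.ok h.isCell.ok).1 h6)).symm

theorem lexLt_mainKey (h : IsCand n Δ B ds rows b) (h' : IsCand n Δ B ds' rows' b') (hB : Δ ≤ B) :
    lexLt (mainKey Δ B ds rows b) (mainKey Δ B ds' rows' b') = true ↔ mainKey Δ B ds rows b < mainKey Δ B ds' rows' b' := by
  rw [lexLt_iff, and_iff_left_iff_imp]
  intro hlt hp
  obtain ⟨rfl, rfl, rfl⟩ := eq_of_prefix h h' hB hp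
  exact lt_irrefl _ hlt

end IsCand

/-- Isomorphic candidates. -/
def Isomorphic (ds : List ℤ) (rows : List El) (b : El) (ds' : List ℤ) (rows' : List El) (b' : El) : Prop :=
  ∃ e : Grid ds' ≃+ Grid ds, IsHeight e ∧ (rows.map (tg ds)).Perm (rows'.map fun x => e (tg ds' x)) ∧ tg ds b = e (tg ds' b')

theorem IsCand.canonTest_iff {n Δ B : ℕ} {rows : List El} {b : El} (h : IsCand n Δ B ds rows b) (hΔ : 1 ≤ Δ) (hB : Δ ≤ B) :
    canonTest ds (cellsOf (range1 B) (elems (rangeZ Δ) ds)) rows b (isosOf (range1 B) (groups Δ (Nat.log 2 Δ))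
      (ds, elems (rangeZ Δ) ds) (tuples (cellsOf [0, 1] (elems (rangeZ Δ) ds)) (Nat.log 2 Δ + 1))) = true ↔
    ∀ ds' rows' b', IsCand n Δ B ds' rows' b' → Isomorphic ds rows b ds' rows' b' →
      mainKey Δ B ds rows b ≤ mainKey Δ B ds' rows' b' := by
  rw [canonTest, List.all_eq_true]
  constructor
  · rintro H ds' rows' b' h' ⟨e, he, hp, hb⟩
    obtain ⟨X, hXl, hXm, hXi, hXd⟩ := exists_isIso h.valid h'.valid h.le h'.le he
    have hg := mem_groups h'.valid h'.card
    have h1 : 2 ^ ds'.length ≤ Δ := (two_pow_le_length_elems h'.valid h'.le).trans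
      (by rw [← card_finPart h'.valid h'.le]; exact h'.card)
    have h2 : ds'.length ≤ Nat.log 2 Δ := Nat.le_log_of_pow_le (by norm_num) h1
    have h3 := H (prefixOf ds', isoImage ds X (cellsOf (range1 B) (elems (rangeZ Δ) ds'))) (by
      rw [isosOf, List.mem_flatMap]
      refine ⟨_, hg, List.mem_map.2 ⟨X, List.mem_filter.2 ⟨mem_tuples.2 ⟨by omega, hXm⟩, hXi⟩, rfl⟩⟩)
    rw [key_isoImage hXd h'.cells h.isRows.ok h'.isRows.ok h.isCell.ok h'.isCell.ok hp hb] at h3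
    by_contra hlt
    rw [not_le, ← h'.lexLt_mainKey h hB] at hlt
    simp only [mainKey] at hlt
    rw [hlt] at h3
    simp at h3
  · intro H iso hiso
    rw [isosOf, List.mem_flatMap] at hiso
    obtain ⟨g, hg, hiso⟩ := hiso
    obtain ⟨X, hX, rfl⟩ := List.mem_map.1 hiso
    obtain ⟨hX1, hX2⟩ := List.mem_filter.1 hX
    obtain ⟨hv, hq, hg2, hgc⟩ := of_mem_groups_log hΔ hg
    obtain ⟨ds', F⟩ := g
    dsimp only at hv hq hg2 hgc ⊢
    subst hg2
    obtain ⟨e, he, hd⟩ := exists_equiv_of_isIso h.valid hv h.le hq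
      (fun x hx => ((mem_cellsOf h.le).1 ((mem_tuples.1 hX1).2 x hx)).2.ok) hX2
    have hrows : IsRows ds' Δ (rows.map fun x => rep ds' (e.symm (tg ds x))) := by
      refine ⟨hv, ?_, ?_, ?_⟩ <;> intro x hx <;> obtain ⟨y, hy, rfl⟩ := List.mem_map.1 hx
      · exact (isCell_rep hv _).ok
      · change 0 < (e.symm (tg ds y)).1
        rw [he.symm]; exact h.isRows.pos y hy
      · change (e.symm (tg ds y)).1 * _ ≤ _
        rw [he.symm, he.card_eq]; exact h.isRows.bound y hy
    have hb := mem_range1.1 ((mem_cellsOf h.le).1 h.mem).1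
    have hbe : (rep ds' (e.symm (tg ds b))).1 = b.1 := he.symm _
    obtain ⟨rows', hp, h'⟩ := IsCand.exists_of_isRows (n := n) (B := B) (b := rep ds' (e.symm (tg ds b))) hrows
      (by rw [List.length_map, h.length]) (by
        intro x hx
        obtain ⟨y, -, rfl⟩ := List.mem_map.1 hx
        exact isCell_rep hv _) (isCell_rep hv _) (by rw [hbe]; exact hb.1) (by rw [hbe]; exact hb.2)
    have hp' : (rows.map (tg ds)).Perm (rows'.map fun x => e (tg ds' x)) := by
      refine List.Perm.trans ?_ (hp.map _).symm
      rw [List.map_map]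
      refine List.Perm.of_eq (List.map_congr_left fun x _ => ?_)
      rw [Function.comp_apply, tg_rep hv, e.apply_symm_apply]
    have hb' : tg ds b = e (tg ds' (rep ds' (e.symm (tg ds b)))) := by rw [tg_rep hv, e.apply_symm_apply]
    have h1 := H ds' rows' _ h' ⟨e, he, hp', hb'⟩
    rw [key_isoImage hd h'.cells h.isRows.ok h'.isRows.ok h.isCell.ok h'.isCell.ok hp' hb']
    rw [← not_lt, ← h'.lexLt_mainKey h hB] at h1
    simp only [mainKey] at h1
    simpa using h1

end DeltaSimplex

namespace DeltaSimplex
open Matrix DeltaSimplex.System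

/-! ### Isomorphic candidates and their systems -/

theorem exists_equiv_of_ofFn_perm {m : ℕ} {T : Type*} {f g : Fin m → T} (h : (List.ofFn f).Perm (List.ofFn g)) :
    ∃ π : Equiv.Perm (Fin m), ∀ i, g (π i) = f i := by
  classical
  have hc : ∀ a, Fintype.card {i // f i = a} = Fintype.card {i // g i = a} := by
    intro a
    have h1 : ∀ f : Fin m → T, (List.ofFn f).count a = Fintype.card {i // f i = a} := by
      intro f
      rw [← Multiset.coe_count, ← Fin.univ_val_map, Multiset.count_map, Fintype.card_subtype, Finset.card, Finset.filter_val]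
      simp only [eq_comm]
    rw [← h1, ← h1]; exact h.count_eq a
  refine ⟨(Equiv.sigmaFiberEquiv f).symm.trans ((Equiv.sigmaCongrRight fun a => Fintype.equivOfCardEq (hc a)).trans
    (Equiv.sigmaFiberEquiv g)), fun i => ?_⟩
  exact (Fintype.equivOfCardEq (hc (f i)) ⟨i, rfl⟩).2

variable {ds ds' ds'' : List ℤ} {rows rows' rows'' : List El} {b b' b'' : El} {n Δ B : ℕ}

theorem map_tg_eq_ofFn (h : rows.length = n + 1) : rows.map (tg ds) = List.ofFn (gens ds n rows) := by
  refine List.ext_getElem (by simp [h]) fun i h1 h2 => ?_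
  rw [List.getElem_map, List.getElem_ofFn, gens_eq h]

theorem isomorphic_iff (h : rows.length = n + 1) (h' : rows'.length = n + 1) :
    Isomorphic ds rows b ds' rows' b' ↔ ∃ (e : Grid ds' ≃+ Grid ds) (π : Equiv.Perm (Fin (n + 1))), IsHeight e ∧
      (∀ i, e (gens ds' n rows' (π i)) = gens ds n rows i) ∧ e (tg ds' b') = tg ds b := by
  have key : ∀ e : Grid ds' ≃+ Grid ds, rows'.map (fun x => e (tg ds' x)) = List.ofFn fun i => e (gens ds' n rows' i) := by
    intro e
    have := congrArg (List.map e) (map_tg_eq_ofFn (ds := ds') h')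
    rw [List.map_map, List.map_ofFn] at this
    exact this
  constructor
  · rintro ⟨e, he, hp, hb⟩
    rw [map_tg_eq_ofFn h, key] at hp
    obtain ⟨π, hπ⟩ := exists_equiv_of_ofFn_perm hp
    exact ⟨e, π, he, hπ, hb.symm⟩
  · rintro ⟨e, π, he, hπ, hb⟩
    refine ⟨e, he, ?_, hb.symm⟩
    rw [map_tg_eq_ofFn h, key]
    have : gens ds n rows = (fun i => e (gens ds' n rows' i)) ∘ π := funext fun i => (hπ i).symm
    rw [this]
    exact π.ofFn_comp_perm _

theorem Isomorphic.refl (ds : List ℤ) (rows : List El) (b : El) : Isomorphic ds rows b ds rows b :=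
  ⟨AddEquiv.refl _, fun _ => rfl, List.Perm.refl _, rfl⟩

theorem Isomorphic.symm (h : Isomorphic ds rows b ds' rows' b') : Isomorphic ds' rows' b' ds rows b := by
  obtain ⟨e, he, hp, hb⟩ := h
  refine ⟨e.symm, he.symm, ?_, by rw [hb, e.symm_apply_apply]⟩
  have := (hp.map e.symm).symm
  simpa [List.map_map, Function.comp_def] using this

theorem Isomorphic.trans (h : Isomorphic ds rows b ds' rows' b') (h' : Isomorphic ds' rows' b' ds'' rows'' b'') :
    Isomorphic ds rows b ds'' rows'' b'' := by
  obtain ⟨e, he, hp, hb⟩ := h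
  obtain ⟨e', he', hp', hb'⟩ := h'
  refine ⟨e'.trans e, fun z => by rw [AddEquiv.trans_apply, he, he'], hp.trans ?_, by rw [hb, hb', AddEquiv.trans_apply]⟩
  have := hp'.map e
  simpa [List.map_map, Function.comp_def] using this

theorem isHeight_of_pos (hds : Valid ds) (hds' : Valid ds') (e : Grid ds' ≃+ Grid ds) {z : Grid ds'} (hz : 0 < z.1)
    (h : 0 < (e z).1) : IsHeight e := by
  have := hds.finite
  have := hds'.finite
  have h1 : ∀ z, (e z).1 = z.1 * (e (1, 0)).1 := hom_apply ((AddMonoidHom.fst ℤ (FinPart ds)).comp e.toAddMonoidHom)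
  have h2 : (e (1, 0)).1 ∣ 1 := by
    have h3 := h1 (e.symm (1, 0))
    rw [e.apply_symm_apply] at h3
    exact ⟨(e.symm (1, 0)).1, by rw [mul_comm]; exact h3⟩
  have h3 : 0 < (e (1, 0)).1 := by
    rw [h1] at h
    exact pos_of_mul_pos_right h hz.le
  have h4 : (e (1, 0)).1 = 1 := Int.eq_one_of_dvd_one h3.le h2
  intro z
  rw [h1, h4, mul_one]

section
variable {G G' : Type*} [AddCommGroup G] [AddCommGroup G'] {g : Fin (n + 1) → G} {g' : Fin (n + 1) → G'} {f : G ≃+ G'}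
  {π : Equiv.Perm (Fin (n + 1))}

theorem comb_of_equiv (hf : ∀ i, f (g (π i)) = g' i) (y : Fin (n + 1) → ℤ) : comb g' y = f (comb g (y ∘ π.symm)) := by
  have hg : g' = f ∘ g ∘ π := funext fun i => (hf i).symm
  rw [comb_symm, hg]
  exact (map_comb f.toAddMonoidHom (g ∘ π) y).symm

theorem surjective_comb_of_equiv (hf : ∀ i, f (g (π i)) = g' i) (h : Function.Surjective (comb g)) :
    Function.Surjective (comb g') := by
  intro z
  obtain ⟨y, hy⟩ := h (f.symm z)
  refine ⟨y ∘ π, ?_⟩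
  rw [comb_of_equiv hf, Function.comp_assoc]
  simp [hy]

theorem InSemigroup.of_equiv (hf : ∀ i, f (g (π i)) = g' i) {z : G} : InSemigroup g' (f z) → InSemigroup g z := by
  rintro ⟨y, hy, hz⟩
  rw [comb_of_equiv hf] at hz
  exact ⟨_, fun i => hy _, f.injective hz⟩

theorem LatticeCond.of_equiv (hf : ∀ i, f (g (π i)) = g' i) {z : G} (h : LatticeCond g z) : LatticeCond g' (f z) := by
  refine ⟨fun i => ?_, fun y hy hz => ?_⟩
  · obtain ⟨t, ht⟩ := h.1 (π i)
    exact ⟨t, by rw [← hf, ← ht, map_zsmul]⟩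
  · rw [comb_of_equiv hf] at hz
    obtain ⟨i, hi⟩ := h.2 _ (fun i => hy _) (f.injective hz)
    refine ⟨π.symm i, fun j hj => ?_⟩
    have := hi (π j) fun e => hj (by rw [← e]; simp)
    simpa using this

end

theorem System.Equivalent.reduced {σ τ : System n} (h : σ.Equivalent τ) (hr : σ.Reduced) : τ.Reduced := by
  obtain ⟨π, U, x₀, hU, hA, hb⟩ := h
  intro i k hk
  refine hr.pullback hU (-x₀) (π i) k ?_
  rw [forall_dvd_row] at hk ⊢
  refine ⟨fun j => ?_, ?_⟩
  · have := hk.1 j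
    rw [hA] at this
    exact this
  · have := hk.2
    rw [hb] at this
    simpa [System.pullback, mulVec_neg] using this

theorem divAll_eq_true {row : List ℤ} {k : ℤ} : divAll row k = true ↔ ∀ z ∈ row, k ∣ z := by
  rw [divAll, List.all_eq_true]
  refine forall₂_congr fun z _ => ?_
  rw [eqb_eq_true]
  exact ⟨fun h => ⟨z / k, by omega⟩, fun h => by rw [Int.mul_ediv_cancel' h, sub_self]⟩

theorem reducedTest_iff {M : List (List ℤ)} (hM : M.length = n + 1) (hr : ∀ r ∈ M, r.length = n + 1) :
    reducedTest (range2 Δ) M = true ↔ ∀ i (k : ℤ), 2 ≤ k → k ≤ Δ → ¬ ∀ j, k ∣ (ofRows n M).row i j := by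
  rw [reducedTest, List.all_eq_true]
  have hrow : ∀ (i : Fin (n + 1)) (k : ℤ), (∀ j, k ∣ (ofRows n M).row i j) ↔ divAll (M[i.1]'(by omega)) k = true := by
    intro i k
    have hi : i.1 < M.length := by omega
    have hl := hr _ (List.getElem_mem hi)
    have h1 : ∀ j : Fin (n + 1), (ofRows n M).row i j = (M[i.1])[j.1] := by
      intro j
      rw [← List.getD_eq_getElem (d := 0), ← List.getD_eq_getElem (d := [])]
      refine Fin.lastCases ?_ (fun j => ?_) j
      · simp [System.row, ofRows]
      · simp [System.row, ofRows]
    rw [divAll_eq_true]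
    constructor
    · intro h z hz
      obtain ⟨j, hj, rfl⟩ := List.mem_iff_getElem.1 hz
      have := h ⟨j, by omega⟩
      rwa [h1] at this
    · intro h j
      rw [h1]; exact h _ (List.getElem_mem _)
  constructor
  · intro H i k h2 hk
    have := H _ (List.getElem_mem (by omega : i.1 < M.length))
    rw [List.all_eq_true] at this
    have := this k (mem_range2.2 ⟨h2, hk⟩)
    rw [hrow]
    simpa using this
  · intro H r hr
    obtain ⟨i, hi, rfl⟩ := List.mem_iff_getElem.1 hr
    rw [List.all_eq_true]
    intro k hk
    have h2 := mem_range2.1 hk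
    have := H ⟨i, by omega⟩ k h2.1 h2.2
    rw [hrow] at this
    simpa using this

end DeltaSimplex

namespace DeltaSimplex
open Matrix Enc DeltaSimplex.System

/-! ### The candidates and the output -/

theorem flatMap_cond {β γ : Type} (p : β → Bool) (f : β → γ) (l : List β) :
    (l.flatMap fun b => bif p b then [f b] else []) = (l.filter p).map f := by
  induction l with
  | nil => rfl
  | cons b l ih => rcases h : p b <;> simp [h, ih]

theorem cond_flatMap_cond {β γ : Type} (q : Bool) (p : β → Bool) (f : β → γ) (l : List β) :
    (bif q then l.flatMap fun b => bif p b then [f b] else [] else []) = (l.filter fun b => q && p b).map f := by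
  rcases q with _ | _
  · simp
  · exact flatMap_cond p f l

abbrev Cand := List ℤ × (List El × El)

/-- All candidates. -/
def candidates (n Δ B : ℕ) : List Cand :=
  (groups Δ (Nat.log 2 Δ)).flatMap fun g => (multisets (n + 1) (cellsOf (smallHeights (range1 Δ) g.2) g.2)).flatMap fun w =>
    (cellsOf (range1 B) g.2).map fun b => (g.1, (w.reverse, b))

def candBasis (Δ : ℕ) (ds : List ℤ) (rows : List El) : List (List ℤ) × List (List ℤ) :=
  basis ds (rows.headD (0, [])) rows.tail (rangeZ Δ) (range1 Δ)

/-- The extended matrix of a candidate. -/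
def outMatrix (Δ : ℕ) (c : Cand) : List (List ℤ) := candMatrix c.1 c.2.1 (candBasis Δ c.1 c.2.1) c.2.2

def candReach (Δ B : ℕ) (c : Cand) : List El :=
  reach c.1 (cellsOf (rangeZ (B + 1)) (elems (rangeZ Δ) c.1)) c.2.1 (rangeZ (B + 1))

def emptyGeom (Δ B : ℕ) (c : Cand) : Bool := emptyTest c.1 (candReach Δ B c) c.2.2

def latticeGeom (Δ B : ℕ) (c : Cand) : Bool := latticeTest c.1 c.2.1 (candReach Δ B c) c.2.2

/-- The candidates that contribute to the output. -/
def accepted (Δ B : ℕ) (geom : Cand → Bool) (c : Cand) : Bool :=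
  generates c.1 c.2.1 (cellsOf (range1 B) (elems (rangeZ Δ) c.1)) (candBasis Δ c.1 c.2.1).1 &&
    (geom c && (reducedTest (range2 Δ) (outMatrix Δ c) &&
      canonTest c.1 (cellsOf (range1 B) (elems (rangeZ Δ) c.1)) c.2.1 c.2.2 (isosOf (range1 B) (groups Δ (Nat.log 2 Δ))
        (c.1, elems (rangeZ Δ) c.1) (tuples (cellsOf [0, 1] (elems (rangeZ Δ) c.1)) (Nat.log 2 Δ + 1)))))

/-- The systems that are found. -/
def output (n Δ B : ℕ) (geom : Cand → Bool) : List (List (List ℤ)) :=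
  ((candidates n Δ B).filter (accepted Δ B geom)).map (outMatrix Δ)

theorem items_flatMap (a : Input) (f : Item → List (List (List ℤ))) (hf : ∀ x s rows, f (x, (s, rows)) = f (x, ([], rows)))
    (geom : Cand → Bool)
    (h : ∀ ds rows, f ((a.rng, mkGrp a.rng.2.2.2 a.heights a.grps
        ((ds, elems (rangeZ a.1.2) ds), tuples (cellsOf [0, 1] (elems (rangeZ a.1.2) ds)) (a.log + 1))), ([], rows)) =
      (((cellsOf a.heights (elems (rangeZ a.1.2) ds)).map fun b => (ds, (rows, b))).filter
        (accepted a.1.2 a.bound geom)).map (outMatrix a.1.2)) :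
    a.items.flatMap f = output a.1.1 a.1.2 a.bound geom := by
  have h1 : a.items.flatMap f = (a.items.map fun i => (i.1, i.2.2)).flatMap fun p => f (p.1, ([], p.2)) := by
    rw [List.flatMap_map]
    congr 1
    funext i
    exact hf _ _ _
  rw [h1, Input.items, Input.itemsAfter, iterate_itemStep_list, Input.items₀, groupTuples, List.map_map, List.flatMap_map,
    List.flatMap_assoc, output, candidates, List.filter_flatMap, List.map_flatMap]
  refine List.flatMap_congr fun g hg => ?_
  obtain ⟨ds, F⟩ := g
  obtain ⟨-, -, hF, -⟩ := of_mem_groups_log a.2.2 hg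
  dsimp only at hF
  subst hF
  rw [List.flatMap_map, List.filter_flatMap, List.map_flatMap]
  refine List.flatMap_congr fun w _ => ?_
  simp only [Function.comp_apply, mkItem, List.append_nil]
  exact h ds w.reverse

theorem items_emptyOf (a : Input) : a.items.flatMap emptyOf = output a.1.1 a.1.2 a.bound (emptyGeom a.1.2 a.bound) :=
  items_flatMap a emptyOf (fun _ _ _ => rfl) _ fun ds rows => by
    rw [List.filter_map, List.map_map]
    exact cond_flatMap_cond _ _ _ _

theorem items_latticeOf (a : Input) :
    a.items.flatMap latticeOf = output a.1.1 a.1.2 a.bound (latticeGeom a.1.2 a.bound) :=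
  items_flatMap a latticeOf (fun _ _ _ => rfl) _ fun ds rows => by
    rw [List.filter_map, List.map_map]
    exact cond_flatMap_cond _ _ _ _

theorem mem_candidates {n Δ B : ℕ} (hΔ : 1 ≤ Δ) {c : Cand} : c ∈ candidates n Δ B ↔ IsCand n Δ B c.1 c.2.1 c.2.2 := by
  have hlen : ∀ {ds : List ℤ}, Valid ds → Nat.card (FinPart ds) ≤ Δ → smallHeights (range1 Δ) (elems (rangeZ Δ) ds) =
      range1 (Δ / (elems (rangeZ Δ) ds).length) := by
    intro ds hv hc
    have := hv.finite
    refine smallHeights_eq ?_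
    rw [← card_finPart hv (hv.le_of_card hc)]
    exact Nat.card_pos
  rw [candidates, List.mem_flatMap]
  constructor
  · rintro ⟨⟨ds, F⟩, hg, h⟩
    obtain ⟨hv, -, hF, hc⟩ := of_mem_groups_log hΔ hg
    dsimp only at hv hF hc h
    subst hF
    rw [hlen hv hc, List.mem_flatMap] at h
    obtain ⟨w, hw, h⟩ := h
    obtain ⟨b, hb, rfl⟩ := List.mem_map.1 h
    exact ⟨hv, hc, by rwa [List.reverse_reverse], hb⟩
  · intro h
    refine ⟨_, mem_groups h.valid h.card, ?_⟩
    dsimp only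
    rw [hlen h.valid h.card, List.mem_flatMap]
    exact ⟨_, h.rows_mem, List.mem_map.2 ⟨_, h.mem, by rw [List.reverse_reverse]⟩⟩

theorem nodup_candidates {n Δ B : ℕ} (hΔ : 1 ≤ Δ) : (candidates n Δ B).Nodup := by
  have h1 : ∀ k, (range1 k).Nodup := fun k => (pairwise_range1 k).imp fun h => h.ne
  rw [candidates, List.nodup_flatMap]
  constructor
  · intro g hg
    have hF : g.2.Nodup := by rw [(of_mem_groups_log hΔ hg).2.2.1]; exact nodup_elems _ _
    rw [List.nodup_flatMap]
    constructor
    · intro w _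
      exact (nodup_cellsOf (h1 B) hF).map fun b b' h => (Prod.mk.inj (Prod.mk.inj h).2).2
    · refine (nodup_multisets _ (nodup_cellsOf ((h1 Δ).filter _) hF)).imp fun {w w'} hw x hx hx' => hw ?_
      obtain ⟨b, -, rfl⟩ := List.mem_map.1 hx
      obtain ⟨b', -, h⟩ := List.mem_map.1 hx'
      exact (List.reverse_injective (Prod.mk.inj (Prod.mk.inj h).2).1).symm
  · refine (List.pairwise_map.1 (nodup_groups Δ (Nat.log 2 Δ))).imp fun {g g'} hg x hx hx' => hg ?_
    simp only [List.mem_flatMap, List.mem_map] at hx hx'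
    obtain ⟨w, -, b, -, rfl⟩ := hx
    obtain ⟨w', -, b', -, h⟩ := hx'
    exact (Prod.mk.inj h).1.symm

namespace IsCand
variable {n Δ B : ℕ} {ds : List ℤ} {rows : List El} {b : El}

/-- The system of a candidate presents its data. -/
theorem presents (h : IsCand n Δ B ds rows b) (hs : Function.Surjective (comb (gens ds n rows))) :
    (ofRows n (outMatrix Δ (ds, (rows, b)))).Presents (gens ds n rows) (tg ds b) := by
  have hl := h.length
  have hr := h.isRows
  rcases rows with _ | ⟨r₀, gs⟩
  · simp at hl
  · exact hr.presents (by simpa using hl) hs h.isCell.ok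

theorem length_outMatrix (h : IsCand n Δ B ds rows b) : (outMatrix Δ (ds, (rows, b))).length = n + 1 := by
  rw [outMatrix, length_candMatrix, h.length]

theorem length_of_mem_outMatrix (h : IsCand n Δ B ds rows b) : ∀ r ∈ outMatrix Δ (ds, (rows, b)), r.length = n + 1 := by
  intro r hr
  rw [length_of_mem_candMatrix r hr]
  have hl := h.length
  have hr := h.isRows
  rcases rows with _ | ⟨r₀, gs⟩
  · simp at hl
  · have h1 := hr.isTriangular_basis.length_cols
    simp only [candBasis, List.headD_cons, List.tail_cons]
    rw [h1]; simpa using hl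

theorem height_pos (h : IsCand n Δ B ds rows b) : 0 < (tg ds b).1 := (mem_range1.1 ((mem_cellsOf h.le).1 h.mem).1).1

theorem height_le (h : IsCand n Δ B ds rows b) : b.1 ≤ B := (mem_range1.1 ((mem_cellsOf h.le).1 h.mem).1).2

theorem isPos (h : IsCand n Δ B ds rows b) (hs : Function.Surjective (comb (gens ds n rows))) :
    (ofRows n (outMatrix Δ (ds, (rows, b)))).IsPos fun i => (gens ds n rows i).1 :=
  (h.presents hs).isPos (h.isRows.gens_pos h.length) h.height_pos

theorem abs_minor_le (h : IsCand n Δ B ds rows b) (hs : Function.Surjective (comb (gens ds n rows))) (i : Fin (n + 1)) :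
    |(ofRows n (outMatrix Δ (ds, (rows, b)))).minor i| ≤ Δ := by
  rw [(h.presents hs).abs_minor (h.isRows.gens_pos h.length) h.height_pos]
  exact h.isRows.gens_bound h.length i

theorem accepted_iff (h : IsCand n Δ B ds rows b) (hn : 1 ≤ n) (hΔ : 1 ≤ Δ) (hB : Δ ≤ B) {geom : Cand → Bool} :
    accepted Δ B geom (ds, (rows, b)) = true ↔ Function.Surjective (comb (gens ds n rows)) ∧ geom (ds, (rows, b)) = true ∧
      (ofRows n (outMatrix Δ (ds, (rows, b)))).Reduced ∧ ∀ ds' rows' b', IsCand n Δ B ds' rows' b' →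
        Isomorphic ds rows b ds' rows' b' → mainKey Δ B ds rows b ≤ mainKey Δ B ds' rows' b' := by
  have hgen : generates ds rows (cellsOf (range1 B) (elems (rangeZ Δ) ds)) (candBasis Δ ds rows).1 = true ↔
      Function.Surjective (comb (gens ds n rows)) := by
    have hl := h.length
    have hr := h.isRows
    rcases rows with _ | ⟨r₀, gs⟩
    · simp at hl
    · exact hr.generates_iff (by simpa using hl) h.le (by omega)
  simp only [accepted, Bool.and_eq_true]
  rw [hgen, h.canonTest_iff hΔ hB, reducedTest_iff h.length_outMatrix h.length_of_mem_outMatrix]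
  refine and_congr_right fun hs => ?_
  rw [reduced_iff hn (h.isPos hs) (h.abs_minor_le hs)]

end IsCand

/-- The output contains one representative of every class. -/
theorem listsRepresentatives {n Δ : ℕ} (hn : 1 ≤ n) (hΔ : 1 ≤ Δ) (P : Set (Fin n → ℝ) → Prop)
    (Q : ∀ ds : List ℤ, (Fin (n + 1) → Grid ds) → Grid ds → Prop)
    (hP : ∀ (σ : System n) ds g β, σ.Presents g β → (∀ i, 0 < (g i).1) → 0 < β.1 → (P σ.polyhedron ↔ Q ds g β))
    (hQ : ∀ ds ds' (f : Grid ds ≃+ Grid ds') (π : Equiv.Perm (Fin (n + 1))) g g' β, (∀ i, f (g (π i)) = g' i) → Q ds g β →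
      Q ds' g' (f β))
    (hle : ∀ ds (g : Fin (n + 1) → Grid ds) (β : Grid ds), Valid ds → (∀ i, 0 < (g i).1) →
      (∀ i, (g i).1 * (Nat.card (FinPart ds) : ℤ) ≤ Δ) →
      Function.Surjective (comb g) → Q ds g β → β.1 ≤ n * Δ * Δ)
    (geom : Cand → Bool) (hgeom : ∀ ds rows b, IsCand n Δ (n * Δ * Δ) ds rows b →
      (geom (ds, (rows, b)) = true ↔ Q ds (gens ds n rows) (tg ds b))) :
    ListsRepresentatives Δ (fun S => IsModularSimplex Δ S ∧ P S) ((output n Δ (n * Δ * Δ) geom).map (ofRows n)) := by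
  set B := n * Δ * Δ with hBdef
  have hB : Δ ≤ B := Nat.le_mul_of_pos_left _ (Nat.mul_pos hn hΔ)
  rw [output, List.map_map]
  refine ⟨fun σ hσ => ?_, ?_, ?_⟩
  · obtain ⟨⟨ds, rows, b⟩, hc, rfl⟩ := List.mem_map.1 hσ
    obtain ⟨hc, hacc⟩ := List.mem_filter.1 hc
    have h : IsCand n Δ B ds rows b := (mem_candidates hΔ).1 hc
    obtain ⟨hs, hg, -, -⟩ := (h.accepted_iff hn hΔ hB).1 hacc
    have hm := (h.isPos hs).isModular_iff.2 (h.abs_minor_le hs)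
    refine ⟨hm, ⟨(h.isPos hs).isSimplex, _, hm, rfl⟩, ?_⟩
    exact (hP _ _ _ _ (h.presents hs) (h.isRows.gens_pos h.length) h.height_pos).2 ((hgeom _ _ _ h).1 hg)
  · rintro S ⟨⟨hS, σ, hσ, rfl⟩, hPS⟩
    obtain ⟨w₀, hw₀⟩ := exists_isPos hn hσ.1 hS
    obtain ⟨τ, w, hw, hred, hpoly, hmin⟩ := exists_reduced hw₀
    obtain ⟨ds₀, g, β, hv, hp, hg, hβ⟩ := hw.exists_presents
    have hbd : ∀ i, (g i).1 * Nat.card (FinPart ds₀) ≤ Δ := fun i => by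
      rw [← hp.abs_minor hg hβ]
      exact (hmin i).trans (hw₀.isModular_iff.1 hσ i)
    rw [← hpoly] at hPS ⊢
    have hQ₀ := (hP _ _ _ _ hp hg hβ).1 hPS
    have hβB : β.1 ≤ B := by
      have := hle _ _ _ hv hg hbd hp.surj hQ₀
      rw [hBdef]; push_cast; exact this
    set rows₁ := List.ofFn fun i => rep ds₀ (g i) with hrows₁
    have hlen₁ : rows₁.length = n + 1 := by simp [hrows₁]
    have hmem₁ : ∀ x ∈ rows₁, ∃ i, rep ds₀ (g i) = x := fun x hx => List.mem_ofFn.1 hx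
    have hR : IsRows ds₀ Δ rows₁ := by
      refine ⟨hv, ?_, ?_, ?_⟩ <;> intro x hx <;> obtain ⟨i, rfl⟩ := hmem₁ x hx
      exacts [(isCell_rep hv _).ok, hg i, hbd i]
    obtain ⟨rows₀, hperm, h₀⟩ := IsCand.exists_of_isRows (n := n) (B := B) (b := rep ds₀ β) hR hlen₁
      (fun x hx => by obtain ⟨i, rfl⟩ := hmem₁ x hx; exact isCell_rep hv _) (isCell_rep hv _) hβ hβB
    have hiso₁ : Isomorphic ds₀ rows₀ (rep ds₀ β) ds₀ rows₁ (rep ds₀ β) :=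
      ⟨AddEquiv.refl _, fun _ => rfl, hperm.map _, rfl⟩
    have hgens₁ : gens ds₀ n rows₁ = g := by
      funext i
      rw [gens_eq hlen₁, ← tg_rep hv (g i)]
      congr 1
      exact List.getElem_ofFn _
    classical
    obtain ⟨⟨ds, rows, b⟩, hc, hmn⟩ := Finset.exists_min_image
      ((candidates n Δ B).toFinset.filter fun c => Isomorphic ds₀ rows₀ (rep ds₀ β) c.1 c.2.1 c.2.2)
      (fun c => mainKey Δ B c.1 c.2.1 c.2.2) ⟨(ds₀, (rows₀, rep ds₀ β)), by
        rw [Finset.mem_filter, List.mem_toFinset, mem_candidates hΔ]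
        exact ⟨h₀, Isomorphic.refl _ _ _⟩⟩
    rw [Finset.mem_filter, List.mem_toFinset, mem_candidates hΔ] at hc
    obtain ⟨h, hiso⟩ := hc
    dsimp only at h hiso
    obtain ⟨e, π, -, hπ, hb⟩ := (isomorphic_iff h.length hlen₁).1 (hiso.symm.trans hiso₁)
    rw [hgens₁] at hπ
    rw [tg_rep hv] at hb
    have hs := surjective_comb_of_equiv hπ hp.surj
    have heq := hp.equivalent (h.presents hs) e π hπ hb
    refine ⟨_, List.mem_map.2 ⟨(ds, (rows, b)), List.mem_filter.2 ⟨(mem_candidates hΔ).2 h, ?_⟩, rfl⟩, heq.unimodularEquiv⟩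
    rw [h.accepted_iff hn hΔ hB]
    refine ⟨hs, (hgeom _ _ _ h).2 (hb ▸ hQ _ _ e π _ _ _ hπ hQ₀), heq.reduced hred, fun ds' rows' b' h' hiso' => ?_⟩
    refine hmn (ds', (rows', b')) ?_
    rw [Finset.mem_filter, List.mem_toFinset, mem_candidates hΔ]
    exact ⟨h', hiso.trans hiso'⟩
  · rw [List.pairwise_map]
    refine List.Pairwise.imp_of_mem ?_ ((nodup_candidates hΔ).filter _)
    rintro ⟨ds, rows, b⟩ ⟨ds', rows', b'⟩ hc hc' hne hequiv
    obtain ⟨hc, hacc⟩ := List.mem_filter.1 hc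
    obtain ⟨hc', hacc'⟩ := List.mem_filter.1 hc'
    have h : IsCand n Δ B ds rows b := (mem_candidates hΔ).1 hc
    have h' : IsCand n Δ B ds' rows' b' := (mem_candidates hΔ).1 hc'
    obtain ⟨hs, -, hr, hcan⟩ := (h.accepted_iff hn hΔ hB).1 hacc
    obtain ⟨hs', -, hr', hcan'⟩ := (h'.accepted_iff hn hΔ hB).1 hacc'
    obtain ⟨f, π, hπ, hf⟩ := (h'.presents hs').exists_equiv (h.presents hs)
      (equivalent_of_unimodularEquiv (h.isPos hs) (h'.isPos hs') hr hr' hequiv)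
    have hiso : Isomorphic ds rows b ds' rows' b' := (isomorphic_iff h.length h'.length).2
      ⟨f, π, isHeight_of_pos h.valid h'.valid f h'.height_pos (by rw [hf]; exact h.height_pos), hπ, hf⟩
    have hkey := le_antisymm (hcan _ _ _ h' hiso) (hcan' _ _ _ h hiso.symm)
    obtain ⟨rfl, rfl, rfl⟩ := h.eq_of_prefix h' hB (hkey ▸ List.prefix_refl _)
    exact hne rfl

theorem emptyGeom_iff {n Δ B : ℕ} {ds : List ℤ} {rows : List El} {b : El} (h : IsCand n Δ B ds rows b) :
    emptyGeom Δ B (ds, (rows, b)) = true ↔ ¬ InSemigroup (gens ds n rows) (tg ds b) :=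
  h.isRows.emptyTest_iff h.length h.le h.isCell.ok h.height_le

theorem latticeGeom_iff {n Δ B : ℕ} {ds : List ℤ} {rows : List El} {b : El} (h : IsCand n Δ B ds rows b) :
    latticeGeom Δ B (ds, (rows, b)) = true ↔ LatticeCond (gens ds n rows) (tg ds b) :=
  h.isRows.latticeTest_iff h.length h.le h.isCell.ok h.height_le

theorem listsRepresentatives_empty {n Δ : ℕ} (hn : 1 ≤ n) (hΔ : 1 ≤ Δ) : ListsRepresentatives Δ (IsModularEmptySimplex Δ)
    ((output n Δ (n * Δ * Δ) (emptyGeom Δ (n * Δ * Δ))).map (ofRows n)) :=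
  listsRepresentatives hn hΔ (fun S => S ∩ integerPoints n = ∅) (fun _ g β => ¬ InSemigroup g β)
    (fun _ _ _ _ h _ _ => h.inter_eq_empty_iff) (fun _ _ _ _ _ _ _ hf h h' => h (h'.of_equiv hf))
    (fun _ _ _ hv hg hb hs h => by have := hv.finite; exact fst_le_of_not_inSemigroup hg hb hs h) _ fun _ _ _ h => emptyGeom_iff h

theorem listsRepresentatives_lattice {n Δ : ℕ} (hn : 1 ≤ n) (hΔ : 1 ≤ Δ) :
    ListsRepresentatives Δ (IsModularEmptyLatticeSimplex Δ)
      ((output n Δ (n * Δ * Δ) (latticeGeom Δ (n * Δ * Δ))).map (ofRows n)) :=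
  listsRepresentatives hn hΔ (fun S => S.extremePoints ℝ ⊆ integerPoints n ∧ S ∩ integerPoints n = S.extremePoints ℝ)
    (fun _ g β => LatticeCond g β) (fun _ _ _ _ h hg hβ => h.lattice_iff (h.isPos hg hβ))
    (fun _ _ _ _ _ _ _ hf h => h.of_equiv hf)
    (fun _ _ _ hv hg hb _ h => by have := hv.finite; exact fst_le_of_latticeCond hn hg hb h) _ fun _ _ _ h => latticeGeom_iff h

theorem encodeList_output {n Δ B : ℕ} (hΔ : 1 ≤ Δ) (geom : Cand → Bool) :
    encodeList ((output n Δ B geom).map (ofRows n)) = enc (output n Δ B geom) := by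
  rw [encodeList, List.map_map]
  refine congrArg Val.ofList (List.map_congr_left fun M hM => ?_)
  obtain ⟨⟨ds, rows, b⟩, hc, rfl⟩ := List.mem_map.1 hM
  have h := (mem_candidates hΔ).1 (List.mem_filter.1 hc).1
  exact encode_ofRows h.length_outMatrix h.length_of_mem_outMatrix

end DeltaSimplex

theorem theorem3 :
    ∃ (p : DeltaSimplex.Prog) (T : ℕ → ℕ → ℕ),
      (∀ n Δ : ℕ, 1 ≤ n → 1 ≤ Δ → DeltaSimplex.Enumerates p n Δ (T n Δ)) ∧
      (∃ C : ℝ, 0 < C ∧ ∀ n Δ : ℕ, 1 ≤ n → 1 ≤ Δ →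
        (T n Δ : ℝ) ≤
          C * (C * ((n : ℝ) + (Δ : ℝ))) ^ (Δ - 1) * (n : ℝ) ^ (Real.logb 2 (Δ : ℝ) + C)) ∧
      (∀ Δ : ℕ, 1 ≤ Δ → ∃ q : Polynomial ℕ, ∀ n : ℕ, 1 ≤ n → T n Δ ≤ q.eval n) := by
  obtain ⟨p, c, h⟩ := DeltaSimplex.exists_main_prog
  have h' : ∀ n Δ : ℕ, ∃ t, 1 ≤ n → 1 ≤ Δ →
      t ≤ (n + Δ) ^ (Δ - 1) * (n * 2 ^ Δ + 2) ^ c ∧ DeltaSimplex.Enumerates p n Δ t := by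
    intro n Δ
    by_cases hnΔ : 1 ≤ n ∧ 1 ≤ Δ
    · obtain ⟨t, ht, hr⟩ := h ⟨(n, Δ), hnΔ⟩
      rw [DeltaSimplex.items_emptyOf, DeltaSimplex.items_latticeOf] at hr
      refine ⟨t, fun _ _ => ⟨ht, _, _, DeltaSimplex.listsRepresentatives_empty hnΔ.1 hnΔ.2,
        DeltaSimplex.listsRepresentatives_lattice hnΔ.1 hnΔ.2, ?_⟩⟩
      rw [DeltaSimplex.encodeList_output hnΔ.2, DeltaSimplex.encodeList_output hnΔ.2]
      exact hr
    · exact ⟨0, fun hn hΔ => (hnΔ ⟨hn, hΔ⟩).elim⟩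
  choose T hT using h'
  obtain ⟨C, hC, hb⟩ := DeltaSimplex.time_bound c
  refine ⟨p, T, fun n Δ hn hΔ => (hT n Δ hn hΔ).2, ⟨C, hC, fun n Δ hn hΔ => hb n Δ _ hn hΔ (hT n Δ hn hΔ).1⟩, fun Δ hΔ => ?_⟩
  obtain ⟨q, hq⟩ := DeltaSimplex.time_polynomial c Δ
  exact ⟨q, fun n hn => hq n _ (hT n Δ hn hΔ).1⟩
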